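/- Let $L>0$, let $T\subseteq\mathbb R$ be an open set of times, and let $q=q(x,t)$ be, for $t\in T$, a classical solution of the defocusing NLS equation $\mathrm i q_t+q_{xx}-2|q|^2q=0$ with $q(x+L,t)=q(x,t)$ (that is, $q(\cdot,t)\in C^2$ for every $t\in T$, $q$ is differentiable in $t$, and $q,q_x,q_{xx}$ are continuous on $\mathbb R\times T$). Put $$\sigma_3=\begin{pmatrix}1&0\\0&-1\end{pmatrix},\qquad Q=\begin{pmatrix}0&q\\q^*&0\end{pmatrix},\qquad U=\begin{pmatrix}1&1\\-\mathrm i&\mathrm i\end{pmatrix},$$ $$\mathcal A=2\mathrm i\sigma_3\partial_x^2+2\mathrm iQ\sigma_3\partial_x-\mathrm i(Q^2-Q_x)\sigma_3,\qquad \tilde{\mathcal A}=U\mathcal AU^{-1}.$$ Let $Y(x,t,z)$ be the solution of $Y_x=(-\mathrm iz\sigma_3+Q)Y$ with $Y(0,t,z)=\mathbb I$, let $\tilde Y=UYU^{-1}=(\tilde y_{ij})$, and let $\Delta=\tfrac12\operatorname{tr}Y(L,t,z)$. Let $\Sigma=\Sigma(t)$ be the set of those $z\in\mathbb C$ for which $v_x=(-\mathrm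 iz\sigma_3+Q)v$ has a nonzero bounded solution on $\mathbb R$. For $z\notin\Sigma$ let $\rho(z)$ be the root of $\rho^2-2\Delta\rho+1=0$ with $|\rho|<1$, and let $\psi^\pm(x,t,z)$ be the solution of $\psi_x=U(-\mathrm iz\sigma_3+Q)U^{-1}\psi$ with $\psi^\pm(x+L,t,z)=\rho^{\pm1}(z)\,\psi^\pm(x,t,z)$ and $\psi_1^\pm(0,t,z)=1$. The Dirichlet eigenvalues at time $t$ are those $\mu\in\mathbb C$ for which $v_x=(-\mathrm i\mu\sigma_3+Q)v$ has a nonzero solution on $[0,L]$ with $v_1+v_2=0$ at $x=0$ and at $x=L$; for such $\mu$ put $\sigma(\mu)=-\operatorname{sgn}\log|\tilde y_{22}(L,t,\mu)|$. A gap is an interval $(a,b)\subset\mathbb R$, $a<b$, with $a,b\in\Sigma$ and $(a,b)\cap\Sigma=\emptyset$. Finally, put $$\alpha^\pm(t,z)=z\,(q^*(0,t)+q(0,t))+\tfrac{\mathrm i}2\,(q_x(0,t)-q_x^*(0,t))+\Big(2z^2+\mathrm iz\,(q^*(0,t)-q(0,t))+|q(0,t)|^2+\tfrac12q_x(0,t)+\tfrac12q_x^*(0,t)\Big)\,\psi_2^\pm(0,t,z).$$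 Then for every $t\in T$ the following holds. 1. If $z\notin\Sigma$ and $z$ is not a Dirichlet eigenvalue with $\sigma(z)=\pm1$, then $\rho(z)$ and $\psi^\pm(\cdot,t,z)$ are well defined, and $\psi^\pm$ is differentiable in $t$ with $$\psi_t^\pm(x,t,z)+\alpha^\pm(t,z)\,\psi^\pm(x,t,z)=\tilde{\mathcal A}\psi^\pm(x,t,z)\qquad\text{for all }x\in\mathbb R.$$ 2. On each closed half-plane $\overline{\mathbb C^+}$ and $\overline{\mathbb C^-}$, $\alpha^\pm(t,\cdot)$ (defined off $\Sigma$) extends continuously, by its boundary values from the interior of that half-plane, to all points that are not Dirichlet eigenvalues. So extended, as $z\to\infty$, $$\alpha^\pm=\pm2\mathrm iz^2+O(1/z)\ \text{ in }\overline{\mathbb C^+},\qquad \alpha^\pm=\mp2\mathrm iz^2+O(1/z)\ \text{ in }\overline{\mathbb C^-},$$ where $O(1/z)$ is uniform in each sector $|\operatorname{Im}z|\ge\theta|z|$, $\theta>0$; if moreover $q(\cdot,t)\in C^3$, then for each $\delta>0$ it is uniform in all $z$ of the closed half-plane whose distance to every Dirichlet eigenvalue at time $t$ is at least $\delta$. 3.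 For every gap $(a,b)$ there is exactly one Dirichlet eigenvalue $\mu(t)$ in $[a,b]$, and every Dirichlet eigenvalue with $\sigma\ne0$ arises in this way. If $\sigma(\mu(t))=1$ (respectively $\sigma(\mu(t))=-1$), then the Dirichlet eigenvalue $\mu(\cdot)$ in $[a,b]$ is differentiable at $t$, and near $z=\mu(t)$ $$\alpha^{+}(t,z)=-\frac{\mu_t(t)}{z-\mu(t)}+\text{(an analytic function of }z)\qquad\text{(respectively the same for }\alpha^-).$$ Thus $\alpha^+$ (respectively $\alpha^-$) has a simple pole at $\mu(t)$ with residue $-\mu_t(t)$, provided $\mu_t(t)\ne0$; if $\mu_t(t)=0$ the singularity is removable. -/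

import Mathlib

open scoped ComplexConjugate Topology Matrix

noncomputable section

namespace PeriodicNLS

/-- The third Pauli matrix. -/
def sigma3 : Matrix (Fin 2) (Fin 2) ℂ := !![1, 0; 0, -1]

/-- The constant matrix of the similarity transformation to the modified problem. -/
def U : Matrix (Fin 2) (Fin 2) ℂ := !![1, 1; -Complex.I, Complex.I]

/-- The spatial derivative `q_x(x,t)`. -/
def dx (q : ℝ → ℝ → ℂ) (x t : ℝ) : ℂ := deriv (fun y => q y t) x

/-- The second spatial derivative `q_xx(x,t)`. -/
def dxx (q : ℝ → ℝ → ℂ) (x t : ℝ) : ℂ := deriv (fun y => dx q y t) x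

/-- The time derivative `q_t(x,t)`. -/
def dt (q : ℝ → ℝ → ℂ) (x t : ℝ) : ℂ := deriv (fun τ => q x τ) t

/-- `q` is, for times in `T`, a classical solution of the defocusing NLS equation
`i q_t + q_xx - 2 |q|^2 q = 0` which is `L`-periodic in `x`. (By the equation, `q_t` is then
jointly continuous as well.) -/
structure IsPeriodicNLSSolution (q : ℝ → ℝ → ℂ) (L : ℝ) (T : Set ℝ) : Prop where
  periodic : ∀ t ∈ T, ∀ x, q (x + L) t = q x t
  contDiff_x : ∀ t ∈ T, ContDiff ℝ 2 (fun x => q x t)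
  differentiable_t : ∀ t ∈ T, ∀ x, DifferentiableAt ℝ (fun τ => q x τ) t
  continuous_q : ContinuousOn (fun p : ℝ × ℝ => q p.1 p.2) (Set.univ ×ˢ T)
  continuous_dx : ContinuousOn (fun p : ℝ × ℝ => dx q p.1 p.2) (Set.univ ×ˢ T)
  continuous_dxx : ContinuousOn (fun p : ℝ × ℝ => dxx q p.1 p.2) (Set.univ ×ˢ T)
  nls : ∀ t ∈ T, ∀ x,
    Complex.I * dt q x t + dxx q x t - 2 * (‖q x t‖ : ℂ) ^ 2 * q x t = 0

/-- The matrix potential `Q(x,t)`. -/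
def Q (q : ℝ → ℝ → ℂ) (t x : ℝ) : Matrix (Fin 2) (Fin 2) ℂ :=
  !![0, q x t; conj (q x t), 0]

/-- The matrix `Q_x(x,t)`. -/
def Qx (q : ℝ → ℝ → ℂ) (t x : ℝ) : Matrix (Fin 2) (Fin 2) ℂ :=
  !![0, dx q x t; conj (dx q x t), 0]

/-- The coefficient matrix `-i z σ₃ + Q` of the Zakharov-Shabat problem. -/
def zsMatrix (q : ℝ → ℝ → ℂ) (t : ℝ) (z : ℂ) (x : ℝ) : Matrix (Fin 2) (Fin 2) ℂ :=
  (-(Complex.I * z)) • sigma3 + Q q t x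

/-- `v_x = (-i z σ₃ + Q) v` on the whole line; equivalently `i σ₃ (∂_x - Q) v = z v`. -/
def IsZSSolution (q : ℝ → ℝ → ℂ) (t : ℝ) (z : ℂ) (v : ℝ → Fin 2 → ℂ) : Prop :=
  ∀ x, HasDerivAt v (zsMatrix q t z x *ᵥ v x) x

/-- The modified Zakharov-Shabat problem `v_x = U (-i z σ₃ + Q) U⁻¹ v`. -/
def IsModZSSolution (q : ℝ → ℝ → ℂ) (t : ℝ) (z : ℂ) (v : ℝ → Fin 2 → ℂ) : Prop :=
  ∀ x, HasDerivAt v ((U * zsMatrix q t z x * U⁻¹) *ᵥ v x) x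

/-- The Lax spectrum: those `z` for which there is a nonzero bounded solution. -/
def laxSpectrum (q : ℝ → ℝ → ℂ) (t : ℝ) : Set ℂ :=
  {z | ∃ φ : ℝ → Fin 2 → ℂ, IsZSSolution q t z φ ∧ φ ≠ 0 ∧ ∃ C : ℝ, ∀ x, ‖φ x‖ ≤ C}

/-- `Y` is a matrix solution of the Zakharov-Shabat problem with `Y(0) = 1`. -/
def IsPrincipalMatrix (q : ℝ → ℝ → ℂ) (t : ℝ) (z : ℂ)
    (Y : ℝ → Matrix (Fin 2) (Fin 2) ℂ) : Prop :=
  Y 0 = 1 ∧ ∀ j, IsZSSolution q t z (fun x i => Y x i j)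

/-- The principal matrix solution `Y(x,t,z)`. -/
def principalMatrix (q : ℝ → ℝ → ℂ) (t : ℝ) (z : ℂ) : ℝ → Matrix (Fin 2) (Fin 2) ℂ :=
  Classical.epsilon (IsPrincipalMatrix q t z)

/-- The modified principal matrix solution `U Y U⁻¹`. -/
def modMatrix (q : ℝ → ℝ → ℂ) (t : ℝ) (z : ℂ) (x : ℝ) : Matrix (Fin 2) (Fin 2) ℂ :=
  U * principalMatrix q t z x * U⁻¹

/-- The Floquet discriminant: half the trace of the monodromy matrix `Y(L,t,z)`. -/
def discriminant (q : ℝ → ℝ → ℂ) (L t : ℝ) (z : ℂ) : ℂ :=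
  (1 / 2) * (principalMatrix q t z L).trace

/-- `r` is the root of `r² - 2 Δ r + 1 = 0` of modulus less than one. -/
def IsSmallMultiplier (q : ℝ → ℝ → ℂ) (L t : ℝ) (z r : ℂ) : Prop :=
  r ^ 2 - 2 * discriminant q L t z * r + 1 = 0 ∧ ‖r‖ < 1

/-- The Floquet multiplier `ρ`, meaningful for `z` outside the Lax spectrum. -/
def multiplier (q : ℝ → ℝ → ℂ) (L t : ℝ) (z : ℂ) : ℂ :=
  Classical.epsilon (IsSmallMultiplier q L t z)

/-- The conditions defining the normalized Bloch-Floquet solution `ψ^±`: it solves the modified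
problem, `ψ(x + L) = ρ^{±1} ψ(x)`, and its first component is `1` at `x = 0`.
The sign `±` is `s`. -/
def IsNormalizedBloch (s : ℤˣ) (q : ℝ → ℝ → ℂ) (L t : ℝ) (z : ℂ) (v : ℝ → Fin 2 → ℂ) : Prop :=
  IsModZSSolution q t z v ∧ (∀ x, v (x + L) = (multiplier q L t z ^ (s : ℤ)) • v x) ∧ v 0 0 = 1

/-- The normalized Bloch-Floquet solution `x ↦ ψ^±(x,t,z)`. -/
def bloch (s : ℤˣ) (q : ℝ → ℝ → ℂ) (L t : ℝ) (z : ℂ) : ℝ → Fin 2 → ℂ :=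
  Classical.epsilon (IsNormalizedBloch s q L t z)

/-- The operator `A = 2 i σ₃ ∂_x² + 2 i Q σ₃ ∂_x - i (Q² - Q_x) σ₃`. -/
def laxA (q : ℝ → ℝ → ℂ) (t : ℝ) (v : ℝ → Fin 2 → ℂ) (x : ℝ) : Fin 2 → ℂ :=
  (2 * Complex.I) • (sigma3 *ᵥ deriv (deriv v) x)
    + (2 * Complex.I) • ((Q q t x * sigma3) *ᵥ deriv v x)
    - Complex.I • (((Q q t x ^ 2 - Qx q t x) * sigma3) *ᵥ v x)

/-- The operator `U A U⁻¹`. -/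
def modLaxA (q : ℝ → ℝ → ℂ) (t : ℝ) (v : ℝ → Fin 2 → ℂ) (x : ℝ) : Fin 2 → ℂ :=
  U *ᵥ laxA q t (fun y => U⁻¹ *ᵥ v y) x

/-- The coefficient `α^±(t,z)`. The component `ψ₂` has index `1`. -/
def alpha (s : ℤˣ) (q : ℝ → ℝ → ℂ) (L t : ℝ) (z : ℂ) : ℂ :=
  z * (conj (q 0 t) + q 0 t) + (Complex.I / 2) * (dx q 0 t - conj (dx q 0 t))
    + (2 * z ^ 2 + Complex.I * z * (conj (q 0 t) - q 0 t) + (‖q 0 t‖ : ℂ) ^ 2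
        + (1 / 2) * dx q 0 t + (1 / 2) * conj (dx q 0 t)) * bloch s q L t z 0 1

/-- The Dirichlet spectrum with base point `0`: there is a nonzero solution on `[0, L]` with
`v₁ + v₂ = 0` at both end points. -/
def dirichletSpectrum (q : ℝ → ℝ → ℂ) (L t : ℝ) : Set ℂ :=
  {μ | ∃ v : ℝ → Fin 2 → ℂ,
    (∀ x ∈ Set.Icc 0 L, HasDerivWithinAt v (zsMatrix q t μ x *ᵥ v x) (Set.Icc 0 L) x) ∧
    (∃ x ∈ Set.Icc 0 L, v x ≠ 0) ∧ v 0 0 + v 0 1 = 0 ∧ v L 0 + v L 1 = 0}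

/-- The sign `σ = - sgn (log |ỹ₂₂(L,t,μ)|)` attached to a Dirichlet eigenvalue `μ`. -/
def dirichletSign (q : ℝ → ℝ → ℂ) (L t : ℝ) (μ : ℂ) : ℤ :=
  -((SignType.sign (Real.log ‖modMatrix q t μ L 1 1‖) : SignType) : ℤ)

/-- `(a, b)` is a (nondegenerate) spectral gap. -/
def IsSpectralGap (q : ℝ → ℝ → ℂ) (t a b : ℝ) : Prop :=
  a < b ∧ (a : ℂ) ∈ laxSpectrum q t ∧ (b : ℂ) ∈ laxSpectrum q t ∧
    ∀ x ∈ Set.Ioo a b, (x : ℂ) ∉ laxSpectrum q t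

/-- The moving Dirichlet eigenvalue `t ↦ μ(t)` that belongs to the gap `(a, b)`, i.e. the Dirichlet
eigenvalue in `[a, b]` at time `t`. -/
def gapDirichlet (q : ℝ → ℝ → ℂ) (L a b t : ℝ) : ℝ :=
  Classical.epsilon (fun μ : ℝ => μ ∈ Set.Icc a b ∧ (μ : ℂ) ∈ dirichletSpectrum q L t)

/-- The closed upper (`e = 1`) or lower (`e = -1`) half-plane. -/
def halfPlane (e : ℤˣ) : Set ℂ := {z | 0 ≤ ((e : ℤ) : ℝ) * z.im}

end PeriodicNLS

end

noncomputable section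

namespace PeriodicNLS

/-! ### Linear differential equations: existence, Grönwall estimate, uniqueness. -/

section LinearODE

variable {E : Type*} [NormedAddCommGroup E] [NormedSpace ℝ E]

/-! Conjugation by `U` makes the coefficient matrix, and hence the fundamental matrix Ỹ, real for
real z. Everything is then read off the monodromy matrix M = Ỹ(L), which has determinant 1 (entries
are indexed from 0). Its trace is 2Δ; the Lax spectrum is the set of z for which M has an eigenvalue
on the unit circle (`mem_laxSpectrum_iff`); the Dirichlet eigenvalues are the zeros of M₀₁
(`mem_dirichletSpectrum_iff`); and ψ^± = Ỹ (1, m), where (1, m) is the eigenvector of M for ρ^{±1}.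
Such an eigenvector exists uniquely unless z is a Dirichlet eigenvalue of sign ±1
(`exists_unique_slope`).

Evolution. On solutions the operator Ã is multiplication by a matrix B (`laxB`), and NLS is the
zero-curvature equation for B (`hasDerivAt_laxB`). Hence Ỹ_t = B Ỹ - Ỹ B(0), and since B is
periodic, M_t = [B(0), M]. So Δ, the Lax spectrum and ρ are locally constant in time, while
differentiating the eigenvector relation gives a Riccati equation for m (`hasDerivAt_slope`). As α
is the first component of B(0) (1, m) (`alpha_eq`), this is the claimed equation for ψ^±.

Boundary values and asymptotics. Off the zeros of M₀₁ one has m = (ρ^{±1} - M₀₀) / M₀₁, so α extends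
because ρ has boundary values (`exists_tendsto_multiplier`). For large z, return to the original
frame and take the ratio n of the two components of the Bloch solution, smaller over larger. Off the
real axis |n| < 1 by the energy identity (`bloch_energy_sign`), and n solves a Riccati equation with
an explicit approximate solution N in powers of 1/z. In a sector, evaluating the equation for n - N
at a maximum of its modulus gains one power of 1/z (`exists_norm_bloch_sub_le_of_sector`), so two
terms of N, hence C², are enough. Near the real axis there is no such gain. There the combination p
- N w of the components p, w is carried over one period by a factor close to exp(-izL) and its
mirror image by one close to exp(izL); the Floquet multiplier cannot be near both when sin(zL) is
not small (`exists_norm_bloch_sub_le`). This needs three terms of N, hence C³. Since the Dirichlet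
eigenvalues approach the zeros of sin(zL), distance from them bounds sin(zL) below
(`exists_le_norm_sin_of_dist`).

Gaps and poles. The z-derivative of M is expressed by the Gram matrix of Ỹ, which is positive
definite for real z. Therefore zeros of M₀₁ in a closed gap are simple with a fixed sign of the
derivative, and M₀₁, where nonzero at the two ends, has opposite signs there: exactly one zero
(`gap_exists_unique`). Inside the gap it moves with μ_t = -∂_t M₀₁ / ∂_z M₀₁, and inserting M_t =
[B(0), M] identifies this as minus the residue of α (`alpha_pole`). -/

/-- The iterated integrals of the Volterra series of `v' = A v`, `v 0 = c`. -/
def volterraTerm (A : ℝ → E →L[ℝ] E) (c : E) : ℕ → ℝ → E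
  | 0 => fun _ => c
  | n + 1 => fun x => ∫ s in (0 : ℝ)..x, A s (volterraTerm A c n s)

theorem continuous_volterraTerm {A : ℝ → E →L[ℝ] E} (hA : Continuous A) (c : E) (n : ℕ) :
    Continuous (volterraTerm A c n) := by
  induction n with
  | zero => exact continuous_const
  | succ n ih =>
    exact intervalIntegral.continuous_primitive
      (fun a b => (hA.clm_apply ih).intervalIntegrable a b) 0

theorem norm_volterraTerm_le {A : ℝ → E →L[ℝ] E} (hA : Continuous A) {K : ℝ}
    (hK : ∀ x, ‖A x‖ ≤ K) (c : E) (n : ℕ) (x : ℝ) :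
    ‖volterraTerm A c n x‖ ≤ ‖c‖ * ((K * |x|) ^ n / n.factorial) := by
  have hK0 : 0 ≤ K := (norm_nonneg _).trans (hK 0)
  induction n generalizing x with
  | zero => simp [volterraTerm]
  | succ n ih =>
    have hc := hA.clm_apply (continuous_volterraTerm hA c n)
    have hint : MeasureTheory.IntegrableOn
        (fun s => ‖A s (volterraTerm A c n s)‖) (Set.uIoc 0 x) :=
      (hc.norm.intervalIntegrable 0 x).def'
    have hint2 : MeasureTheory.IntegrableOn
        (fun s : ℝ => K * ‖c‖ * K ^ n / n.factorial * |s - 0| ^ n) (Set.uIoc 0 x) :=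
      ((by fun_prop : Continuous
        (fun s : ℝ => K * ‖c‖ * K ^ n / n.factorial * |s - 0| ^ n)).intervalIntegrable 0 x).def'
    calc ‖volterraTerm A c (n + 1) x‖
        ≤ ∫ s in Set.uIoc 0 x, ‖A s (volterraTerm A c n s)‖ :=
          intervalIntegral.norm_integral_le_integral_norm_uIoc
      -- The form `|s - 0|` is the one that `integral_pow_abs_sub_uIoc` integrates.
      _ ≤ ∫ s in Set.uIoc 0 x, K * ‖c‖ * K ^ n / n.factorial * |s - 0| ^ n := by
          refine MeasureTheory.integral_mono hint hint2 fun s => ?_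
          calc ‖A s (volterraTerm A c n s)‖ ≤ ‖A s‖ * ‖volterraTerm A c n s‖ :=
                (A s).le_opNorm _
            _ ≤ K * (‖c‖ * ((K * |s|) ^ n / n.factorial)) := by
                gcongr
                · exact hK s
                · exact ih s
            _ = K * ‖c‖ * K ^ n / n.factorial * |s - 0| ^ n := by
                rw [sub_zero, mul_pow]; ring
      _ = ‖c‖ * ((K * |x|) ^ (n + 1) / (n + 1).factorial) := by
          rw [MeasureTheory.integral_const_mul, integral_pow_abs_sub_uIoc, sub_zero, mul_pow,
            Nat.factorial_succ]
          have : (n.factorial : ℝ) ≠ 0 := by positivity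
          push_cast
          field_simp
          ring

/-- Global existence for linear equations with bounded continuous coefficients. -/
theorem exists_linearODE_solution [CompleteSpace E] {A : ℝ → E →L[ℝ] E} (hA : Continuous A)
    {K : ℝ} (hK : ∀ x, ‖A x‖ ≤ K) (c : E) :
    ∃ v : ℝ → E, v 0 = c ∧ ∀ x, HasDerivAt v (A x (v x)) x := by
  have hK0 : 0 ≤ K := (norm_nonneg _).trans (hK 0)
  have hsum : ∀ x, Summable fun n => volterraTerm A c n x := fun x =>
    Summable.of_norm_bounded ((Real.summable_pow_div_factorial (K * |x|)).mul_left ‖c‖)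
      fun n => norm_volterraTerm_le hA hK c n x
  have hzero : ∀ n, volterraTerm A c (n + 1) 0 = 0 := fun n => by simp [volterraTerm]
  refine ⟨fun x => ∑' n, volterraTerm A c n x, ?_, fun x => ?_⟩
  · show (∑' n, volterraTerm A c n 0) = c
    rw [(hsum 0).tsum_eq_zero_add]
    simp [volterraTerm]
  · have hR : ∀ y, y ∈ Metric.ball (0 : ℝ) (|x| + 1) ↔ |y| < |x| + 1 := fun y => by simp
    -- The derivative of term n + 1 is A applied to term n, so the series is differentiated without
    -- its constant term, on a ball containing both 0 and x; c is put back at the end.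
    have key := hasDerivAt_tsum_of_isPreconnected
      (g := fun n y => volterraTerm A c (n + 1) y)
      (g' := fun n y => A y (volterraTerm A c n y))
      (u := fun n => K * (‖c‖ * ((K * (|x| + 1)) ^ n / n.factorial)))
      (t := Metric.ball (0 : ℝ) (|x| + 1)) (y₀ := 0) (y := x)
      (((Real.summable_pow_div_factorial _).mul_left ‖c‖).mul_left K)
      Metric.isOpen_ball (convex_ball _ _).isPreconnected
      (fun n y _ => by
        have hc := hA.clm_apply (continuous_volterraTerm hA c n)
        exact hc.integral_hasStrictDerivAt 0 y |>.hasDerivAt)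
      (fun n y hy => by
        calc ‖A y (volterraTerm A c n y)‖ ≤ ‖A y‖ * ‖volterraTerm A c n y‖ := (A y).le_opNorm _
          _ ≤ K * (‖c‖ * ((K * |y|) ^ n / n.factorial)) :=
              mul_le_mul (hK y) (norm_volterraTerm_le hA hK c n y) (norm_nonneg _) hK0
          _ ≤ _ := by
              have := ((hR y).1 hy).le
              gcongr)
      ((hR 0).2 (by simp; positivity)) (by simp [hzero]) ((hR x).2 (by simp))
    have h2 : (fun y => ∑' n, volterraTerm A c n y)
        = fun y => c + ∑' n, volterraTerm A c (n + 1) y := by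
      funext y
      rw [(hsum y).tsum_eq_zero_add]; rfl
    have h3 : A x (∑' n, volterraTerm A c n x) = ∑' n, A x (volterraTerm A c n x) :=
      (A x).map_tsum (hsum x)
    change HasDerivAt _ (A x (∑' n, volterraTerm A c n x)) x
    rw [h2, h3]
    exact key.const_add c

/-- A two-sided Grönwall estimate. -/
theorem norm_le_of_norm_deriv_le {e e' : ℝ → E} {K ε R : ℝ} (hK : 1 ≤ K) (hε : 0 ≤ ε)
    (he : ∀ x, |x| ≤ R → HasDerivAt e (e' x) x)
    (hb : ∀ x, |x| ≤ R → ‖e' x‖ ≤ K * ‖e x‖ + ε) {x : ℝ} (hx : |x| ≤ R) :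
    ‖e x‖ ≤ (‖e 0‖ + ε) * Real.exp (K * |x|) := by
  have main : ∀ (f f' : ℝ → E), (∀ y, |y| ≤ R → HasDerivAt f (f' y) y) →
      (∀ y, |y| ≤ R → ‖f' y‖ ≤ K * ‖f y‖ + ε) → ∀ y, 0 ≤ y → y ≤ R →
      ‖f y‖ ≤ (‖f 0‖ + ε) * Real.exp (K * y) := by
    intro f f' hf hfb y hy hyR
    have hR : ∀ w ∈ Set.Icc 0 y, |w| ≤ R := fun w hw => by
      rw [abs_of_nonneg hw.1]; exact hw.2.trans hyR
    have := norm_le_gronwallBound_of_norm_deriv_right_le (f := f) (f' := f') (δ := ‖f 0‖)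
      (K := K) (ε := ε) (a := 0) (b := y)
      (fun w hw => (hf w (hR w hw)).continuousAt.continuousWithinAt)
      (fun w hw => (hf w (hR w (Set.Ico_subset_Icc_self hw))).hasDerivWithinAt) le_rfl
      (fun w hw => hfb w (hR w (Set.Ico_subset_Icc_self hw))) y ⟨hy, le_rfl⟩
    refine this.trans ?_
    -- The bound is δ exp(K y) + (ε / K)(exp(K y) - 1); since K ≥ 1, ε / K may be replaced by ε.
    rw [gronwallBound_of_K_ne_0 (by linarith), sub_zero, add_mul]
    have h1 : 1 ≤ Real.exp (K * y) := Real.one_le_exp (by positivity)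
    have h2 : ε / K ≤ ε := div_le_self hε hK
    have h3 : 0 ≤ ε / K := by positivity
    nlinarith
  rcases le_total 0 x with h | h
  · rw [abs_of_nonneg h] at hx ⊢
    exact main e e' he hb x h hx
  · rw [abs_of_nonpos h] at hx ⊢
    have := main (fun y => e (-y)) (fun y => -e' (-y))
      (fun y hy => by
        have := (he (-y) (by rwa [abs_neg])).scomp y (hasDerivAt_neg y)
        simpa [Function.comp_def] using this)
      (fun y hy => by
        rw [norm_neg]; exact hb (-y) (by rwa [abs_neg])) (-x) (by linarith) hx
    simpa using this

theorem linearODE_unique {A : ℝ → E →L[ℝ] E} {K : ℝ} (hK : ∀ x, ‖A x‖ ≤ K) {v w : ℝ → E}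
    (hv : ∀ x, HasDerivAt v (A x (v x)) x) (hw : ∀ x, HasDerivAt w (A x (w x)) x)
    (h0 : v 0 = w 0) : v = w := by
  funext x
  have hK1 : (1 : ℝ) ≤ max K 1 := le_max_right _ _
  have := norm_le_of_norm_deriv_le (e := fun x => v x - w x)
    (e' := fun x => A x (v x) - A x (w x)) (K := max K 1) (ε := 0) (R := |x|) hK1 le_rfl
    (fun y _ => (hv y).sub (hw y))
    (fun y _ => by
      rw [← map_sub, add_zero]
      exact ((A y).le_opNorm _).trans (by gcongr; exact (hK y).trans (le_max_left _ _)))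
    (x := x) le_rfl
  rw [h0] at this
  simpa [sub_eq_zero] using this

end LinearODE

/-! ### The fundamental matrix in the original and in the modified frame. -/

/-- The time slice `q(·,t)` is a continuous `L`-periodic potential. -/
structure IsPeriodicPotential (q : ℝ → ℝ → ℂ) (L t : ℝ) : Prop where
  pos : 0 < L
  continuous : Continuous fun x => q x t
  periodic : ∀ x, q (x + L) t = q x t

theorem IsPeriodicNLSSolution.isPeriodicPotential {q : ℝ → ℝ → ℂ} {L : ℝ} {T : Set ℝ}
    (hq : IsPeriodicNLSSolution q L T) (hL : 0 < L) {t : ℝ} (ht : t ∈ T) :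
    IsPeriodicPotential q L t :=
  ⟨hL, (hq.contDiff_x t ht).continuous, hq.periodic t ht⟩

/-- Matrices as real-linear continuous maps of `ℂ²`. -/
def mulVecCLM : Matrix (Fin 2) (Fin 2) ℂ →ₗ[ℝ] ((Fin 2 → ℂ) →L[ℝ] (Fin 2 → ℂ)) where
  toFun X := (LinearMap.toContinuousLinearMap (Matrix.mulVecLin X)).restrictScalars ℝ
  map_add' X Y := by ext; simp
  map_smul' r X := by ext; simp

@[simp] theorem mulVecCLM_apply (X : Matrix (Fin 2) (Fin 2) ℂ) (v : Fin 2 → ℂ) :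
    mulVecCLM X v = X *ᵥ v := rfl

theorem continuous_mulVecCLM : Continuous mulVecCLM :=
  LinearMap.continuous_of_finiteDimensional _

theorem hasDerivAt_fin2 {v : ℝ → Fin 2 → ℂ} {w : Fin 2 → ℂ} {x : ℝ} :
    HasDerivAt v w x ↔
      HasDerivAt (fun y => v y 0) (w 0) x ∧ HasDerivAt (fun y => v y 1) (w 1) x := by
  rw [hasDerivAt_pi, Fin.forall_fin_two]

theorem U_inv : U⁻¹ = !![1 / 2, Complex.I / 2; 1 / 2, -Complex.I / 2] := by
  apply Matrix.inv_eq_right_inv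
  ext i j
  fin_cases i <;> fin_cases j <;> simp [U, Matrix.mul_apply, Fin.sum_univ_two] <;> ring_nf <;>
    simp [Complex.I_sq]

theorem isUnit_det_U : IsUnit U.det := by
  simp [U, Matrix.det_fin_two]

theorem U_mul_inv : U * U⁻¹ = 1 := Matrix.mul_nonsing_inv _ isUnit_det_U

theorem U_inv_mul : U⁻¹ * U = 1 := Matrix.nonsing_inv_mul _ isUnit_det_U

theorem zsMatrix_eq (q : ℝ → ℝ → ℂ) (t : ℝ) (z : ℂ) (x : ℝ) :
    zsMatrix q t z x = !![-(Complex.I * z), q x t; conj (q x t), Complex.I * z] := by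
  ext i j
  fin_cases i <;> fin_cases j <;> simp [zsMatrix, sigma3, Q]

theorem isZSSolution_iff {q : ℝ → ℝ → ℂ} {t : ℝ} {z : ℂ} {v : ℝ → Fin 2 → ℂ} :
    IsZSSolution q t z v ↔ ∀ x,
      HasDerivAt (fun y => v y 0) (-(Complex.I * z) * v x 0 + q x t * v x 1) x ∧
      HasDerivAt (fun y => v y 1) (conj (q x t) * v x 0 + Complex.I * z * v x 1) x := by
  unfold IsZSSolution
  refine forall_congr' fun x => ?_
  rw [hasDerivAt_fin2, zsMatrix_eq]
  simp [Matrix.mulVec, dotProduct, Fin.sum_univ_two]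

section Fundamental

variable {q : ℝ → ℝ → ℂ} {L t : ℝ}

theorem IsPeriodicPotential.continuous_zsMatrix (h : IsPeriodicPotential q L t) (z : ℂ) :
    Continuous (zsMatrix q t z) := by
  have h1 := h.continuous
  refine continuous_matrix fun i j => ?_
  simp only [zsMatrix_eq]
  fin_cases i <;> fin_cases j <;> simp
  · exact continuous_const
  · exact h1
  · exact Complex.continuous_conj.comp h1
  · exact continuous_const

theorem IsPeriodicPotential.zsMatrix_periodic (h : IsPeriodicPotential q L t) (z : ℂ) (x : ℝ) :
    zsMatrix q t z (x + L) = zsMatrix q t z x := by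
  simp only [zsMatrix_eq, h.periodic]

theorem IsPeriodicPotential.exists_norm_zs_le (h : IsPeriodicPotential q L t) (z : ℂ) :
    ∃ K, ∀ x, ‖mulVecCLM (zsMatrix q t z x)‖ ≤ K := by
  have hp : Function.Periodic (fun x => mulVecCLM (zsMatrix q t z x)) L := fun x => by
    simp only [h.zsMatrix_periodic]
  have := hp.isBounded_of_continuous h.pos.ne'
    (continuous_mulVecCLM.comp (h.continuous_zsMatrix z))
  obtain ⟨K, hK⟩ := this.exists_norm_le
  exact ⟨K, fun x => hK _ ⟨x, rfl⟩⟩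

theorem IsPeriodicPotential.exists_zsSolution (h : IsPeriodicPotential q L t) (z : ℂ)
    (c : Fin 2 → ℂ) : ∃ v, v 0 = c ∧ IsZSSolution q t z v := by
  obtain ⟨K, hK⟩ := h.exists_norm_zs_le z
  exact exists_linearODE_solution (continuous_mulVecCLM.comp (h.continuous_zsMatrix z)) hK c

theorem IsPeriodicPotential.zsSolution_unique (h : IsPeriodicPotential q L t) {z : ℂ}
    {v w : ℝ → Fin 2 → ℂ} (hv : IsZSSolution q t z v) (hw : IsZSSolution q t z w)
    (h0 : v 0 = w 0) : v = w := by
  obtain ⟨K, hK⟩ := h.exists_norm_zs_le z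
  exact linearODE_unique hK hv hw h0

theorem IsPeriodicPotential.isPrincipalMatrix (h : IsPeriodicPotential q L t) (z : ℂ) :
    IsPrincipalMatrix q t z (principalMatrix q t z) := by
  apply Classical.epsilon_spec
  choose v hv0 hv using fun j : Fin 2 => h.exists_zsSolution z (Pi.single j 1)
  refine ⟨fun x => Matrix.of fun i j => v j x i, ?_, fun j => hv j⟩
  ext i j
  simp [hv0, Matrix.one_apply, Pi.single_apply]

theorem IsZSSolution.linear_comb {z : ℂ} {v w : ℝ → Fin 2 → ℂ} (hv : IsZSSolution q t z v)
    (hw : IsZSSolution q t z w) (a b : ℂ) : IsZSSolution q t z (fun x => a • v x + b • w x) := by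
  intro x
  rw [Matrix.mulVec_add, Matrix.mulVec_smul, Matrix.mulVec_smul]
  exact ((hv x).const_smul a).add ((hw x).const_smul b)

theorem IsPeriodicPotential.zsSolution_mulVec (h : IsPeriodicPotential q L t) (z : ℂ)
    (c : Fin 2 → ℂ) : IsZSSolution q t z (fun x => principalMatrix q t z x *ᵥ c) := by
  have hY := (h.isPrincipalMatrix z).2
  have := (hY 0).linear_comb (hY 1) (c 0) (c 1)
  convert this using 2 with x
  ext i
  simp [Matrix.mulVec, dotProduct, Fin.sum_univ_two, mul_comm]

theorem IsPeriodicPotential.zsSolution_eq (h : IsPeriodicPotential q L t) {z : ℂ}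
    {v : ℝ → Fin 2 → ℂ} (hv : IsZSSolution q t z v) (x : ℝ) :
    v x = principalMatrix q t z x *ᵥ v 0 := by
  have := h.zsSolution_unique hv (h.zsSolution_mulVec z (v 0))
    (by simp [(h.isPrincipalMatrix z).1])
  exact congrFun this x

theorem IsPeriodicPotential.zsSolution_shift (h : IsPeriodicPotential q L t) {z : ℂ}
    {v : ℝ → Fin 2 → ℂ} (hv : IsZSSolution q t z v) : IsZSSolution q t z (fun x => v (x + L)) := by
  intro x
  have := (hv (x + L)).comp_add_const x L
  rwa [h.zsMatrix_periodic] at this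

/-- Liouville's formula: the coefficient matrix has trace zero. -/
theorem IsPeriodicPotential.det_principalMatrix (h : IsPeriodicPotential q L t) (z : ℂ) (x : ℝ) :
    (principalMatrix q t z x).det = 1 := by
  obtain ⟨h0, hY⟩ := h.isPrincipalMatrix z
  have hd : ∀ x, HasDerivAt (fun y => (principalMatrix q t z y).det) 0 x := fun x => by
    obtain ⟨h1, h2⟩ := isZSSolution_iff.1 (hY 0) x
    obtain ⟨h3, h4⟩ := isZSSolution_iff.1 (hY 1) x
    simp only [Matrix.det_fin_two]
    convert! (h1.mul h4).sub (h3.mul h2) using 1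
    ring
  have := is_const_of_deriv_eq_zero (fun x => (hd x).differentiableAt) (fun x => (hd x).deriv) x 0
  simpa [h0] using this

theorem isModZSSolution_iff {z : ℂ} {v : ℝ → Fin 2 → ℂ} :
    IsModZSSolution q t z v ↔ IsZSSolution q t z (fun x => U⁻¹ *ᵥ v x) := by
  constructor
  · intro hv x
    have := (mulVecCLM U⁻¹).hasFDerivAt.comp_hasDerivAt x (hv x)
    simp only [mulVecCLM_apply, Matrix.mulVec_mulVec, ← mul_assoc, U_inv_mul, one_mul] at this
    rw [Matrix.mulVec_mulVec]
    exact this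
  · intro hv x
    have := (mulVecCLM U).hasFDerivAt.comp_hasDerivAt x (hv x)
    simp only [mulVecCLM_apply, Matrix.mulVec_mulVec, ← mul_assoc, U_mul_inv, Function.comp_def,
      Matrix.one_mulVec] at this
    exact this

theorem IsPeriodicPotential.modMatrix_zero (h : IsPeriodicPotential q L t) (z : ℂ) :
    modMatrix q t z 0 = 1 := by
  simp [modMatrix, (h.isPrincipalMatrix z).1, U_mul_inv]

theorem IsPeriodicPotential.det_modMatrix (h : IsPeriodicPotential q L t) (z : ℂ) (x : ℝ) :
    modMatrix q t z x 0 0 * modMatrix q t z x 1 1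
      - modMatrix q t z x 0 1 * modMatrix q t z x 1 0 = 1 := by
  rw [← Matrix.det_fin_two, modMatrix, Matrix.det_mul, Matrix.det_mul,
    h.det_principalMatrix, mul_one, ← Matrix.det_mul, U_mul_inv, Matrix.det_one]

theorem discriminant_eq (z : ℂ) :
    2 * discriminant q L t z = modMatrix q t z L 0 0 + modMatrix q t z L 1 1 := by
  rw [← Matrix.trace_fin_two, modMatrix, Matrix.trace_mul_cycle, U_inv_mul, one_mul, discriminant]
  ring

theorem IsPeriodicPotential.modSolution_mulVec (h : IsPeriodicPotential q L t) (z : ℂ)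
    (c : Fin 2 → ℂ) : IsModZSSolution q t z (fun x => modMatrix q t z x *ᵥ c) := by
  rw [isModZSSolution_iff]
  convert h.zsSolution_mulVec z (U⁻¹ *ᵥ c) using 2 with x
  simp only [modMatrix, Matrix.mulVec_mulVec, ← mul_assoc, U_inv_mul, one_mul]

theorem IsPeriodicPotential.modSolution_eq (h : IsPeriodicPotential q L t) {z : ℂ}
    {v : ℝ → Fin 2 → ℂ} (hv : IsModZSSolution q t z v) (x : ℝ) :
    v x = modMatrix q t z x *ᵥ v 0 := by
  have := h.zsSolution_eq (isModZSSolution_iff.1 hv) x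
  have h2 := congrArg (fun w => U *ᵥ w) this
  simp only [Matrix.mulVec_mulVec, ← mul_assoc, U_mul_inv, Matrix.one_mulVec] at h2
  exact h2

theorem IsPeriodicPotential.modSolution_unique (h : IsPeriodicPotential q L t) {z : ℂ}
    {v w : ℝ → Fin 2 → ℂ} (hv : IsModZSSolution q t z v) (hw : IsModZSSolution q t z w)
    (h0 : v 0 = w 0) : v = w := by
  funext x
  rw [h.modSolution_eq hv, h.modSolution_eq hw, h0]

theorem IsPeriodicPotential.modSolution_shift (h : IsPeriodicPotential q L t) {z : ℂ}
    {v : ℝ → Fin 2 → ℂ} (hv : IsModZSSolution q t z v) :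
    IsModZSSolution q t z (fun x => v (x + L)) :=
  isModZSSolution_iff.2 (h.zsSolution_shift (isModZSSolution_iff.1 hv))

/-- The point of the modified frame: the coefficients become real when z is real. -/
theorem U_zsMatrix_U_inv (z : ℂ) (x : ℝ) :
    U * zsMatrix q t z x * U⁻¹ = !![((q x t).re : ℂ), (q x t).im + z; (q x t).im - z,
      -((q x t).re : ℂ)] := by
  rw [zsMatrix_eq, U_inv, U]
  have hc : conj (q x t) = ((q x t).re : ℂ) - (q x t).im * Complex.I := by
    apply Complex.ext <;> simp
  have hi := Complex.I_sq
  rw [hc]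
  conv_lhs => rw [← Complex.re_add_im (q x t)]
  ext i j
  fin_cases i <;> fin_cases j <;>
    simp [Matrix.mul_apply, Fin.sum_univ_two, -Complex.re_add_im] <;> grind

theorem isModZSSolution_iff_components {z : ℂ} {v : ℝ → Fin 2 → ℂ} :
    IsModZSSolution q t z v ↔ ∀ x,
      HasDerivAt (fun y => v y 0) ((q x t).re * v x 0 + ((q x t).im + z) * v x 1) x ∧
      HasDerivAt (fun y => v y 1) (((q x t).im - z) * v x 0 - (q x t).re * v x 1) x := by
  unfold IsModZSSolution
  refine forall_congr' fun x => ?_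
  rw [hasDerivAt_fin2, U_zsMatrix_U_inv]
  simp [Matrix.mulVec, dotProduct, Fin.sum_univ_two, sub_eq_add_neg]

theorem IsPeriodicPotential.hasDerivAt_modMatrix (h : IsPeriodicPotential q L t) (z : ℂ)
    (j : Fin 2) (x : ℝ) :
    HasDerivAt (fun y => modMatrix q t z y 0 j)
      ((q x t).re * modMatrix q t z x 0 j + ((q x t).im + z) * modMatrix q t z x 1 j) x ∧
    HasDerivAt (fun y => modMatrix q t z y 1 j)
      (((q x t).im - z) * modMatrix q t z x 0 j - (q x t).re * modMatrix q t z x 1 j) x := by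
  have := isModZSSolution_iff_components.1 (h.modSolution_mulVec z (Pi.single j 1)) x
  simpa using this

end Fundamental

/-! ### Differentiable dependence on parameters. -/

section Parameters

variable {E : Type*} [NormedAddCommGroup E] [NormedSpace ℝ E]

/-- Differentiable dependence of solutions of linear equations on parameters: `D` is the solution
of the linearized equation. -/
theorem hasFDerivAt_linearODE {P : Type*} [NormedAddCommGroup P] [NormedSpace ℝ P]
    {A : P → ℝ → E →L[ℝ] E} {v : P → ℝ → E} {p₀ : P} {c : E} {R K : ℝ} (hK : 0 < K)
    (hv0 : ∀ᶠ p in 𝓝 p₀, v p 0 = c)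
    (hv : ∀ᶠ p in 𝓝 p₀, ∀ x, HasDerivAt (v p) (A p x (v p x)) x)
    {A' : ℝ → P →L[ℝ] E →L[ℝ] E} {D : ℝ → P →L[ℝ] E} (hD0 : D 0 = 0)
    (hD : ∀ h x, HasDerivAt (fun y => D y h) (A p₀ x (D x h) + A' x h (v p₀ x)) x)
    (hA : ∀ x, |x| ≤ R → ‖A p₀ x‖ ≤ K) (hA' : ∀ x, |x| ≤ R → ‖A' x‖ ≤ K)
    (hvK : ∀ x, |x| ≤ R → ‖v p₀ x‖ ≤ K) (hDK : ∀ x, |x| ≤ R → ‖D x‖ ≤ K)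
    (hunif : ∀ ε > 0, ∀ᶠ p in 𝓝 p₀, ∀ x, |x| ≤ R →
      ‖A p x - A p₀ x - A' x (p - p₀)‖ ≤ ε * ‖p - p₀‖)
    {x : ℝ} (hx : |x| ≤ R) : HasFDerivAt (fun p => v p x) (D x) p₀ := by
  -- C dominates ‖A p‖ for p near p₀, where (1 + K) + K is a bound, and is at least 1, as the
  -- Grönwall estimate demands.
  set C := (2 * K + 2) with hC
  set M := Real.exp (C * |x|) with hM
  have hMpos : 0 < M := Real.exp_pos _
  rw [hasFDerivAt_iff_isLittleO, Asymptotics.isLittleO_iff]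
  intro ε' hε'
  -- The final error is ε M (K + (1 + K) K) ‖p - p₀‖, which must not exceed ε' ‖p - p₀‖; ε ≤ 1 is
  -- what keeps ‖A p‖ below C.
  set ε := min 1 (ε' / (M * (K + (1 + K) * K))) with hε
  have hden : 0 < M * (K + (1 + K) * K) := by positivity
  have hεpos : 0 < ε := lt_min one_pos (by positivity)
  have hball : ∀ᶠ p in 𝓝 p₀, ‖p - p₀‖ < ε := by
    have := Metric.ball_mem_nhds p₀ hεpos
    filter_upwards [this] with p hp
    rwa [Metric.mem_ball, dist_eq_norm] at hp
  filter_upwards [hv0, hv, hunif ε hεpos, hball] with p hp0 hp hu hpε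
  set h := p - p₀ with hh
  have hε1 : ε ≤ 1 := min_le_left _ _
  have hdiff : ∀ y, |y| ≤ R → ‖A p y - A p₀ y‖ ≤ (1 + K) * ‖h‖ := fun y hy => by
    calc ‖A p y - A p₀ y‖ = ‖(A p y - A p₀ y - A' y h) + A' y h‖ := by rw [sub_add_cancel]
      _ ≤ ε * ‖h‖ + K * ‖h‖ := (norm_add_le _ _).trans
          (add_le_add (hu y hy) (((A' y).le_opNorm h).trans (by gcongr; exact hA' y hy)))
      _ ≤ 1 * ‖h‖ + K * ‖h‖ := by gcongr
      _ = _ := by ring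
  have hApK : ∀ y, |y| ≤ R → ‖A p y‖ ≤ C := fun y hy => by
    calc ‖A p y‖ = ‖(A p y - A p₀ y) + A p₀ y‖ := by rw [sub_add_cancel]
      _ ≤ (1 + K) * ‖h‖ + K := (norm_add_le _ _).trans (add_le_add (hdiff y hy) (hA y hy))
      _ ≤ (1 + K) * 1 + K := by gcongr; exact hpε.le.trans hε1
      _ ≤ C := by rw [hC]; linarith
  have hlin : HasDerivAt (fun _ : ℝ => (0 : E)) 0 0 := hasDerivAt_const _ _
  have key := norm_le_of_norm_deriv_le (e := fun y => v p y - v p₀ y - D y h)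
    (e' := fun y => A p y (v p y) - A p₀ y (v p₀ y) - (A p₀ y (D y h) + A' y h (v p₀ y)))
    (K := C) (ε := ε * (K + (1 + K) * K) * ‖h‖) (R := R) (by rw [hC]; linarith) (by positivity)
    (fun y _ => ((hp y).sub (hv.self_of_nhds y)).sub (hD h y))
    (fun y hy => by
      -- The remainder e = v_p - v_{p₀} - D h solves e' = A_p e + source. The source is of smaller
      -- than first order: its first part by `hunif`, its second as a product of the first-order
      -- quantities A_p - A_{p₀} and D h.
      have e1 : A p y (v p y) - A p₀ y (v p₀ y) - (A p₀ y (D y h) + A' y h (v p₀ y))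
          = A p y (v p y - v p₀ y - D y h)
            + ((A p y - A p₀ y - A' y h) (v p₀ y) + (A p y - A p₀ y) (D y h)) := by
        simp only [map_sub, sub_apply]; abel
      rw [e1]
      refine (norm_add_le _ _).trans (add_le_add ?_ ((norm_add_le _ _).trans ?_))
      · exact ((A p y).le_opNorm _).trans (by gcongr; exact hApK y hy)
      · have t1 : ‖(A p y - A p₀ y - A' y h) (v p₀ y)‖ ≤ ε * ‖h‖ * K :=
          (ContinuousLinearMap.le_opNorm _ _).trans (by
            gcongr
            · exact hu y hy
            · exact hvK y hy)
        have t2 : ‖(A p y - A p₀ y) (D y h)‖ ≤ ((1 + K) * ‖h‖) * (K * ε) :=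
          (ContinuousLinearMap.le_opNorm _ _).trans (by
            gcongr
            · exact hdiff y hy
            · exact ((D y).le_opNorm h).trans (by
                gcongr
                exact hDK y hy))
        calc _ ≤ ε * ‖h‖ * K + ((1 + K) * ‖h‖) * (K * ε) := add_le_add t1 t2
          _ = _ := by ring)
    hx
  have h0 : v p 0 - v p₀ 0 - D 0 h = 0 := by
    rw [hp0, hv0.self_of_nhds, hD0]; simp
  rw [h0, norm_zero, zero_add] at key
  refine key.trans ?_
  have : ε * (M * (K + (1 + K) * K)) ≤ ε' := by
    rw [← le_div_iff₀ hden]; exact min_le_right _ _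
  calc ε * (K + (1 + K) * K) * ‖h‖ * Real.exp (C * |x|)
      = ε * (M * (K + (1 + K) * K)) * ‖h‖ := by rw [hM]; ring
    _ ≤ ε' * ‖h‖ := by gcongr

end Parameters

/-! ### Differentiability of the potential in time, locally uniformly in x. -/

section TimeDifferentiability

variable {q : ℝ → ℝ → ℂ} {L t : ℝ} {T : Set ℝ}

theorem IsPeriodicNLSSolution.dt_eq (hq : IsPeriodicNLSSolution q L T) {t : ℝ} (ht : t ∈ T)
    (x : ℝ) : dt q x t = Complex.I * dxx q x t - 2 * Complex.I * (‖q x t‖ : ℂ) ^ 2 * q x t := by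
  have h := hq.nls t ht x
  have hi := Complex.I_sq
  linear_combination (-Complex.I) * h + (dt q x t) * hi

theorem IsPeriodicNLSSolution.continuousOn_dt (hq : IsPeriodicNLSSolution q L T) :
    ContinuousOn (fun p : ℝ × ℝ => dt q p.1 p.2) (Set.univ ×ˢ T) := by
  have h1 := hq.continuous_q
  have h2 := hq.continuous_dxx
  have : ContinuousOn (fun p : ℝ × ℝ => Complex.I * dxx q p.1 p.2
      - 2 * Complex.I * (‖q p.1 p.2‖ : ℂ) ^ 2 * q p.1 p.2) (Set.univ ×ˢ T) := by
    have h3 : ContinuousOn (fun p : ℝ × ℝ => (‖q p.1 p.2‖ : ℂ)) (Set.univ ×ˢ T) :=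
      Complex.continuous_ofReal.comp_continuousOn h1.norm
    fun_prop
  exact this.congr fun p hp => hq.dt_eq hp.2 p.1

/-- The mean value inequality for s ↦ q(x, s) - s q_t(x, t). Uniformity in x comes from uniform
continuity of q_t on a compact rectangle, and q_t is continuous because the equation expresses it
through q_xx and q. This is the input for `hunif` in `hasFDerivAt_linearODE`. -/
theorem IsPeriodicNLSSolution.uniform_differentiable (hq : IsPeriodicNLSSolution q L T)
    (hT : IsOpen T) {t : ℝ} (ht : t ∈ T) (R : ℝ) {ε : ℝ} (hε : 0 < ε) :
    ∀ᶠ τ in 𝓝 t, ∀ x, |x| ≤ R →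
      ‖q x τ - q x t - (τ - t) • dt q x t‖ ≤ ε * |τ - t| := by
  obtain ⟨r, hr, hrT⟩ := Metric.nhds_basis_closedBall.mem_iff.1 (hT.mem_nhds ht)
  have hcomp : IsCompact (Set.Icc (-R) R ×ˢ Metric.closedBall t r) :=
    isCompact_Icc.prod (isCompact_closedBall t r)
  have hu := hcomp.uniformContinuousOn_of_continuous
    (hq.continuousOn_dt.mono (Set.prod_mono (Set.subset_univ _) hrT))
  obtain ⟨δ, hδ, hδu⟩ := Metric.uniformContinuousOn_iff.1 hu ε hε
  have hmin : 0 < min δ r := lt_min hδ hr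
  filter_upwards [Metric.ball_mem_nhds t hmin] with τ hτ x hx
  have hxR : x ∈ Set.Icc (-R) R := abs_le.1 hx
  have hder : ∀ s ∈ Metric.ball t (min δ r), HasDerivWithinAt
      (fun s => q x s - s • dt q x t) (dt q x s - dt q x t) (Metric.ball t (min δ r)) s := by
    intro s hs
    have hsT : s ∈ T := hrT (Metric.ball_subset_closedBall
      (Metric.ball_subset_ball (min_le_right _ _) hs))
    have h1 : HasDerivAt (fun s => q x s) (dt q x s) s :=
      (hq.differentiable_t s hsT x).hasDerivAt
    have h2 : HasDerivAt (fun s : ℝ => s • dt q x t) (dt q x t) s := by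
      simpa using (hasDerivAt_id s).smul_const (dt q x t)
    exact (h1.sub h2).hasDerivWithinAt
  have hbd : ∀ s ∈ Metric.ball t (min δ r), ‖dt q x s - dt q x t‖ ≤ ε := by
    intro s hs
    have := hδu (x, s) ⟨hxR, Metric.ball_subset_closedBall
      (Metric.ball_subset_ball (min_le_right _ _) hs)⟩ (x, t)
      ⟨hxR, Metric.mem_closedBall_self hr.le⟩
      (by
        rw [Prod.dist_eq]
        simpa [hδ] using (lt_of_lt_of_le hs (min_le_left δ r)))
    rw [← dist_eq_norm]; exact this.le
  have := (convex_ball t (min δ r)).norm_image_sub_le_of_norm_hasDerivWithin_le hder hbd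
    (Metric.mem_ball_self hmin) hτ
  rw [Real.norm_eq_abs] at this
  have e : q x τ - q x t - (τ - t) • dt q x t = q x τ - τ • dt q x t - (q x t - t • dt q x t) := by
    rw [sub_smul]; abel
  rwa [e]

end TimeDifferentiability

/-! ### Zero curvature; derivatives of the fundamental matrix in time and spectral parameter. -/

variable {q : ℝ → ℝ → ℂ} {L t : ℝ} {T : Set ℝ}

/-- The coefficient matrix `U (-2 i z² σ₃ + 2 z Q + i σ₃ (Q_x - Q²)) U⁻¹` of the time part of the
Lax pair in the modified frame. -/
def laxB (q : ℝ → ℝ → ℂ) (t : ℝ) (z : ℂ) (x : ℝ) : Matrix (Fin 2) (Fin 2) ℂ :=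
  !![2 * z * (q x t).re - (dx q x t).im,
      2 * z ^ 2 + 2 * z * (q x t).im + ((q x t).re ^ 2 + (q x t).im ^ 2) + (dx q x t).re;
    -2 * z ^ 2 + 2 * z * (q x t).im - ((q x t).re ^ 2 + (q x t).im ^ 2) + (dx q x t).re,
      -(2 * z * (q x t).re - (dx q x t).im)]

theorem hasDerivAt_re_im {f : ℝ → ℂ} {f' : ℂ} {x : ℝ} (h : HasDerivAt f f' x) :
    HasDerivAt (fun y => ((f y).re : ℂ)) (f'.re : ℂ) x ∧
      HasDerivAt (fun y => ((f y).im : ℂ)) (f'.im : ℂ) x := by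
  have h1 := (Complex.ofRealCLM.comp Complex.reCLM).hasFDerivAt.comp_hasDerivAt x h
  have h2 := (Complex.ofRealCLM.comp Complex.imCLM).hasFDerivAt.comp_hasDerivAt x h
  exact ⟨by simpa [Function.comp_def] using h1, by simpa [Function.comp_def] using h2⟩

theorem IsPeriodicNLSSolution.hasDerivAt_x (hq : IsPeriodicNLSSolution q L T) (ht : t ∈ T)
    (x : ℝ) : HasDerivAt (fun y => q y t) (dx q x t) x :=
  ((hq.contDiff_x t ht).differentiable (by norm_num) x).hasDerivAt

theorem IsPeriodicNLSSolution.hasDerivAt_dx (hq : IsPeriodicNLSSolution q L T) (ht : t ∈ T)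
    (x : ℝ) : HasDerivAt (fun y => dx q y t) (dxx q x t) x := by
  have h := hq.contDiff_x t ht
  have : ContDiff ℝ 1 (deriv fun y => q y t) := by
    have h2 : ContDiff ℝ (1 + 1) (fun y => q y t) := by simpa [one_add_one_eq_two] using h
    exact (contDiff_succ_iff_deriv.1 h2).2.2
  exact (this.differentiable (by norm_num) x).hasDerivAt

theorem IsPeriodicNLSSolution.continuous_dx_slice (hq : IsPeriodicNLSSolution q L T)
    (ht : t ∈ T) : Continuous fun x => dx q x t :=
  continuous_iff_continuousAt.2 fun x => (hq.hasDerivAt_dx ht x).continuousAt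

theorem IsPeriodicNLSSolution.dx_periodic (hq : IsPeriodicNLSSolution q L T) (ht : t ∈ T)
    (x : ℝ) : dx q (x + L) t = dx q x t := by
  have h := (hq.hasDerivAt_x ht (x + L)).comp_add_const x L
  have h2 : (fun y => q (y + L) t) = fun y => q y t := funext (hq.periodic t ht)
  rw [h2] at h
  exact h.unique (hq.hasDerivAt_x ht x)

theorem IsPeriodicNLSSolution.laxB_periodic (hq : IsPeriodicNLSSolution q L T) (ht : t ∈ T)
    (z : ℂ) (x : ℝ) : laxB q t z (x + L) = laxB q t z x := by
  simp only [laxB, hq.periodic t ht, hq.dx_periodic ht]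

theorem IsPeriodicNLSSolution.dt_re_im (hq : IsPeriodicNLSSolution q L T) (ht : t ∈ T) (x : ℝ) :
    ((dt q x t).re : ℂ) = -(dxx q x t).im + 2 * ((q x t).re ^ 2 + (q x t).im ^ 2) * (q x t).im ∧
    ((dt q x t).im : ℂ) = (dxx q x t).re - 2 * ((q x t).re ^ 2 + (q x t).im ^ 2) * (q x t).re := by
  have h := hq.dt_eq ht x
  have hn : ((‖q x t‖ : ℝ) : ℂ) ^ 2 = (((q x t).re ^ 2 + (q x t).im ^ 2 : ℝ) : ℂ) := by
    rw [← Complex.ofReal_pow, Complex.sq_norm, Complex.normSq_apply]; congr 1; ring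
  rw [hn] at h
  rw [h]
  constructor <;> norm_cast <;> simp [-Complex.ofReal_add, -Complex.ofReal_pow]

/-- The zero-curvature equation. -/
theorem IsPeriodicNLSSolution.hasDerivAt_laxB (hq : IsPeriodicNLSSolution q L T) (ht : t ∈ T)
    (z : ℂ) (x : ℝ) :
    HasDerivAt (fun y => laxB q t z y 0 0) (((dt q x t).re : ℂ)
      + (((q x t).im + z) * laxB q t z x 1 0 - laxB q t z x 0 1 * ((q x t).im - z))) x ∧
    HasDerivAt (fun y => laxB q t z y 0 1) (((dt q x t).im : ℂ)
      + (2 * (q x t).re * laxB q t z x 0 1 - 2 * laxB q t z x 0 0 * ((q x t).im + z))) x ∧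
    HasDerivAt (fun y => laxB q t z y 1 0) (((dt q x t).im : ℂ)
      + (2 * laxB q t z x 0 0 * ((q x t).im - z) - 2 * (q x t).re * laxB q t z x 1 0)) x := by
  obtain ⟨h1, h2⟩ := hasDerivAt_re_im (hq.hasDerivAt_x ht x)
  obtain ⟨h3, h4⟩ := hasDerivAt_re_im (hq.hasDerivAt_dx ht x)
  obtain ⟨e1, e2⟩ := hq.dt_re_im ht x
  rw [e1, e2]
  simp only [laxB, Matrix.of_apply, Matrix.cons_val', Matrix.cons_val_zero, Matrix.cons_val_one,
    Matrix.cons_val_fin_one]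
  refine ⟨?_, ?_, ?_⟩
  · convert! (h1.const_mul (2 * z)).sub h4 using 1
    ring
  · convert! (((h2.const_mul (2 * z)).const_add (2 * z ^ 2)).add
      ((h1.pow 2).add (h2.pow 2))).add h3 using 1
    push_cast; ring
  · convert! (((h2.const_mul (2 * z)).const_add (-2 * z ^ 2)).sub
      ((h1.pow 2).add (h2.pow 2))).add h3 using 1
    push_cast; ring

/-- The entries of `∫₀ˣ Ỹᵀ Ỹ`. -/
def gram (q : ℝ → ℝ → ℂ) (t : ℝ) (z : ℂ) (i j : Fin 2) (x : ℝ) : ℂ :=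
  ∫ s in (0 : ℝ)..x, (modMatrix q t z s 0 i * modMatrix q t z s 0 j
    + modMatrix q t z s 1 i * modMatrix q t z s 1 j)

theorem IsPeriodicPotential.continuous_modMatrix (h : IsPeriodicPotential q L t) (z : ℂ)
    (i j : Fin 2) : Continuous fun x => modMatrix q t z x i j := by
  refine continuous_iff_continuousAt.2 fun x => ?_
  have := h.hasDerivAt_modMatrix z j x
  fin_cases i
  · exact this.1.continuousAt
  · exact this.2.continuousAt

theorem IsPeriodicPotential.hasDerivAt_gram (h : IsPeriodicPotential q L t) (z : ℂ)
    (i j : Fin 2) (x : ℝ) :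
    HasDerivAt (gram q t z i j) (modMatrix q t z x 0 i * modMatrix q t z x 0 j
      + modMatrix q t z x 1 i * modMatrix q t z x 1 j) x := by
  have hc : Continuous fun s => modMatrix q t z s 0 i * modMatrix q t z s 0 j
      + modMatrix q t z s 1 i * modMatrix q t z s 1 j :=
    ((h.continuous_modMatrix z 0 i).mul (h.continuous_modMatrix z 0 j)).add
      ((h.continuous_modMatrix z 1 i).mul (h.continuous_modMatrix z 1 j))
  exact (hc.integral_hasStrictDerivAt 0 x).hasDerivAt

/-- The derivative of `Ỹ` in the spectral parameter. -/
def specDeriv (q : ℝ → ℝ → ℂ) (t : ℝ) (z : ℂ) (x : ℝ) : Matrix (Fin 2) (Fin 2) ℂ :=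
  modMatrix q t z x * !![gram q t z 0 1 x, gram q t z 1 1 x; -gram q t z 0 0 x, -gram q t z 0 1 x]

/-- The derivative of `Ỹ` in time. -/
def timeDeriv (q : ℝ → ℝ → ℂ) (t : ℝ) (z : ℂ) (x : ℝ) : Matrix (Fin 2) (Fin 2) ℂ :=
  laxB q t z x * modMatrix q t z x - modMatrix q t z x * laxB q t z 0

/-- Variation of parameters. The z-derivative of the coefficient matrix is J = (0 1; -1 0), and det
Ỹ = 1 gives Ỹ⁻¹ J Ỹ = J Ỹᵀ Ỹ, whose integral is the Gram matrix times J. This is how positivity of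
the Gram matrix enters the study of gaps. -/
theorem IsPeriodicPotential.hasDerivAt_specDeriv (h : IsPeriodicPotential q L t) (z : ℂ)
    (j : Fin 2) (x : ℝ) :
    HasDerivAt (fun y => specDeriv q t z y 0 j)
      ((q x t).re * specDeriv q t z x 0 j + ((q x t).im + z) * specDeriv q t z x 1 j
        + modMatrix q t z x 1 j) x ∧
    HasDerivAt (fun y => specDeriv q t z y 1 j)
      (((q x t).im - z) * specDeriv q t z x 0 j - (q x t).re * specDeriv q t z x 1 j
        - modMatrix q t z x 0 j) x := by
  obtain ⟨h00, h10⟩ := h.hasDerivAt_modMatrix z 0 x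
  obtain ⟨h01, h11⟩ := h.hasDerivAt_modMatrix z 1 x
  have g00 := h.hasDerivAt_gram z 0 0 x
  have g01 := h.hasDerivAt_gram z 0 1 x
  have g11 := h.hasDerivAt_gram z 1 1 x
  have hdet := h.det_modMatrix z x
  simp only [specDeriv, Matrix.mul_apply, Fin.sum_univ_two]
  fin_cases j <;> simp <;> constructor
  · convert! (h00.mul g01).sub (h01.mul g00) using 1
    linear_combination (-modMatrix q t z x 1 0) * hdet
  · convert! (h10.mul g01).sub (h11.mul g00) using 1
    linear_combination (modMatrix q t z x 0 0) * hdet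
  · convert! (h00.mul g11).sub (h01.mul g01) using 1
    linear_combination (-modMatrix q t z x 1 1) * hdet
  · convert! (h10.mul g11).sub (h11.mul g01) using 1
    linear_combination (modMatrix q t z x 0 1) * hdet

/-- With coefficient matrix X, zero curvature reads B_x = X_t + [X, B], so B Ỹ solves the
inhomogeneous equation with source X_t Ỹ. The homogeneous solution Ỹ B(0) is subtracted to make the
value at x = 0 vanish. -/
theorem IsPeriodicNLSSolution.hasDerivAt_timeDeriv (hq : IsPeriodicNLSSolution q L T)
    (hL : 0 < L) (ht : t ∈ T) (z : ℂ) (j : Fin 2) (x : ℝ) :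
    HasDerivAt (fun y => timeDeriv q t z y 0 j)
      ((q x t).re * timeDeriv q t z x 0 j + ((q x t).im + z) * timeDeriv q t z x 1 j
        + ((dt q x t).re * modMatrix q t z x 0 j + (dt q x t).im * modMatrix q t z x 1 j)) x ∧
    HasDerivAt (fun y => timeDeriv q t z y 1 j)
      (((q x t).im - z) * timeDeriv q t z x 0 j - (q x t).re * timeDeriv q t z x 1 j
        + ((dt q x t).im * modMatrix q t z x 0 j - (dt q x t).re * modMatrix q t z x 1 j)) x := by
  have h := hq.isPeriodicPotential hL ht
  obtain ⟨b00, b01, b10⟩ := hq.hasDerivAt_laxB ht z x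
  have e11 : ∀ y, laxB q t z y 1 1 = -laxB q t z y 0 0 := fun y => by simp [laxB]
  obtain ⟨m0, m1⟩ := h.hasDerivAt_modMatrix z j x
  obtain ⟨h00, h10⟩ := h.hasDerivAt_modMatrix z 0 x
  obtain ⟨h01, h11⟩ := h.hasDerivAt_modMatrix z 1 x
  simp only [timeDeriv, Matrix.sub_apply, Matrix.mul_apply, Fin.sum_univ_two, e11]
  constructor
  · convert! ((b00.mul m0).add (b01.mul m1)).sub
      ((h00.mul_const (laxB q t z 0 0 j)).add (h01.mul_const (laxB q t z 0 1 j))) using 1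
    ring
  · convert! ((b10.mul m0).sub (b00.mul m1)).sub
      ((h10.mul_const (laxB q t z 0 0 j)).add (h11.mul_const (laxB q t z 0 1 j))) using 1
    · funext y; simp [sub_eq_add_neg]
    · ring

/-- The real symmetric matrix with entries `Re w`, `Im w`, as a continuous linear map. -/
def symCLM : ℂ →L[ℝ] ((Fin 2 → ℂ) →L[ℝ] (Fin 2 → ℂ)) :=
  LinearMap.toContinuousLinearMap
    { toFun := fun w => mulVecCLM !![(w.re : ℂ), w.im; w.im, -w.re]
      map_add' := fun a b => by
        rw [← map_add]; congr 1; ext i j; fin_cases i <;> fin_cases j <;> simp <;> ring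
      map_smul' := fun r a => by
        rw [RingHom.id_apply, ← map_smul]; congr 1; ext i j; fin_cases i <;> fin_cases j <;> simp }

/-- The matrix `w J`, as a continuous linear map. -/
def rotCLM : ℂ →L[ℝ] ((Fin 2 → ℂ) →L[ℝ] (Fin 2 → ℂ)) :=
  LinearMap.toContinuousLinearMap
    { toFun := fun w => mulVecCLM !![0, w; -w, 0]
      map_add' := fun a b => by
        rw [← map_add]; congr 1; ext i j; fin_cases i <;> fin_cases j <;> simp; ring
      map_smul' := fun r a => by
        rw [RingHom.id_apply, ← map_smul]; congr 1; ext i j; fin_cases i <;> fin_cases j <;> simp }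

theorem symCLM_apply (w : ℂ) (v : Fin 2 → ℂ) :
    symCLM w v = ![w.re * v 0 + w.im * v 1, w.im * v 0 - w.re * v 1] := by
  change !![(w.re : ℂ), w.im; w.im, -w.re] *ᵥ v = _
  ext i; fin_cases i <;> simp [Matrix.mulVec, dotProduct, sub_eq_add_neg]

theorem rotCLM_apply (w : ℂ) (v : Fin 2 → ℂ) : rotCLM w v = ![w * v 1, -w * v 0] := by
  change !![0, w; -w, 0] *ᵥ v = _
  ext i; fin_cases i <;> simp [Matrix.mulVec, dotProduct]

theorem exists_norm_le_on_Icc {F : Type*} [SeminormedAddCommGroup F] {f : ℝ → F}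
    (hf : Continuous f) (R : ℝ) : ∃ K, ∀ x, |x| ≤ R → ‖f x‖ ≤ K := by
  obtain ⟨K, hK⟩ := (isCompact_Icc (a := -R) (b := R)).exists_bound_of_continuousOn
    hf.continuousOn
  exact ⟨K, fun x hx => hK x (abs_le.1 hx)⟩

/-- `timeDeriv` and `specDeriv` already solve the linearized equation, so `hasFDerivAt_linearODE`
applies to each column. Differentiability jointly in (t, z) is what the motion of the Dirichlet
eigenvalues requires. -/
theorem IsPeriodicNLSSolution.hasFDerivAt_modMatrix (hq : IsPeriodicNLSSolution q L T)
    (hL : 0 < L) (hT : IsOpen T) (ht : t ∈ T) (z : ℂ) (x : ℝ) (i j : Fin 2) :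
    HasFDerivAt (fun p : ℝ × ℂ => modMatrix q p.1 p.2 x i j)
      ((ContinuousLinearMap.fst ℝ ℝ ℂ).smulRight (timeDeriv q t z x i j)
        + (ContinuousLinearMap.snd ℝ ℝ ℂ).smulRight (specDeriv q t z x i j)) (t, z) := by
  have hpot := hq.isPeriodicPotential hL ht
  set A : ℝ × ℂ → ℝ → (Fin 2 → ℂ) →L[ℝ] (Fin 2 → ℂ) :=
    fun p x => symCLM (q x p.1) + rotCLM p.2 with hA
  set A' : ℝ → ℝ × ℂ →L[ℝ] (Fin 2 → ℂ) →L[ℝ] (Fin 2 → ℂ) := fun x =>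
    (ContinuousLinearMap.fst ℝ ℝ ℂ).smulRight (symCLM (dt q x t))
      + rotCLM.comp (ContinuousLinearMap.snd ℝ ℝ ℂ) with hA'
  set v : ℝ × ℂ → ℝ → Fin 2 → ℂ := fun p x i => modMatrix q p.1 p.2 x i j with hv
  set D : ℝ → ℝ × ℂ →L[ℝ] (Fin 2 → ℂ) := fun x =>
    (ContinuousLinearMap.fst ℝ ℝ ℂ).smulRight (fun i => timeDeriv q t z x i j)
      + (ContinuousLinearMap.snd ℝ ℝ ℂ).smulRight (fun i => specDeriv q t z x i j) with hD
  have hTt : ∀ᶠ p : ℝ × ℂ in 𝓝 (t, z), p.1 ∈ T :=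
    continuous_fst.continuousAt.eventually (hT.mem_nhds ht)
  have hv0 : ∀ᶠ p in 𝓝 (t, z), v p 0 = fun i => (1 : Matrix (Fin 2) (Fin 2) ℂ) i j := by
    filter_upwards [hTt] with p hp
    simp only [hv, (hq.isPeriodicPotential hL hp).modMatrix_zero]
  have hvd : ∀ᶠ p in 𝓝 (t, z), ∀ x, HasDerivAt (v p) (A p x (v p x)) x := by
    filter_upwards [hTt] with p hp y
    obtain ⟨h1, h2⟩ := (hq.isPeriodicPotential hL hp).hasDerivAt_modMatrix p.2 j y
    rw [hasDerivAt_fin2]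
    simp only [hA, hv, add_apply, symCLM_apply, rotCLM_apply]
    constructor
    · convert! h1 using 1
      simp; ring
    · convert! h2 using 1
      simp; ring
  have hdtc : Continuous fun y => dt q y t :=
    continuousOn_univ.1 (hq.continuousOn_dt.comp (f := fun y : ℝ => (y, t)) (s := Set.univ)
      (by fun_prop) (fun y _ => ⟨trivial, ht⟩))
  have hDd : ∀ h y, HasDerivAt (fun y => D y h) (A (t, z) y (D y h) + A' y h (v (t, z) y)) y := by
    intro h y
    obtain ⟨r0, r1⟩ := hpot.hasDerivAt_specDeriv z j y
    obtain ⟨s0, s1⟩ := hq.hasDerivAt_timeDeriv hL ht z j y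
    rw [hasDerivAt_fin2]
    simp only [hA, hA', hv, hD, add_apply, symCLM_apply, rotCLM_apply,
      ContinuousLinearMap.smulRight_apply, ContinuousLinearMap.comp_apply,
      ContinuousLinearMap.coe_fst', ContinuousLinearMap.coe_snd', Pi.add_apply, Pi.smul_apply,
      smul_apply]
    constructor
    · convert! (s0.const_smul h.1).add (r0.const_smul h.2) using 1
      simp; ring
    · convert! (s1.const_smul h.1).add (r1.const_smul h.2) using 1
      simp; ring
  have hDc : Continuous D := continuous_clm_apply.2 fun h =>
    continuous_iff_continuousAt.2 fun y => (hDd h y).continuousAt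
  obtain ⟨K1, hK1⟩ := exists_norm_le_on_Icc (f := A (t, z))
    ((symCLM.continuous.comp hpot.continuous).add continuous_const) |x|
  obtain ⟨K2, hK2⟩ := exists_norm_le_on_Icc (f := A')
    (((ContinuousLinearMap.smulRightL ℝ _ _ _).continuous.comp
      (symCLM.continuous.comp hdtc)).add continuous_const) |x|
  obtain ⟨K3, hK3⟩ := exists_norm_le_on_Icc (f := v (t, z))
    (continuous_iff_continuousAt.2 fun y => (hvd.self_of_nhds y).continuousAt) |x|
  obtain ⟨K4, hK4⟩ := exists_norm_le_on_Icc hDc |x|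
  set K := max 1 (max (max K1 K2) (max K3 K4)) with hKdef
  have key := hasFDerivAt_linearODE (K := K) (R := |x|) (D := D) (A' := A') (p₀ := (t, z))
    (lt_max_of_lt_left one_pos) hv0 hvd
    (by
      refine ContinuousLinearMap.ext fun h => funext fun i => ?_
      simp only [hD, timeDeriv, specDeriv, hpot.modMatrix_zero]
      fin_cases i <;> fin_cases j <;> simp [gram])
    hDd
    (fun y hy => (hK1 y hy).trans (by simp [hKdef]))
    (fun y hy => (hK2 y hy).trans (by simp [hKdef]))
    (fun y hy => (hK3 y hy).trans (by simp [hKdef]))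
    (fun y hy => (hK4 y hy).trans (by simp [hKdef]))
    (fun ε hε => by
      have hS : 0 < ‖symCLM‖ + 1 := by positivity
      have := hq.uniform_differentiable hT ht |x| (div_pos hε hS)
      have h2 : ∀ᶠ p : ℝ × ℂ in 𝓝 (t, z), ∀ y, |y| ≤ |x| →
          ‖q y p.1 - q y t - (p.1 - t) • dt q y t‖ ≤ ε / (‖symCLM‖ + 1) * |p.1 - t| :=
        (continuous_fst.tendsto (t, z)).eventually this
      filter_upwards [h2] with p hp y hy
      -- The coefficient matrix is affine in z, so only the potential contributes to the
      -- linearization error.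
      have e : A p y - A (t, z) y - A' y (p - (t, z))
          = symCLM (q y p.1 - q y t - (p.1 - t) • dt q y t) := by
        simp only [hA, hA', add_apply, ContinuousLinearMap.smulRight_apply,
          ContinuousLinearMap.comp_apply, ContinuousLinearMap.coe_fst',
          ContinuousLinearMap.coe_snd', map_sub, map_smul]
        module
      rw [e]
      calc _ ≤ ‖symCLM‖ * (ε / (‖symCLM‖ + 1) * |p.1 - t|) :=
            (symCLM.le_opNorm _).trans (by gcongr; exact hp y hy)
        _ ≤ (‖symCLM‖ + 1) * (ε / (‖symCLM‖ + 1) * |p.1 - t|) := by gcongr; linarith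
        _ = ε * |p.1 - t| := by field_simp
        _ ≤ ε * ‖p - (t, z)‖ := by
            gcongr
            exact norm_fst_le (p - (t, z)))
    (x := x) le_rfl
  have h2 := (hasFDerivAt_pi'.1 key) i
  convert! h2 using 1

theorem IsPeriodicNLSSolution.hasDerivAt_modMatrix_time (hq : IsPeriodicNLSSolution q L T)
    (hL : 0 < L) (hT : IsOpen T) (ht : t ∈ T) (z : ℂ) (x : ℝ) (i j : Fin 2) :
    HasDerivAt (fun τ => modMatrix q τ z x i j) (timeDeriv q t z x i j) t := by
  have h := hq.hasFDerivAt_modMatrix hL hT ht z x i j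
  have h2 : HasDerivAt (fun τ : ℝ => (τ, z)) (1, 0) t :=
    (hasDerivAt_id t).prodMk (hasDerivAt_const t z)
  simpa [Function.comp_def] using h.comp_hasDerivAt t h2

/-- The real derivative in z is multiplication by a complex number, hence a complex derivative; thus
the monodromy matrix is entire in z. -/
theorem IsPeriodicNLSSolution.hasDerivAt_modMatrix_spec (hq : IsPeriodicNLSSolution q L T)
    (hL : 0 < L) (hT : IsOpen T) (ht : t ∈ T) (z : ℂ) (x : ℝ) (i j : Fin 2) :
    HasDerivAt (fun w => modMatrix q t w x i j) (specDeriv q t z x i j) z := by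
  have h := hq.hasFDerivAt_modMatrix hL hT ht z x i j
  have h2 : HasFDerivAt (fun w : ℂ => (t, w)) (ContinuousLinearMap.inr ℝ ℝ ℂ) z :=
    hasFDerivAt_prodMk_right t z
  have h3 := h.comp z h2
  refine hasDerivAt_iff_hasFDerivAt.2 (hasFDerivAt_of_restrictScalars (𝕜 := ℝ) h3 ?_)
  refine ContinuousLinearMap.ext fun w => ?_
  simp

/-! ### Energy identity, Floquet theory and the Lax spectrum. -/

/-- A nonzero solution vanishes nowhere. -/
theorem IsPeriodicPotential.zsSolution_ne_zero (h : IsPeriodicPotential q L t) {z : ℂ}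
    {v : ℝ → Fin 2 → ℂ} (hv : IsZSSolution q t z v) (hv0 : v ≠ 0) (x : ℝ) : v x ≠ 0 := by
  intro hx
  apply hv0
  have h1 : v 0 = 0 := by
    rw [h.zsSolution_eq hv] at hx
    exact Matrix.eq_zero_of_mulVec_eq_zero (by rw [h.det_principalMatrix]; exact one_ne_zero) hx
  funext y
  rw [h.zsSolution_eq hv, h1]; simp

theorem hasDerivAt_norm_sq {f : ℝ → ℂ} {f' : ℂ} {x : ℝ} (hf : HasDerivAt f f' x) :
    HasDerivAt (fun y => ‖f y‖ ^ 2) (2 * (f' * conj (f x)).re) x := by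
  have := hf.norm_sq
  convert this using 1
  rw [Complex.inner]

/-- The energy identity `(|v₁|² - |v₂|²)' = 2 Im z (|v₁|² + |v₂|²)`. -/
theorem IsZSSolution.hasDerivAt_energy {z : ℂ} {v : ℝ → Fin 2 → ℂ} (hv : IsZSSolution q t z v)
    (x : ℝ) : HasDerivAt (fun y => ‖v y 0‖ ^ 2 - ‖v y 1‖ ^ 2)
      (2 * z.im * (‖v x 0‖ ^ 2 + ‖v x 1‖ ^ 2)) x := by
  obtain ⟨h0, h1⟩ := isZSSolution_iff.1 hv x
  convert! (hasDerivAt_norm_sq h0).sub (hasDerivAt_norm_sq h1) using 1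
  simp only [Complex.sq_norm, Complex.normSq_apply, Complex.mul_re, Complex.add_re, Complex.add_im,
    Complex.mul_im, Complex.neg_re, Complex.neg_im, Complex.I_re, Complex.I_im, Complex.conj_re,
    Complex.conj_im]
  ring

/-- Multiplied by Im z, the energy has derivative 2 (Im z)² |v|² > 0. Applied over one period, this
excludes non-real spectrum and decides which component of a Bloch solution is larger. -/
theorem IsPeriodicPotential.energy_lt (h : IsPeriodicPotential q L t) {z : ℂ}
    {v : ℝ → Fin 2 → ℂ} (hv : IsZSSolution q t z v) (hv0 : v ≠ 0) (hz : z.im ≠ 0) (x : ℝ) :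
    z.im * (‖v x 0‖ ^ 2 - ‖v x 1‖ ^ 2) < z.im * (‖v (x + L) 0‖ ^ 2 - ‖v (x + L) 1‖ ^ 2) := by
  have hd := fun x => (hv.hasDerivAt_energy x).const_mul z.im
  have hmono : StrictMono fun x => z.im * (‖v x 0‖ ^ 2 - ‖v x 1‖ ^ 2) := by
    refine strictMono_of_deriv_pos fun x => ?_
    rw [(hd x).deriv]
    have hx := h.zsSolution_ne_zero hv hv0 x
    have : 0 < ‖v x 0‖ ^ 2 + ‖v x 1‖ ^ 2 := by
      by_contra hle
      apply hx
      have a0 : 0 ≤ ‖v x 0‖ ^ 2 := by positivity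
      have a1 : 0 ≤ ‖v x 1‖ ^ 2 := by positivity
      have e0 : ‖v x 0‖ ^ 2 = 0 := by linarith
      have e1 : ‖v x 1‖ ^ 2 = 0 := by linarith
      ext i
      fin_cases i
      · simpa using e0
      · simpa using e1
    have h2 : 0 < z.im * z.im := mul_self_pos.2 hz
    nlinarith
  exact hmono (by linarith [h.pos])

/-- A solution multiplied by `r` over one period is a Bloch solution. -/
theorem IsPeriodicPotential.bloch_of_period (h : IsPeriodicPotential q L t) {z r : ℂ}
    {v : ℝ → Fin 2 → ℂ} (hv : IsModZSSolution q t z v) (hr : v L = r • v 0) (x : ℝ) :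
    v (x + L) = r • v x := by
  have h1 : IsModZSSolution q t z (fun x => r • v x) := by
    intro x
    rw [Matrix.mulVec_smul]
    exact (hv x).const_smul r
  exact congrFun (h.modSolution_unique (h.modSolution_shift hv) h1 (by simpa using hr)) x

theorem char_root_iff {z r : ℂ} (h : IsPeriodicPotential q L t) :
    r ^ 2 - 2 * discriminant q L t z * r + 1 = 0 ↔
      (modMatrix q t z L 0 0 - r) * (modMatrix q t z L 1 1 - r)
        - modMatrix q t z L 0 1 * modMatrix q t z L 1 0 = 0 := by
  have hd := h.det_modMatrix z L
  rw [discriminant_eq]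
  constructor <;> intro h1
  · linear_combination h1 + hd
  · linear_combination h1 - hd

theorem IsPeriodicPotential.exists_bloch_of_root (h : IsPeriodicPotential q L t) {z r : ℂ}
    (hr : r ^ 2 - 2 * discriminant q L t z * r + 1 = 0) :
    ∃ v, IsModZSSolution q t z v ∧ v 0 ≠ 0 ∧ ∀ x, v (x + L) = r • v x := by
  have hdet : (modMatrix q t z L - r • (1 : Matrix (Fin 2) (Fin 2) ℂ)).det = 0 := by
    rw [Matrix.det_fin_two]
    simpa using (char_root_iff h).1 hr
  obtain ⟨c, hc0, hc⟩ := Matrix.exists_mulVec_eq_zero_iff.2 hdet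
  refine ⟨fun x => modMatrix q t z x *ᵥ c, h.modSolution_mulVec z c, ?_, ?_⟩
  · simpa [h.modMatrix_zero] using hc0
  · refine h.bloch_of_period (h.modSolution_mulVec z c) ?_
    rw [Matrix.sub_mulVec, Matrix.smul_mulVec, Matrix.one_mulVec, sub_eq_zero] at hc
    simp only [h.modMatrix_zero, Matrix.one_mulVec, hc]

theorem IsModZSSolution.continuous {z : ℂ} {v : ℝ → Fin 2 → ℂ} (hv : IsModZSSolution q t z v) :
    Continuous v := continuous_iff_continuousAt.2 fun x => (hv x).continuousAt

/-- Cayley–Hamilton for M, with det M = 1, gives the relation at x = 0; uniqueness of solutions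
carries it to all x. With r + 1/r = 2Δ it factors the shift by L as (shift - r)(shift - 1/r) = 0. -/
theorem IsPeriodicPotential.cayley_hamilton (h : IsPeriodicPotential q L t) {z : ℂ}
    {v : ℝ → Fin 2 → ℂ} (hv : IsModZSSolution q t z v) (x : ℝ) :
    v (x + L + L) = (2 * discriminant q L t z) • v (x + L) - v x := by
  have hs := h.modSolution_shift hv
  have e1 := h.modSolution_eq hs L
  have e2 := h.modSolution_eq hv L
  have hd := h.det_modMatrix z L
  simp only [zero_add] at e1
  have key : v (L + L) = (2 * discriminant q L t z) • v L - v 0 := by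
    rw [e1, e2, discriminant_eq]
    ext i
    fin_cases i <;> simp [Matrix.mulVec, dotProduct, Fin.sum_univ_two]
    · linear_combination (-v 0 0) * hd
    · linear_combination (-v 0 1) * hd
  have h1 : IsModZSSolution q t z
      (fun x => (2 * discriminant q L t z) • v (x + L) - v x) := by
    intro x
    rw [Matrix.mulVec_sub, Matrix.mulVec_smul]
    exact ((hs x).const_smul (2 * discriminant q L t z)).sub (hv x)
  exact congrFun (h.modSolution_unique (h.modSolution_shift hs) h1 (by simpa using key)) x

/-- Iteration gives exponential growth along the multiples of a. The step a may be negative, which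
covers growth towards -∞. -/
theorem eq_zero_of_bounded_of_multiplier {E : Type*} [NormedAddCommGroup E] [NormedSpace ℂ E]
    {g : ℝ → E} {C a : ℝ} {s : ℂ} (hb : ∀ x, ‖g x‖ ≤ C) (hs : 1 < ‖s‖)
    (hg : ∀ x, g (x + a) = s • g x) : g 0 = 0 := by
  by_contra hne
  have hn : ∀ n : ℕ, g (n * a) = s ^ n • g 0 := by
    intro n
    induction n with
    | zero => simp
    | succ n ih =>
      have : ((n + 1 : ℕ) : ℝ) * a = n * a + a := by push_cast; ring
      rw [this, hg, ih, smul_smul, pow_succ']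
  have hpos : 0 < ‖g 0‖ := norm_pos_iff.2 hne
  obtain ⟨n, hn'⟩ := pow_unbounded_of_one_lt (C / ‖g 0‖) hs
  have := hb (n * a)
  rw [hn, norm_smul, norm_pow] at this
  rw [div_lt_iff₀ hpos] at hn'
  linarith

theorem exists_root (D : ℂ) : ∃ r : ℂ, r ^ 2 - 2 * D * r + 1 = 0 := by
  obtain ⟨w, hw⟩ := IsAlgClosed.exists_pow_nat_eq (D ^ 2 - 1) two_pos
  exact ⟨D + w, by linear_combination hw⟩

/-- If no root has modulus 1, let |r| < 1. For a bounded solution, ψ(x + L) - r ψ(x) grows by 1/r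
under the shift by L, and ψ(x + L) - r⁻¹ ψ(x) grows by 1/r under the shift by -L; both vanish, so
ψ(0) = 0. Conversely, a Bloch solution with unimodular multiplier has periodic norm. -/
theorem IsPeriodicPotential.mem_laxSpectrum_iff (h : IsPeriodicPotential q L t) {z : ℂ} :
    z ∈ laxSpectrum q t ↔ ∃ r : ℂ, r ^ 2 - 2 * discriminant q L t z * r + 1 = 0 ∧ ‖r‖ = 1 := by
  constructor
  · rintro ⟨φ, hφ, hφ0, C, hC⟩
    by_contra hno
    push Not at hno
    obtain ⟨r, hr⟩ := exists_root (discriminant q L t z)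
    have hr0 : r ≠ 0 := by rintro rfl; simp at hr
    have hrinv : r⁻¹ ^ 2 - 2 * discriminant q L t z * r⁻¹ + 1 = 0 := by
      field_simp; linear_combination hr
    have hsum : 2 * discriminant q L t z = r + r⁻¹ := by
      field_simp; linear_combination -hr
    wlog hlt : ‖r‖ < 1 generalizing r
    · refine this r⁻¹ hrinv (inv_ne_zero hr0) (by rwa [inv_inv]) (by rw [inv_inv]; rw [hsum]; ring)
        ?_
      rw [norm_inv]
      exact inv_lt_one_of_one_lt₀ (lt_of_le_of_ne (not_lt.1 hlt) (hno r hr).symm)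
    have hinv : 1 < ‖r⁻¹‖ := by
      rw [norm_inv]; exact (one_lt_inv₀ (norm_pos_iff.2 hr0)).2 hlt
    set ψ : ℝ → Fin 2 → ℂ := fun x => U *ᵥ φ x with hψ
    have hψs : IsModZSSolution q t z ψ := isModZSSolution_iff.2 (by
      simpa only [hψ, Matrix.mulVec_mulVec, U_inv_mul, Matrix.one_mulVec] using hφ)
    obtain ⟨C', hC'⟩ : ∃ C', ∀ x, ‖ψ x‖ ≤ C' :=
      ⟨‖mulVecCLM U‖ * C, fun x => ((mulVecCLM U).le_opNorm (φ x)).trans (by gcongr; exact hC x)⟩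
    have hCH := h.cayley_hamilton hψs
    have hb : ∀ (s : ℂ) x y, ‖ψ x - s • ψ y‖ ≤ C' + ‖s‖ * C' := fun s x y =>
      (norm_sub_le _ _).trans (add_le_add (hC' x) (by rw [norm_smul]; gcongr; exact hC' y))
    have z1 : ψ (0 + L) - r • ψ 0 = 0 :=
      eq_zero_of_bounded_of_multiplier (g := fun x => ψ (x + L) - r • ψ x) (a := L) (s := r⁻¹)
        (fun x => hb r _ _) hinv (fun x => by
          rw [hCH, hsum]
          ext i
          simp
          field_simp
          ring)
    have z2 : ψ (0 + L) - r⁻¹ • ψ 0 = 0 :=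
      eq_zero_of_bounded_of_multiplier (g := fun x => ψ (x + L) - r⁻¹ • ψ x) (a := -L) (s := r⁻¹)
        (fun x => hb r⁻¹ _ _) hinv (fun x => by
          have := hCH (x - L)
          rw [hsum, sub_add_cancel] at this
          rw [neg_add_cancel_right, this, ← sub_eq_add_neg]
          ext i
          simp
          field_simp
          ring)
    have h0 : (r - r⁻¹) • ψ 0 = 0 := by
      rw [sub_smul, sub_eq_zero]
      rw [sub_eq_zero] at z1 z2
      rw [← z1, ← z2]
    have hne : r - r⁻¹ ≠ 0 := fun he => by
      rw [sub_eq_zero] at he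
      rw [← he] at hinv
      exact lt_asymm hlt hinv
    have hψ0 : ψ 0 = 0 := (smul_eq_zero.1 h0).resolve_left hne
    refine h.zsSolution_ne_zero hφ hφ0 0 ?_
    have := congrArg (fun w => U⁻¹ *ᵥ w) hψ0
    simpa only [hψ, Matrix.mulVec_mulVec, U_inv_mul, Matrix.one_mulVec, Matrix.mulVec_zero]
      using this
  · rintro ⟨r, hr, hr1⟩
    obtain ⟨v, hv, hv0, hvL⟩ := h.exists_bloch_of_root hr
    refine ⟨fun x => U⁻¹ *ᵥ v x, isModZSSolution_iff.1 hv, fun h0 => hv0 ?_, ?_⟩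
    · have := congrArg (fun w => U *ᵥ w) (congrFun h0 0)
      simpa only [Matrix.mulVec_mulVec, U_mul_inv, Matrix.one_mulVec, Pi.zero_apply,
        Matrix.mulVec_zero] using this
    · have hp : Function.Periodic (fun x => ‖v x‖) L := fun x => by
        simp only [hvL, norm_smul, hr1, one_mul]
      obtain ⟨C, hC⟩ := (hp.isBounded_of_continuous h.pos.ne' hv.continuous.norm).exists_norm_le
      refine ⟨‖mulVecCLM U⁻¹‖ * C, fun x => ((mulVecCLM U⁻¹).le_opNorm (v x)).trans ?_⟩
      gcongr
      simpa using hC ‖v x‖ ⟨x, rfl⟩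

theorem root_inv {D r : ℂ} (hr : r ^ 2 - 2 * D * r + 1 = 0) :
    r ≠ 0 ∧ 2 * D = r + r⁻¹ ∧ r⁻¹ ^ 2 - 2 * D * r⁻¹ + 1 = 0 := by
  have hr0 : r ≠ 0 := by rintro rfl; simp at hr
  refine ⟨hr0, ?_, ?_⟩
  · field_simp; linear_combination -hr
  · field_simp; linear_combination hr

theorem small_root_unique {D r r' : ℂ} (hr : r ^ 2 - 2 * D * r + 1 = 0) (h1 : ‖r‖ < 1)
    (hr' : r' ^ 2 - 2 * D * r' + 1 = 0) (h2 : ‖r'‖ < 1) : r = r' := by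
  obtain ⟨h0, hs, -⟩ := root_inv hr
  have : (r - r') * (r⁻¹ - r') = 0 := by
    rw [hs] at hr'
    field_simp at hr' ⊢
    linear_combination hr'
  rcases mul_eq_zero.1 this with h | h
  · exact sub_eq_zero.1 h
  · exfalso
    rw [sub_eq_zero] at h
    rw [← h, norm_inv] at h2
    exact absurd ((one_lt_inv₀ (norm_pos_iff.2 h0)).2 h1) h2.not_gt

theorem IsPeriodicPotential.isSmallMultiplier (h : IsPeriodicPotential q L t) {z : ℂ}
    (hz : z ∉ laxSpectrum q t) : IsSmallMultiplier q L t z (multiplier q L t z) := by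
  apply Classical.epsilon_spec (p := IsSmallMultiplier q L t z)
  obtain ⟨r, hr⟩ := exists_root (discriminant q L t z)
  obtain ⟨h0, -, hri⟩ := root_inv hr
  have hne : ‖r‖ ≠ 1 := fun h1 => hz (h.mem_laxSpectrum_iff.2 ⟨r, hr, h1⟩)
  rcases lt_or_gt_of_ne hne with h1 | h1
  · exact ⟨r, hr, h1⟩
  · exact ⟨r⁻¹, hri, by rw [norm_inv]; exact inv_lt_one_of_one_lt₀ h1⟩

/-- The multiplier `ρ^s`, and that it differs from its inverse. -/
theorem IsPeriodicPotential.multiplier_zpow (h : IsPeriodicPotential q L t) {z : ℂ}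
    (hz : z ∉ laxSpectrum q t) (s : ℤˣ) :
    (multiplier q L t z ^ (s : ℤ)) ^ 2
        - 2 * discriminant q L t z * multiplier q L t z ^ (s : ℤ) + 1 = 0 ∧
      ((s = 1 ∧ ‖multiplier q L t z ^ (s : ℤ)‖ < 1) ∨
        (s = -1 ∧ 1 < ‖multiplier q L t z ^ (s : ℤ)‖)) := by
  obtain ⟨hr, h1⟩ := h.isSmallMultiplier hz
  obtain ⟨h0, -, hri⟩ := root_inv hr
  rcases Int.units_eq_one_or s with rfl | rfl
  · simpa using ⟨hr, h1⟩
  · refine ⟨by simpa using hri, Or.inr ⟨rfl, ?_⟩⟩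
    simpa using (one_lt_inv₀ (norm_pos_iff.2 h0)).2 h1

/-! ### Normalized Bloch solutions and the Dirichlet spectrum. -/

theorem mulVec_one_cons (X : Matrix (Fin 2) (Fin 2) ℂ) (m : ℂ) :
    X *ᵥ ![1, m] = ![X 0 0 + X 0 1 * m, X 1 0 + X 1 1 * m] := by
  ext i; fin_cases i <;> simp [Matrix.mulVec, dotProduct]

/-- `(1, m)` is the initial value of a normalized Bloch-Floquet solution. -/
def IsBlochSlope (s : ℤˣ) (q : ℝ → ℝ → ℂ) (L t : ℝ) (z m : ℂ) : Prop :=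
  modMatrix q t z L 0 0 + modMatrix q t z L 0 1 * m = multiplier q L t z ^ (s : ℤ) ∧
    modMatrix q t z L 1 0 + modMatrix q t z L 1 1 * m = multiplier q L t z ^ (s : ℤ) * m

theorem IsPeriodicPotential.isNormalizedBloch_of_slope (h : IsPeriodicPotential q L t)
    {s : ℤˣ} {z m : ℂ} (hm : IsBlochSlope s q L t z m) :
    IsNormalizedBloch s q L t z (fun x => modMatrix q t z x *ᵥ ![1, m]) := by
  refine ⟨h.modSolution_mulVec z _, h.bloch_of_period (h.modSolution_mulVec z _) ?_, ?_⟩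
  · simp only [h.modMatrix_zero, Matrix.one_mulVec, mulVec_one_cons, hm.1, hm.2]
    ext i; fin_cases i <;> simp
  · simp only [h.modMatrix_zero, Matrix.one_mulVec]; rfl

theorem IsPeriodicPotential.slope_of_isNormalizedBloch (h : IsPeriodicPotential q L t)
    {s : ℤˣ} {z : ℂ} {v : ℝ → Fin 2 → ℂ} (hv : IsNormalizedBloch s q L t z v) :
    IsBlochSlope s q L t z (v 0 1) ∧ v = fun x => modMatrix q t z x *ᵥ ![1, v 0 1] := by
  have e0 : v 0 = ![1, v 0 1] := by
    ext i; fin_cases i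
    · simpa using hv.2.2
    · rfl
  have e1 : v = fun x => modMatrix q t z x *ᵥ ![1, v 0 1] := by
    funext x; rw [← e0]; exact h.modSolution_eq hv.1 x
  refine ⟨?_, e1⟩
  have hL := hv.2.1 0
  rw [zero_add, h.modSolution_eq hv.1 L, e0, mulVec_one_cons] at hL
  constructor
  · simpa using congrFun hL 0
  · simpa using congrFun hL 1

/-- On `[0, L]` solutions are determined by their initial value. -/
theorem IsPeriodicPotential.zsSolution_eq_on_Icc (h : IsPeriodicPotential q L t) {z : ℂ}
    {v : ℝ → Fin 2 → ℂ} (hv : ∀ x ∈ Set.Icc 0 L,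
      HasDerivWithinAt v (zsMatrix q t z x *ᵥ v x) (Set.Icc 0 L) x) {x : ℝ}
    (hx : x ∈ Set.Icc 0 L) : v x = principalMatrix q t z x *ᵥ v 0 := by
  obtain ⟨K, hK⟩ := h.exists_norm_zs_le z
  have hY := h.zsSolution_mulVec z (v 0)
  have := norm_le_gronwallBound_of_norm_deriv_right_le
    (f := fun x => v x - principalMatrix q t z x *ᵥ v 0)
    (f' := fun x => zsMatrix q t z x *ᵥ v x
      - zsMatrix q t z x *ᵥ (principalMatrix q t z x *ᵥ v 0))
    (δ := 0) (K := K) (ε := 0) (a := 0) (b := L)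
    (fun y hy => ((hv y hy).sub (hY y).hasDerivWithinAt).continuousWithinAt)
    (fun y hy => by
      refine ((hv y (Set.Ico_subset_Icc_self hy)).mono_of_mem_nhdsWithin ?_).sub
        (hY y).hasDerivWithinAt
      exact Filter.mem_of_superset (Ico_mem_nhdsGE hy.2)
        (fun w hw => ⟨hy.1.trans hw.1, hw.2.le⟩))
    (by simp [(h.isPrincipalMatrix z).1])
    (fun y _ => by
      rw [← Matrix.mulVec_sub, add_zero]
      exact ((mulVecCLM (zsMatrix q t z y)).le_opNorm _).trans (by gcongr; exact hK y)) x hx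
  rw [gronwallBound_ε0_δ0] at this
  exact sub_eq_zero.1 (norm_le_zero_iff.1 this)

/-- The first component of U v is v₁ + v₂, so in the modified frame a Dirichlet solution starts as a
multiple of (0, 1) and returns to one at x = L. -/
theorem IsPeriodicPotential.mem_dirichletSpectrum_iff (h : IsPeriodicPotential q L t) {μ : ℂ} :
    μ ∈ dirichletSpectrum q L t ↔ modMatrix q t μ L 0 1 = 0 := by
  have hLmem : L ∈ Set.Icc 0 L := ⟨h.pos.le, le_rfl⟩
  constructor
  · rintro ⟨v, hv, ⟨x, hx, hvx⟩, h0, h1⟩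
    have hv0 : v 0 ≠ 0 := fun h0 => hvx (by
      rw [h.zsSolution_eq_on_Icc hv hx, h0, Matrix.mulVec_zero])
    have hL := h.zsSolution_eq_on_Icc hv hLmem
    have e1 : U *ᵥ v L = modMatrix q t μ L *ᵥ (U *ᵥ v 0) := by
      rw [hL]
      simp only [modMatrix, Matrix.mulVec_mulVec, mul_assoc, U_inv_mul, mul_one]
    have e2 := congrFun e1 0
    simp [Matrix.mulVec, dotProduct, U, Fin.sum_univ_two] at e2
    rw [h0, h1, mul_zero, zero_add] at e2
    have hv1 : v 0 1 = -v 0 0 := by linear_combination h0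
    rw [hv1] at e2
    have hne : v 0 0 ≠ 0 := fun h00 => hv0 (by
      ext i; fin_cases i
      · simpa using h00
      · simp [hv1, h00])
    have e3 : modMatrix q t μ L 0 1 * (-2 * Complex.I * v 0 0) = 0 := by
      linear_combination -e2
    exact (mul_eq_zero.1 e3).resolve_right (by simp [hne])
  · intro hB
    have hs := isModZSSolution_iff.1 (h.modSolution_mulVec μ ![0, 1])
    have hsum : ∀ w : Fin 2 → ℂ, (U⁻¹ *ᵥ w) 0 + (U⁻¹ *ᵥ w) 1 = w 0 := fun w => by
      rw [U_inv]; simp [Matrix.mulVec, dotProduct, Fin.sum_univ_two]; ring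
    refine ⟨_, fun x _ => (hs x).hasDerivWithinAt, ⟨0, ⟨le_rfl, h.pos.le⟩, fun h0 => ?_⟩, ?_, ?_⟩
    · have := congrArg (fun w => (U *ᵥ w) 1) h0
      simp only [Matrix.mulVec_mulVec, U_mul_inv, h.modMatrix_zero,
        Matrix.one_mulVec, Matrix.mulVec_zero] at this
      simp at this
    · rw [hsum, h.modMatrix_zero]; simp
    · rw [hsum]; simp [Matrix.mulVec, dotProduct, Fin.sum_univ_two, hB]

/-- If M₀₁ ≠ 0, the first row of the eigenvector relation determines m and the second follows from
the characteristic equation. If M₀₁ = 0, the eigenvalues are M₀₀ and M₁₁; the hypothesis excludes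
M₁₁ = ρ^s, so M₀₀ = ρ^s and the second row determines m. -/
theorem IsPeriodicPotential.exists_unique_slope (h : IsPeriodicPotential q L t) {z : ℂ}
    (hz : z ∉ laxSpectrum q t) {s : ℤˣ}
    (hd : ¬ (z ∈ dirichletSpectrum q L t ∧ dirichletSign q L t z = (s : ℤ))) :
    ∃! m, IsBlochSlope s q L t z m := by
  obtain ⟨hr, hcase⟩ := h.multiplier_zpow hz s
  have hdet := h.det_modMatrix z L
  have hchar := (char_root_iff h).1 hr
  unfold IsBlochSlope
  set r := multiplier q L t z ^ (s : ℤ) with hrdef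
  set A := modMatrix q t z L 0 0
  set B := modMatrix q t z L 0 1 with hB
  set C := modMatrix q t z L 1 0
  set D := modMatrix q t z L 1 1 with hD
  by_cases hB0 : B = 0
  · have hDr : r - D ≠ 0 := by
      intro he
      apply hd
      refine ⟨h.mem_dirichletSpectrum_iff.2 hB0, ?_⟩
      have hrD : D = r := by linear_combination -he
      rw [dirichletSign, ← hD, hrD]
      rcases hcase with ⟨rfl, hlt⟩ | ⟨rfl, hlt⟩
      · have hpos : 0 < ‖r‖ := norm_pos_iff.2 (root_inv hr).1
        rw [sign_neg (Real.log_neg hpos hlt)]; rfl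
      · rw [sign_pos (Real.log_pos hlt)]; rfl
    have hAr : A = r := by
      rw [hB0, zero_mul, sub_zero] at hchar
      rcases mul_eq_zero.1 hchar with h1 | h1
      · exact sub_eq_zero.1 h1
      · exact absurd (by linear_combination -h1) hDr
    refine ⟨C / (r - D), ⟨by simp [hB0, hAr], by field_simp; ring⟩, ?_⟩
    rintro m ⟨-, h2⟩
    rw [eq_div_iff hDr]
    linear_combination -h2
  · refine ⟨(r - A) / B, ⟨by field_simp; ring, ?_⟩, ?_⟩
    · field_simp
      linear_combination -hchar
    · rintro m ⟨h1, -⟩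
      rw [eq_div_iff hB0]
      linear_combination h1

theorem IsPeriodicPotential.isNormalizedBloch (h : IsPeriodicPotential q L t) {z : ℂ}
    (hz : z ∉ laxSpectrum q t) {s : ℤˣ}
    (hd : ¬ (z ∈ dirichletSpectrum q L t ∧ dirichletSign q L t z = (s : ℤ))) :
    IsNormalizedBloch s q L t z (bloch s q L t z) := by
  apply Classical.epsilon_spec (p := IsNormalizedBloch s q L t z)
  obtain ⟨m, hm, -⟩ := h.exists_unique_slope hz hd
  exact ⟨_, h.isNormalizedBloch_of_slope hm⟩

theorem IsPeriodicPotential.isBlochSlope (h : IsPeriodicPotential q L t) {z : ℂ}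
    (hz : z ∉ laxSpectrum q t) {s : ℤˣ}
    (hd : ¬ (z ∈ dirichletSpectrum q L t ∧ dirichletSign q L t z = (s : ℤ))) :
    IsBlochSlope s q L t z (bloch s q L t z 0 1) :=
  (h.slope_of_isNormalizedBloch (h.isNormalizedBloch hz hd)).1

theorem IsPeriodicPotential.bloch_unique (h : IsPeriodicPotential q L t) {z : ℂ}
    (hz : z ∉ laxSpectrum q t) {s : ℤˣ}
    (hd : ¬ (z ∈ dirichletSpectrum q L t ∧ dirichletSign q L t z = (s : ℤ)))
    {v : ℝ → Fin 2 → ℂ} (hv : IsNormalizedBloch s q L t z v) : v = bloch s q L t z := by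
  obtain ⟨h1, e1⟩ := h.slope_of_isNormalizedBloch hv
  obtain ⟨h2, e2⟩ := h.slope_of_isNormalizedBloch (h.isNormalizedBloch hz hd)
  rw [e1, e2, (h.exists_unique_slope hz hd).unique h1 h2]

/-! ### Reality of the monodromy matrix and consequences of the energy identity. -/

/-- `modMatrix` is real for real spectral parameter. -/
theorem IsPeriodicPotential.conj_modMatrix (h : IsPeriodicPotential q L t) (z : ℂ) (x : ℝ)
    (i j : Fin 2) : conj (modMatrix q t z x i j) = modMatrix q t (conj z) x i j := by
  have h1 : IsModZSSolution q t (conj z) (fun x i => conj (modMatrix q t z x i j)) := by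
    rw [isModZSSolution_iff_components]
    intro x
    obtain ⟨a, b⟩ := h.hasDerivAt_modMatrix z j x
    constructor
    · convert! a.star using 1; simp
    · convert! b.star using 1; simp
  have h2 : IsModZSSolution q t (conj z) (fun x i => modMatrix q t (conj z) x i j) :=
    isModZSSolution_iff_components.2 (h.hasDerivAt_modMatrix (conj z) j)
  have := h.modSolution_unique h1 h2 (by
    ext i
    simp only [h.modMatrix_zero]
    fin_cases i <;> fin_cases j <;> simp)
  exact congrFun (congrFun this x) i

theorem IsPeriodicPotential.modMatrix_ofReal (h : IsPeriodicPotential q L t) (μ x : ℝ)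
    (i j : Fin 2) : modMatrix q t μ x i j = ((modMatrix q t μ x i j).re : ℂ) := by
  have := h.conj_modMatrix μ x i j
  rw [Complex.conj_ofReal] at this
  exact (Complex.conj_eq_iff_re.1 this).symm

/-- The energy at `x` expressed in the modified frame. -/
theorem energy_U_inv (w : Fin 2 → ℂ) :
    ‖(U⁻¹ *ᵥ w) 0‖ ^ 2 - ‖(U⁻¹ *ᵥ w) 1‖ ^ 2 = (w 0 * conj (w 1)).im := by
  rw [U_inv]
  simp [Matrix.mulVec, dotProduct, Fin.sum_univ_two, Complex.sq_norm, Complex.normSq_apply]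
  ring

theorem IsPeriodicPotential.im_lt (h : IsPeriodicPotential q L t) {z : ℂ}
    {v : ℝ → Fin 2 → ℂ} (hv : IsModZSSolution q t z v) (hv0 : v 0 ≠ 0) (hz : z.im ≠ 0) (x : ℝ) :
    z.im * (v x 0 * conj (v x 1)).im < z.im * (v (x + L) 0 * conj (v (x + L) 1)).im := by
  have := h.energy_lt (isModZSSolution_iff.1 hv) (fun h0 => hv0 (by
    have := congrArg (fun w => U *ᵥ w) (congrFun h0 0)
    simpa only [Matrix.mulVec_mulVec, U_mul_inv, Matrix.one_mulVec, Pi.zero_apply,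
      Matrix.mulVec_zero] using this)) hz x
  simpa only [energy_U_inv] using this

/-- For a Dirichlet solution the energy, Im of w₀ times the conjugate of w₁, vanishes at both ends
of the period, although it is strictly monotone when Im μ ≠ 0. -/
theorem IsPeriodicPotential.im_eq_zero_of_dirichlet (h : IsPeriodicPotential q L t) {μ : ℂ}
    (hμ : μ ∈ dirichletSpectrum q L t) : μ.im = 0 := by
  rw [h.mem_dirichletSpectrum_iff] at hμ
  by_contra hne
  have := h.im_lt (h.modSolution_mulVec μ ![0, 1]) (by simp [h.modMatrix_zero]) hne 0
  simp [h.modMatrix_zero, Matrix.mulVec, dotProduct, Fin.sum_univ_two, hμ] at this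

/-- A unimodular multiplier preserves the energy over a period, against its strict monotonicity off
the real axis. -/
theorem IsPeriodicPotential.im_eq_zero_of_lax (h : IsPeriodicPotential q L t) {z : ℂ}
    (hz : z ∈ laxSpectrum q t) : z.im = 0 := by
  obtain ⟨r, hr, hr1⟩ := h.mem_laxSpectrum_iff.1 hz
  obtain ⟨v, hv, hv0, hvL⟩ := h.exists_bloch_of_root hr
  by_contra hne
  have := h.im_lt hv hv0 hne 0
  rw [hvL] at this
  have e : (r • v 0) 0 * conj ((r • v 0) 1) = v 0 0 * conj (v 0 1) := by
    have : r * conj r = 1 := by rw [Complex.mul_conj, Complex.normSq_eq_norm_sq, hr1]; simp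
    simp only [Pi.smul_apply, smul_eq_mul, map_mul]
    linear_combination (v 0 0 * conj (v 0 1)) * this
  rw [e] at this
  exact lt_irrefl _ this

/-- The energy of a Bloch-Floquet solution has a sign off the real axis. -/
theorem IsPeriodicPotential.bloch_energy_sign (h : IsPeriodicPotential q L t) {z : ℂ}
    (hz : z.im ≠ 0) (s : ℤˣ) {v : ℝ → Fin 2 → ℂ} (hv : IsNormalizedBloch s q L t z v) (x : ℝ) :
    ((s : ℤ) : ℝ) * z.im * (‖(U⁻¹ *ᵥ v x) 0‖ ^ 2 - ‖(U⁻¹ *ᵥ v x) 1‖ ^ 2) < 0 := by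
  have hzl : z ∉ laxSpectrum q t := fun hmem => hz (h.im_eq_zero_of_lax hmem)
  obtain ⟨hr, hcase⟩ := h.multiplier_zpow hzl s
  have hlt := h.im_lt hv.1 (fun h0 => by simpa [h0] using hv.2.2) hz x
  rw [hv.2.1] at hlt
  rw [energy_U_inv]
  set r := multiplier q L t z ^ (s : ℤ)
  have e : (r • v x) 0 * conj ((r • v x) 1) = ((‖r‖ ^ 2 : ℝ) : ℂ) * (v x 0 * conj (v x 1)) := by
    have : r * conj r = ((‖r‖ ^ 2 : ℝ) : ℂ) := by rw [Complex.mul_conj, Complex.normSq_eq_norm_sq]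
    rw [← this]
    simp only [Pi.smul_apply, smul_eq_mul, map_mul]
    ring
  rw [e, Complex.im_ofReal_mul] at hlt
  have hrn := norm_nonneg r
  rcases hcase with ⟨rfl, h1⟩ | ⟨rfl, h1⟩
  · have : ‖r‖ ^ 2 < 1 := by nlinarith
    simp only [Units.val_one, Int.cast_one, one_mul]
    nlinarith
  · have : 1 < ‖r‖ ^ 2 := by nlinarith
    simp only [Units.val_neg, Units.val_one, Int.cast_neg, Int.cast_one]
    nlinarith

/-! ### The Lax operator on solutions and the time evolution of Bloch solutions. -/

theorem IsPeriodicNLSSolution.laxA_eq (hq : IsPeriodicNLSSolution q L T) (ht : t ∈ T) {z : ℂ}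
    {v : ℝ → Fin 2 → ℂ} (hv : IsZSSolution q t z v) (x : ℝ) :
    laxA q t v x =
      ![(-2 * Complex.I * z ^ 2 - Complex.I * (q x t * conj (q x t))) * v x 0
          + (2 * z * q x t + Complex.I * dx q x t) * v x 1,
        (2 * z * conj (q x t) - Complex.I * conj (dx q x t)) * v x 0
          + (2 * Complex.I * z ^ 2 + Complex.I * (q x t * conj (q x t))) * v x 1] := by
  -- The equation eliminates v_x and, differentiated once more, v_xx, so the differential operator
  -- acts on solutions as a matrix.
  have hd1 : deriv v = fun x => ![-(Complex.I * z) * v x 0 + q x t * v x 1,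
      conj (q x t) * v x 0 + Complex.I * z * v x 1] := by
    funext y
    rw [(hv y).deriv, zsMatrix_eq]
    ext i; fin_cases i <;> simp [Matrix.mulVec, dotProduct]
  have hqx := hq.hasDerivAt_x ht x
  obtain ⟨h0, h1⟩ := isZSSolution_iff.1 hv x
  have hd2 : deriv (deriv v) x =
      ![-(Complex.I * z) * (-(Complex.I * z) * v x 0 + q x t * v x 1)
          + (dx q x t * v x 1 + q x t * (conj (q x t) * v x 0 + Complex.I * z * v x 1)),
        (conj (dx q x t) * v x 0 + conj (q x t) * (-(Complex.I * z) * v x 0 + q x t * v x 1))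
          + Complex.I * z * (conj (q x t) * v x 0 + Complex.I * z * v x 1)] := by
    rw [hd1]
    refine HasDerivAt.deriv (hasDerivAt_fin2.2 ⟨?_, ?_⟩)
    · exact (h0.const_mul (-(Complex.I * z))).add (hqx.mul h1)
    · exact (hqx.star.mul h0).add (h1.const_mul (Complex.I * z))
  have hi := Complex.I_sq
  rw [laxA, hd2, congrFun hd1 x]
  ext i
  fin_cases i <;>
    simp [sigma3, Q, Qx, dotProduct, Fin.sum_univ_two, sq]
  · linear_combination (2 * Complex.I * z ^ 2 * v x 0 - 2 * z * q x t * v x 1) * hi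
  · linear_combination (-2 * Complex.I * z ^ 2 * v x 1 - 2 * z * conj (q x t) * v x 0) * hi

theorem IsPeriodicNLSSolution.modLaxA_eq (hq : IsPeriodicNLSSolution q L T) (ht : t ∈ T) {z : ℂ}
    {v : ℝ → Fin 2 → ℂ} (hv : IsModZSSolution q t z v) (x : ℝ) :
    modLaxA q t v x = laxB q t z x *ᵥ v x := by
  have hi := Complex.I_sq
  have hc : ∀ w : ℂ, conj w = (w.re : ℂ) - w.im * Complex.I := fun w => by
    apply Complex.ext <;> simp
  rw [modLaxA, hq.laxA_eq ht (isModZSSolution_iff.1 hv), hc, hc]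
  have e1 := Complex.re_add_im (q x t)
  have e2 := Complex.re_add_im (dx q x t)
  rw [U_inv]
  simp only [U, laxB]
  generalize ((q x t).re : ℂ) = a at *
  generalize ((q x t).im : ℂ) = b at *
  generalize ((dx q x t).re : ℂ) = c at *
  generalize ((dx q x t).im : ℂ) = d at *
  rw [← e1, ← e2]
  ext i
  fin_cases i <;> simp [Matrix.mulVec, dotProduct, Fin.sum_univ_two] <;> grind

/-- The meaning of α: it is the first component of B(0) ψ(0), the amount needed to keep ψ₁(0) = 1 in
time. -/
theorem alpha_eq (s : ℤˣ) (q : ℝ → ℝ → ℂ) (L t : ℝ) (z : ℂ) :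
    alpha s q L t z = laxB q t z 0 0 0 + laxB q t z 0 0 1 * bloch s q L t z 0 1 := by
  have hi := Complex.I_sq
  have hc : ∀ w : ℂ, conj w = (w.re : ℂ) - w.im * Complex.I := fun w => by
    apply Complex.ext <;> simp
  have hn : ((‖q 0 t‖ : ℝ) : ℂ) ^ 2 = (q 0 t).re ^ 2 + (q 0 t).im ^ 2 := by
    rw [← Complex.ofReal_pow, Complex.sq_norm, Complex.normSq_apply]; push_cast; ring
  simp only [alpha, hc, hn, laxB, Matrix.of_apply, Matrix.cons_val', Matrix.cons_val_zero,
    Matrix.cons_val_one, Matrix.cons_val_fin_one]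
  have e1 := Complex.re_add_im (q 0 t)
  have e2 := Complex.re_add_im (dx q 0 t)
  generalize ((q 0 t).re : ℂ) = a at *
  generalize ((q 0 t).im : ℂ) = b at *
  generalize ((dx q 0 t).re : ℂ) = c at *
  generalize ((dx q 0 t).im : ℂ) = d at *
  rw [← e1, ← e2]
  generalize bloch s q L t z 0 1 = m
  grind

theorem laxB_one_one (z : ℂ) (x : ℝ) : laxB q t z x 1 1 = -laxB q t z x 0 0 := by simp [laxB]

/-- The discriminant is a local constant of motion. -/
theorem IsPeriodicNLSSolution.eventually_discriminant_eq (hq : IsPeriodicNLSSolution q L T)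
    (hL : 0 < L) (hT : IsOpen T) (ht : t ∈ T) :
    ∀ᶠ τ in 𝓝 t, ∀ z, discriminant q L τ z = discriminant q L t z := by
  obtain ⟨r, hr, hrT⟩ := Metric.isOpen_iff.1 hT t ht
  filter_upwards [Metric.ball_mem_nhds t hr] with τ hτ z
  have hd : ∀ s ∈ T, HasDerivAt (fun s => 2 * discriminant q L s z) 0 s := by
    intro s hs
    simp only [discriminant_eq]
    convert! (hq.hasDerivAt_modMatrix_time hL hT hs z L 0 0).add
      (hq.hasDerivAt_modMatrix_time hL hT hs z L 1 1) using 1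
    -- Periodicity of B turns the time derivative of the monodromy matrix into the commutator [B(0),
    -- M], whose trace is zero.
    have hp := hq.laxB_periodic hs z 0
    rw [zero_add] at hp
    simp only [timeDeriv, hp, Matrix.sub_apply, Matrix.mul_apply, Fin.sum_univ_two]
    ring
  have := (convex_ball t r).is_const_of_fderivWithin_eq_zero (𝕜 := ℝ)
    (f := fun s => 2 * discriminant q L s z)
    (fun s hs => (hd s (hrT hs)).differentiableAt.differentiableWithinAt)
    (fun s hs => by
      rw [((hd s (hrT hs)).hasFDerivAt.hasFDerivWithinAt).fderivWithin
        (Metric.isOpen_ball.uniqueDiffWithinAt hs)]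
      simp) hτ (Metric.mem_ball_self hr)
  simpa using this

theorem multiplier_congr {τ : ℝ} {z : ℂ} (h : discriminant q L τ z = discriminant q L t z) :
    multiplier q L τ z = multiplier q L t z := by
  simp only [multiplier]
  congr 1
  funext r
  simp only [IsSmallMultiplier, h]

theorem IsPeriodicNLSSolution.eventually_laxSpectrum_eq (hq : IsPeriodicNLSSolution q L T)
    (hL : 0 < L) (hT : IsOpen T) (ht : t ∈ T) :
    ∀ᶠ τ in 𝓝 t, laxSpectrum q τ = laxSpectrum q t := by
  filter_upwards [hq.eventually_discriminant_eq hL hT ht, hT.mem_nhds ht] with τ hτ hτT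
  ext z
  rw [(hq.isPeriodicPotential hL hτT).mem_laxSpectrum_iff,
    (hq.isPeriodicPotential hL ht).mem_laxSpectrum_iff, hτ]

/-- Off the Lax spectrum, `z` is a Dirichlet eigenvalue of sign `s` iff the eigenvector of the
monodromy matrix with eigenvalue `ρ^s` is the second unit vector. -/
theorem IsPeriodicPotential.dirichlet_sign_iff (h : IsPeriodicPotential q L t) {z : ℂ}
    (hz : z ∉ laxSpectrum q t) {s : ℤˣ} :
    (z ∈ dirichletSpectrum q L t ∧ dirichletSign q L t z = (s : ℤ)) ↔
      modMatrix q t z L 0 1 = 0 ∧ modMatrix q t z L 1 1 = multiplier q L t z ^ (s : ℤ) := by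
  obtain ⟨hr, hcase⟩ := h.multiplier_zpow hz s
  have hdet := h.det_modMatrix z L
  have hchar := (char_root_iff h).1 hr
  have hr0 := (root_inv hr).1
  rw [h.mem_dirichletSpectrum_iff]
  refine and_congr_right fun hB => ?_
  rw [dirichletSign]
  rw [hB, zero_mul, sub_zero] at hdet hchar
  set r := multiplier q L t z ^ (s : ℤ) with hrdef
  constructor
  · intro hσ
    -- M is triangular here. If M₀₀ were ρ^s, then M₁₁ = ρ^{-s} would have the opposite sign.
    rcases mul_eq_zero.1 hchar with h1 | h1
    · exfalso
      have hA : modMatrix q t z L 1 1 = r⁻¹ := by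
        rw [sub_eq_zero.1 h1] at hdet
        exact eq_inv_of_mul_eq_one_right hdet
      rw [hA, norm_inv, Real.log_inv] at hσ
      rcases hcase with ⟨rfl, hlt⟩ | ⟨rfl, hlt⟩
      · have : 0 < -Real.log ‖r‖ := neg_pos.2 (Real.log_neg (norm_pos_iff.2 hr0) hlt)
        rw [sign_pos this] at hσ
        exact absurd hσ (by decide)
      · have : -Real.log ‖r‖ < 0 := neg_lt_zero.2 (Real.log_pos hlt)
        rw [sign_neg this] at hσ
        exact absurd hσ (by decide)
    · exact sub_eq_zero.1 h1
  · intro hD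
    rw [hD]
    rcases hcase with ⟨rfl, hlt⟩ | ⟨rfl, hlt⟩
    · rw [sign_neg (Real.log_neg (norm_pos_iff.2 hr0) hlt)]; rfl
    · rw [sign_pos (Real.log_pos hlt)]; rfl

/-- The evolution of the slope of the normalized Bloch-Floquet solution. -/
theorem IsPeriodicNLSSolution.hasDerivAt_slope (hq : IsPeriodicNLSSolution q L T)
    (hL : 0 < L) (hT : IsOpen T) (ht : t ∈ T) {z : ℂ} (hz : z ∉ laxSpectrum q t) {s : ℤˣ}
    (hd : ¬ (z ∈ dirichletSpectrum q L t ∧ dirichletSign q L t z = (s : ℤ))) :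
    HasDerivAt (fun τ => bloch s q L τ z 0 1)
      (laxB q t z 0 1 0 - 2 * laxB q t z 0 0 0 * bloch s q L t z 0 1
        - laxB q t z 0 0 1 * bloch s q L t z 0 1 ^ 2) t ∧
    ∀ᶠ τ in 𝓝 t, ∀ x, bloch s q L τ z x = modMatrix q τ z x *ᵥ ![1, bloch s q L τ z 0 1] := by
  have hpot := hq.isPeriodicPotential hL ht
  obtain ⟨s1, s2⟩ := hpot.isBlochSlope hz hd
  have hB := hq.hasDerivAt_modMatrix_time hL hT ht z L 0 1
  have hD := hq.hasDerivAt_modMatrix_time hL hT ht z L 1 1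
  have hA := hq.hasDerivAt_modMatrix_time hL hT ht z L 0 0
  have hC := hq.hasDerivAt_modMatrix_time hL hT ht z L 1 0
  rw [hpot.dirichlet_sign_iff hz] at hd
  have hp := hq.laxB_periodic ht z 0
  rw [zero_add] at hp
  simp only [timeDeriv, hp, Matrix.sub_apply, Matrix.mul_apply, Fin.sum_univ_two,
    laxB_one_one] at hA hB hC hD
  -- ρ is locally constant in time, so the exceptional case concerns M alone with ρ^s frozen at time
  -- t, and avoiding it is an open condition.
  have hgood : ∀ᶠ τ in 𝓝 t, ¬ (modMatrix q τ z L 0 1 = 0 ∧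
      modMatrix q τ z L 1 1 = multiplier q L t z ^ (s : ℤ)) := by
    simp only [not_and_or] at hd ⊢
    rcases hd with h1 | h1
    · filter_upwards [hB.continuousAt.eventually_ne h1] with τ hτ using Or.inl hτ
    · filter_upwards [hD.continuousAt.eventually_ne h1] with τ hτ using Or.inr hτ
  have hslope : ∀ᶠ τ in 𝓝 t, IsNormalizedBloch s q L τ z (bloch s q L τ z) := by
    filter_upwards [hgood, hq.eventually_discriminant_eq hL hT ht,
      hq.eventually_laxSpectrum_eq hL hT ht, hT.mem_nhds ht] with τ h1 h2 h3 hτT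
    have hτ := hq.isPeriodicPotential hL hτT
    have hzτ : z ∉ laxSpectrum q τ := by rwa [h3]
    refine hτ.isNormalizedBloch hzτ ?_
    rwa [hτ.dirichlet_sign_iff hzτ, multiplier_congr (h2 z)]
  have hslope2 : ∀ᶠ τ in 𝓝 t,
      modMatrix q τ z L 0 0 + modMatrix q τ z L 0 1 * bloch s q L τ z 0 1
        = multiplier q L t z ^ (s : ℤ) ∧
      modMatrix q τ z L 1 0 + modMatrix q τ z L 1 1 * bloch s q L τ z 0 1
        = multiplier q L t z ^ (s : ℤ) * bloch s q L τ z 0 1 := by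
    filter_upwards [hslope, hq.eventually_discriminant_eq hL hT ht, hT.mem_nhds ht]
      with τ h1 h2 hτT
    have := ((hq.isPeriodicPotential hL hτT).slope_of_isNormalizedBloch h1).1
    rwa [IsBlochSlope, multiplier_congr (h2 z)] at this
  refine ⟨?_, ?_⟩
  · generalize bloch s q L t z 0 1 = m at *
    generalize multiplier q L t z ^ (s : ℤ) = r at *
    -- The slope is M₁₀ / (r - M₁₁) from the second row or (r - M₀₀) / M₀₁ from the first, according
    -- to which denominator is nonzero. Either formula persists near t, and the eigenvector relation
    -- at t reduces its derivative to the same Riccati expression.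
    by_cases hB0 : modMatrix q t z L 0 1 = 0
    · have hD0 : r - modMatrix q t z L 1 1 ≠ 0 := fun h0 => hd ⟨hB0, (sub_eq_zero.1 h0).symm⟩
      have heq : (fun τ => bloch s q L τ z 0 1) =ᶠ[𝓝 t]
          fun τ => modMatrix q τ z L 1 0 / (r - modMatrix q τ z L 1 1) := by
        filter_upwards [hslope2, (hD.const_sub r).continuousAt.eventually_ne hD0] with τ h1 h2
        rw [eq_div_iff h2]
        linear_combination -h1.2
      refine HasDerivAt.congr_of_eventuallyEq ?_ heq
      convert! hC.div (hD.const_sub r) hD0 using 1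
      rw [eq_div_iff (pow_ne_zero 2 hD0)]
      have e1 : modMatrix q t z L 1 0 = m * (r - modMatrix q t z L 1 1) := by
        linear_combination s2
      have e2 : modMatrix q t z L 0 0 = r := by linear_combination s1 - m * hB0
      rw [e1, e2, hB0]
      simp
      ring
    · have heq : (fun τ => bloch s q L τ z 0 1) =ᶠ[𝓝 t]
          fun τ => (r - modMatrix q τ z L 0 0) / modMatrix q τ z L 0 1 := by
        filter_upwards [hslope2, hB.continuousAt.eventually_ne hB0] with τ h1 h2
        rw [eq_div_iff h2]
        linear_combination h1.1
      refine HasDerivAt.congr_of_eventuallyEq ?_ heq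
      convert! (hA.const_sub r).div hB hB0 using 1
      rw [eq_div_iff (pow_ne_zero 2 hB0)]
      have e1 : r = modMatrix q t z L 0 0 + modMatrix q t z L 0 1 * m := by
        linear_combination -s1
      have e2 : modMatrix q t z L 1 0
          = (modMatrix q t z L 0 0 + modMatrix q t z L 0 1 * m) * m - modMatrix q t z L 1 1 * m := by
        rw [← e1]; linear_combination s2
      rw [e1, e2]
      simp
      ring
  · filter_upwards [hslope, hT.mem_nhds ht] with τ h1 hτT x
    exact congrFun ((hq.isPeriodicPotential hL hτT).slope_of_isNormalizedBloch h1).2 x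

/-- The evolution equation of the normalized Bloch-Floquet solutions. -/
theorem IsPeriodicNLSSolution.hasDerivAt_bloch (hq : IsPeriodicNLSSolution q L T)
    (hL : 0 < L) (hT : IsOpen T) (ht : t ∈ T) {z : ℂ} (hz : z ∉ laxSpectrum q t) {s : ℤˣ}
    (hd : ¬ (z ∈ dirichletSpectrum q L t ∧ dirichletSign q L t z = (s : ℤ))) (x : ℝ) :
    HasDerivAt (fun τ => bloch s q L τ z x)
      (modLaxA q t (bloch s q L t z) x - alpha s q L t z • bloch s q L t z x) t := by
  have hpot := hq.isPeriodicPotential hL ht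
  obtain ⟨hm, he⟩ := hq.hasDerivAt_slope hL hT ht hz hd
  have hM := fun i j => hq.hasDerivAt_modMatrix_time hL hT ht z x i j
  rw [hq.modLaxA_eq ht (hpot.isNormalizedBloch hz hd).1, alpha_eq]
  refine HasDerivAt.congr_of_eventuallyEq ?_ (he.mono fun τ hτ => hτ x)
  rw [he.self_of_nhds x]
  simp only [mulVec_one_cons]
  rw [hasDerivAt_fin2]
  -- The term -Ỹ B(0) (1, m) of Ỹ_t (1, m) and the term Ỹ (0, m_t) add up to -α Ỹ (1, m), by the
  -- Riccati equation for m.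
  constructor
  · convert! (hM 0 0).add ((hM 0 1).mul hm) using 1
    simp [timeDeriv, Matrix.mul_apply, Fin.sum_univ_two, laxB_one_one]
    ring
  · convert! (hM 1 0).add ((hM 1 1).mul hm) using 1
    simp [timeDeriv, Matrix.mul_apply, Fin.sum_univ_two, laxB_one_one]
    ring

/-! ### Spectral gaps and their Dirichlet eigenvalues. -/

/-- The real entries of the monodromy matrix at real spectral parameter. -/
def realMono (q : ℝ → ℝ → ℂ) (L t : ℝ) (i j : Fin 2) (x : ℝ) : ℝ := (modMatrix q t x L i j).re

/-- The entries of the real Gram matrix `∫₀ᴸ Ỹᵀ Ỹ`. -/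
def realGram (q : ℝ → ℝ → ℂ) (L t : ℝ) (i j : Fin 2) (μ : ℝ) : ℝ :=
  ∫ s in (0 : ℝ)..L, ((modMatrix q t μ s 0 i).re * (modMatrix q t μ s 0 j).re
    + (modMatrix q t μ s 1 i).re * (modMatrix q t μ s 1 j).re)

theorem IsPeriodicPotential.ofReal_realMono (h : IsPeriodicPotential q L t) (i j : Fin 2)
    (x : ℝ) : ((realMono q L t i j x : ℝ) : ℂ) = modMatrix q t x L i j :=
  (h.modMatrix_ofReal x L i j).symm

theorem IsPeriodicPotential.ofReal_realGram (h : IsPeriodicPotential q L t) (i j : Fin 2)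
    (μ : ℝ) : ((realGram q L t i j μ : ℝ) : ℂ) = gram q t μ i j L := by
  rw [realGram, gram, ← intervalIntegral.integral_ofReal]
  congr 1
  funext s
  rw [h.modMatrix_ofReal μ s 0 i, h.modMatrix_ofReal μ s 0 j, h.modMatrix_ofReal μ s 1 i,
    h.modMatrix_ofReal μ s 1 j]
  push_cast
  simp

/-- The quadratic form is the integral over the period of |Ỹ(s) (a, b)|², and Ỹ(s) is invertible. -/
theorem IsPeriodicPotential.realGram_pos (h : IsPeriodicPotential q L t) (μ : ℝ) {a b : ℝ}
    (hab : a ≠ 0 ∨ b ≠ 0) :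
    0 < a ^ 2 * realGram q L t 0 0 μ + 2 * a * b * realGram q L t 0 1 μ
      + b ^ 2 * realGram q L t 1 1 μ := by
  have hc : ∀ i j, Continuous fun s => (modMatrix q t μ s i j).re := fun i j =>
    Complex.continuous_re.comp (h.continuous_modMatrix μ i j)
  have hi : ∀ i j, IntervalIntegrable (fun s => (modMatrix q t μ s 0 i).re
      * (modMatrix q t μ s 0 j).re + (modMatrix q t μ s 1 i).re * (modMatrix q t μ s 1 j).re)
      MeasureTheory.volume 0 L := fun i j =>
    (((hc 0 i).mul (hc 0 j)).add ((hc 1 i).mul (hc 1 j))).intervalIntegrable 0 L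
  simp only [realGram]
  rw [← intervalIntegral.integral_const_mul, ← intervalIntegral.integral_const_mul,
    ← intervalIntegral.integral_const_mul,
    ← intervalIntegral.integral_add ((hi 0 0).const_mul _) ((hi 0 1).const_mul _),
    ← intervalIntegral.integral_add (((hi 0 0).const_mul _).add ((hi 0 1).const_mul _))
      ((hi 1 1).const_mul _)]
  refine intervalIntegral.intervalIntegral_pos_of_pos
    ((((hi 0 0).const_mul _).add ((hi 0 1).const_mul _)).add ((hi 1 1).const_mul _))
    (fun s => ?_) h.pos
  have hdet := h.det_modMatrix μ s
  rw [h.modMatrix_ofReal μ s 0 0, h.modMatrix_ofReal μ s 0 1, h.modMatrix_ofReal μ s 1 0,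
    h.modMatrix_ofReal μ s 1 1] at hdet
  norm_cast at hdet
  set m00 := (modMatrix q t μ s 0 0).re
  set m01 := (modMatrix q t μ s 0 1).re
  set m10 := (modMatrix q t μ s 1 0).re
  set m11 := (modMatrix q t μ s 1 1).re
  have e : a ^ 2 * (m00 * m00 + m10 * m10) + 2 * a * b * (m00 * m01 + m10 * m11)
      + b ^ 2 * (m01 * m01 + m11 * m11) = (a * m00 + b * m01) ^ 2 + (a * m10 + b * m11) ^ 2 := by
    ring
  rw [e]
  by_contra hle
  have h1 : (a * m00 + b * m01) ^ 2 = 0 := by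
    nlinarith [sq_nonneg (a * m00 + b * m01), sq_nonneg (a * m10 + b * m11)]
  have h2 : (a * m10 + b * m11) ^ 2 = 0 := by
    nlinarith [sq_nonneg (a * m00 + b * m01), sq_nonneg (a * m10 + b * m11)]
  rw [sq_eq_zero_iff] at h1 h2
  have ha : a = 0 := by linear_combination m11 * h1 - m01 * h2 - a * hdet
  have hb : b = 0 := by linear_combination m00 * h2 - m10 * h1 - b * hdet
  rcases hab with h | h <;> contradiction

theorem IsPeriodicNLSSolution.hasDerivAt_realMono (hq : IsPeriodicNLSSolution q L T)
    (hL : 0 < L) (hT : IsOpen T) (ht : t ∈ T) (i j : Fin 2) (μ : ℝ) :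
    HasDerivAt (realMono q L t i j) ((specDeriv q t μ L i j).re) μ :=
  (hq.hasDerivAt_modMatrix_spec hL hT ht μ L i j).real_of_complex

theorem IsPeriodicPotential.specDeriv_re (h : IsPeriodicPotential q L t) (μ : ℝ) (i : Fin 2) :
    (specDeriv q t μ L i 0).re = realMono q L t i 0 μ * realGram q L t 0 1 μ
        - realMono q L t i 1 μ * realGram q L t 0 0 μ ∧
      (specDeriv q t μ L i 1).re = realMono q L t i 0 μ * realGram q L t 1 1 μ
        - realMono q L t i 1 μ * realGram q L t 0 1 μ := by
  simp only [specDeriv, Matrix.mul_apply, Fin.sum_univ_two, Matrix.of_apply, Matrix.cons_val',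
    Matrix.cons_val_zero, Matrix.cons_val_one, Matrix.cons_val_fin_one,
    ← h.ofReal_realGram, ← h.ofReal_realMono]
  constructor <;> norm_cast <;> ring

theorem IsPeriodicPotential.realMono_det (h : IsPeriodicPotential q L t) (μ : ℝ) :
    realMono q L t 0 0 μ * realMono q L t 1 1 μ
      - realMono q L t 0 1 μ * realMono q L t 1 0 μ = 1 := by
  have := h.det_modMatrix μ L
  simp only [← h.ofReal_realMono] at this
  exact_mod_cast this

theorem IsPeriodicPotential.ofReal_mem_dirichlet (h : IsPeriodicPotential q L t) (μ : ℝ) :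
    (μ : ℂ) ∈ dirichletSpectrum q L t ↔ realMono q L t 0 1 μ = 0 := by
  rw [h.mem_dirichletSpectrum_iff, ← h.ofReal_realMono]
  norm_cast

/-- The trace d is real. A unimodular root has its conjugate as inverse, so d = 2 Re r; conversely,
for |d| ≤ 2 the number d/2 + i √(1 - d²/4) is a root on the unit circle. -/
theorem IsPeriodicPotential.ofReal_mem_lax (h : IsPeriodicPotential q L t) (x : ℝ) :
    (x : ℂ) ∈ laxSpectrum q t ↔ |realMono q L t 0 0 x + realMono q L t 1 1 x| ≤ 2 := by
  rw [h.mem_laxSpectrum_iff, discriminant_eq, ← h.ofReal_realMono, ← h.ofReal_realMono]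
  set d := realMono q L t 0 0 x + realMono q L t 1 1 x with hd
  have e : ((realMono q L t 0 0 x : ℝ) : ℂ) + realMono q L t 1 1 x = d := by rw [hd]; push_cast; rfl
  rw [e]
  constructor
  · rintro ⟨r, hr, h1⟩
    have hc : r * conj r = 1 := by
      rw [Complex.mul_conj, Complex.normSq_eq_norm_sq, h1]; simp
    have hr0 : r ≠ 0 := by rintro rfl; simp at h1
    have h2 : (d : ℂ) = r + conj r := by
      apply mul_left_cancel₀ hr0
      linear_combination -hr - hc
    have h3 : d = 2 * r.re := by
      rw [Complex.add_conj] at h2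
      exact_mod_cast h2
    rw [h3, abs_mul, abs_two]
    have := Complex.abs_re_le_norm r
    linarith
  · intro h1
    have h2 : 0 ≤ 1 - (d / 2) ^ 2 := by
      have := abs_le.1 h1
      nlinarith
    refine ⟨⟨d / 2, Real.sqrt (1 - (d / 2) ^ 2)⟩, ?_, ?_⟩
    · apply Complex.ext
      · simp [sq]
        have h3 := Real.mul_self_sqrt h2
        rw [sq] at h3
        linear_combination -h3
      · simp [sq]
        ring
    · rw [Complex.norm_def, Complex.normSq_mk, Real.mul_self_sqrt h2]
      simp [sq]

/-- A positive derivative at zeros prevents a downward crossing, so f ≥ 0 to the right of a zero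
(comparison with the constant barrier 0). At a later zero the left difference quotients would then
be nonpositive. -/
theorem le_one_zero_of_deriv_pos {f f' : ℝ → ℝ} {a b : ℝ}
    (hf : ∀ x ∈ Set.Icc a b, HasDerivAt f (f' x) x)
    (hpos : ∀ x ∈ Set.Icc a b, f x = 0 → 0 < f' x) {x y : ℝ} (hx : x ∈ Set.Icc a b)
    (hy : y ∈ Set.Icc a b) (hfx : f x = 0) (hfy : f y = 0) : x = y := by
  wlog hxy : x ≤ y generalizing x y
  · exact (this hy hx hfy hfx (le_of_not_ge hxy)).symm
  rcases hxy.eq_or_lt with h | hlt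
  · exact h
  exfalso
  have hsub : Set.Icc x y ⊆ Set.Icc a b := Set.Icc_subset_Icc hx.1 hy.2
  have hnn : ∀ w ∈ Set.Icc x y, -f w ≤ 0 := fun w hw =>
    image_le_of_deriv_right_lt_deriv_boundary' (f := fun w => -f w) (f' := fun w => -f' w)
      (a := x) (b := y)
      (B := fun _ => 0) (B' := fun _ => 0)
      (fun w hw => (hf w (hsub hw)).continuousAt.continuousWithinAt.neg)
      (fun w hw => (hf w (hsub (Set.Ico_subset_Icc_self hw))).hasDerivWithinAt.neg)
      (by simp [hfx]) continuousOn_const (fun w _ => hasDerivWithinAt_const _ _ _)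
      (fun w hw h0 => by
        have := hpos w (hsub (Set.Ico_subset_Icc_self hw)) (by simpa using h0)
        simpa using this) hw
  have hlim := (hf y hy).tendsto_slope_zero_left
  have h2 : f' y ≤ 0 := by
    refine le_of_tendsto hlim ?_
    have hmem : Set.Ioo (x - y) 0 ∈ 𝓝[<] (0 : ℝ) := Ioo_mem_nhdsLT (by linarith)
    filter_upwards [hmem] with w hw
    have h3 := hnn (y + w) ⟨by linarith [hw.1], by linarith [hw.2]⟩
    rw [hfy, sub_zero, smul_eq_mul]
    exact mul_nonpos_of_nonpos_of_nonneg (inv_nonpos.2 hw.2.le) (by linarith)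
  linarith [hpos y hy hfy]

/-- In a spectral gap, the (doubled) discriminant has a constant sign `ε`. -/
theorem IsPeriodicNLSSolution.gap_sign (hq : IsPeriodicNLSSolution q L T)
    (hL : 0 < L) (hT : IsOpen T) (ht : t ∈ T) {a b : ℝ} (hg : IsSpectralGap q t a b) :
    ∃ ε : ℝ, (ε = 1 ∨ ε = -1) ∧
      (∀ x ∈ Set.Icc a b, 2 ≤ ε * (realMono q L t 0 0 x + realMono q L t 1 1 x)) ∧
      ε * (realMono q L t 0 0 a + realMono q L t 1 1 a) = 2 ∧
      ε * (realMono q L t 0 0 b + realMono q L t 1 1 b) = 2 := by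
  have h := hq.isPeriodicPotential hL ht
  obtain ⟨hab, ha, hb, hgap⟩ := hg
  set d : ℝ → ℝ := fun x => realMono q L t 0 0 x + realMono q L t 1 1 x with hd
  have hdc : Continuous d := continuous_iff_continuousAt.2 fun x =>
    (hq.hasDerivAt_realMono hL hT ht 0 0 x).continuousAt.add
      (hq.hasDerivAt_realMono hL hT ht 1 1 x).continuousAt
  rw [h.ofReal_mem_lax] at ha hb
  have hgap' : ∀ x ∈ Set.Ioo a b, 2 < |d x| := fun x hx => by
    have := hgap x hx
    rwa [h.ofReal_mem_lax, not_le] at this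
  have hsign : (∀ x ∈ Set.Ioo a b, 2 < d x) ∨ (∀ x ∈ Set.Ioo a b, d x < -2) := by
    by_contra hcon
    push Not at hcon
    obtain ⟨⟨x, hx, hdx⟩, ⟨y, hy, hdy⟩⟩ := hcon
    have hx2 : d x < 0 := by
      rcases lt_abs.1 (hgap' x hx) with h1 | h1 <;> linarith
    have hy2 : 0 < d y := by
      rcases lt_abs.1 (hgap' y hy) with h1 | h1 <;> linarith
    obtain ⟨w, hw, hw0⟩ := (isPreconnected_Ioo (a := a) (b := b)).intermediate_value hx hy
      hdc.continuousOn (show (0 : ℝ) ∈ Set.Icc (d x) (d y) from ⟨hx2.le, hy2.le⟩)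
    have := hgap' w hw
    rw [hw0] at this
    simp at this
    linarith
  obtain ⟨ε, hε, hε2⟩ : ∃ ε : ℝ, (ε = 1 ∨ ε = -1) ∧ ∀ x ∈ Set.Ioo a b, 2 ≤ ε * d x := by
    rcases hsign with h1 | h1
    · exact ⟨1, Or.inl rfl, fun x hx => by linarith [h1 x hx]⟩
    · exact ⟨-1, Or.inr rfl, fun x hx => by linarith [h1 x hx]⟩
  have hcl : ∀ x ∈ Set.Icc a b, 2 ≤ ε * d x := by
    have hclosed : IsClosed {x | 2 ≤ ε * d x} :=
      isClosed_le continuous_const (continuous_const.mul hdc)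
    have := closure_minimal (s := Set.Ioo a b) hε2 hclosed
    rwa [closure_Ioo hab.ne] at this
  refine ⟨ε, hε, hcl, le_antisymm ?_ (hcl a ⟨le_rfl, hab.le⟩),
    le_antisymm ?_ (hcl b ⟨hab.le, le_rfl⟩)⟩
  · have := abs_le.1 ha
    rcases hε with rfl | rfl <;> linarith
  · have := abs_le.1 hb
    rcases hε with rfl | rfl <;> linarith

/-- Where `|Δ| ≥ 1`, zeros of the Dirichlet function are simple. -/
theorem IsPeriodicPotential.deriv_dirichlet_pos (h : IsPeriodicPotential q L t) {ε x : ℝ}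
    (hε : ε = 1 ∨ ε = -1) (hx : 2 ≤ ε * (realMono q L t 0 0 x + realMono q L t 1 1 x))
    (h0 : realMono q L t 0 1 x = 0) : 0 < ε * (specDeriv q t x L 0 1).re := by
  rw [(h.specDeriv_re x 0).2, h0, zero_mul, sub_zero, ← mul_assoc]
  have hk := h.realGram_pos x (a := 0) (b := 1) (Or.inr one_ne_zero)
  have hdet := h.realMono_det x
  rw [h0] at hdet
  -- Where M₀₁ = 0, the derivative of M₀₁ is M₀₀ times a positive Gram entry; M₀₀ and M₁₁ have
  -- product 1 and ε times their sum is at least 2, so ε M₀₀ > 0.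
  have hA : 0 < ε * realMono q L t 0 0 x := by
    have he : ε * ε = 1 := by rcases hε with rfl | rfl <;> norm_num
    by_contra hle
    have h3 : (ε * realMono q L t 0 0 x) * (ε * realMono q L t 1 1 x) = 1 := by
      linear_combination (realMono q L t 0 0 x * realMono q L t 1 1 x) * he + hdet
    nlinarith
  refine mul_pos hA (by linarith)

/-- The sign of the derivative of the discriminant at a band edge. -/
theorem IsPeriodicPotential.deriv_discriminant_mul_lt (h : IsPeriodicPotential q L t) {ε x : ℝ}
    (he : ε * ε = 1) (hx : ε * (realMono q L t 0 0 x + realMono q L t 1 1 x) = 2)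
    (hB : realMono q L t 0 1 x ≠ 0) :
    (ε * ((specDeriv q t x L 0 0).re + (specDeriv q t x L 1 1).re))
      * (ε * realMono q L t 0 1 x) < 0 := by
  rw [(h.specDeriv_re x 0).1, (h.specDeriv_re x 1).2]
  -- The vector (B, -(A - D)/2) is the eigenvector of M for the double eigenvalue (A + D)/2 at the
  -- band edge. The Gram form at this vector is minus B times the derivative of the trace, because
  -- BC = -((A - D)/2)² there.
  have hk := h.realGram_pos x (a := realMono q L t 0 1 x)
    (b := -(realMono q L t 0 0 x - realMono q L t 1 1 x) / 2) (Or.inl hB)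
  have hdet := h.realMono_det x
  have hsq : (realMono q L t 0 0 x + realMono q L t 1 1 x) ^ 2 = 4 := by
    have h4 : (ε * (realMono q L t 0 0 x + realMono q L t 1 1 x)) ^ 2 = 4 := by
      rw [hx]; norm_num
    linear_combination h4 - (realMono q L t 0 0 x + realMono q L t 1 1 x) ^ 2 * he
  have hBC : realMono q L t 0 1 x * realMono q L t 1 0 x
      = -((realMono q L t 0 0 x - realMono q L t 1 1 x) / 2) ^ 2 := by
    linear_combination hsq / 4 - hdet
  generalize realMono q L t 0 0 x = A at *
  generalize realMono q L t 0 1 x = B at *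
  generalize realMono q L t 1 0 x = C at *
  generalize realMono q L t 1 1 x = D at *
  have e : ε * ((A * realGram q L t 0 1 x - B * realGram q L t 0 0 x)
      + (C * realGram q L t 1 1 x - D * realGram q L t 0 1 x)) * (ε * B)
      = -(B ^ 2 * realGram q L t 0 0 x + 2 * B * (-(A - D) / 2) * realGram q L t 0 1 x
        + (-(A - D) / 2) ^ 2 * realGram q L t 1 1 x) := by
    linear_combination ((A * realGram q L t 0 1 x - B * realGram q L t 0 0 x)
      + (C * realGram q L t 1 1 x - D * realGram q L t 0 1 x)) * B * he
      + realGram q L t 1 1 x * hBC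
  rw [e]
  linarith

/-- The function 2εΔ is at least 2 on [a, b] and equals 2 at both ends, so its derivative is ≥ 0 at
a and ≤ 0 at b. By `deriv_discriminant_mul_lt`, unless M₀₁ vanishes at an end, ε M₀₁ is negative at
a and positive at b, which gives a zero. Uniqueness holds because ε M₀₁ has positive derivative at
each of its zeros in [a, b]. -/
theorem IsPeriodicNLSSolution.gap_exists_unique (hq : IsPeriodicNLSSolution q L T)
    (hL : 0 < L) (hT : IsOpen T) (ht : t ∈ T) {a b : ℝ} (hg : IsSpectralGap q t a b) :
    ∃! μ : ℝ, μ ∈ Set.Icc a b ∧ (μ : ℂ) ∈ dirichletSpectrum q L t := by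
  have h := hq.isPeriodicPotential hL ht
  obtain ⟨ε, hε, hcl, hda, hdb⟩ := hq.gap_sign hL hT ht hg
  have hab := hg.1
  have he : ε * ε = 1 := by rcases hε with rfl | rfl <;> norm_num
  have hd := fun i j x => hq.hasDerivAt_realMono hL hT ht i j x
  simp only [h.ofReal_mem_dirichlet]
  have hcont : Continuous (realMono q L t 0 1) :=
    continuous_iff_continuousAt.2 fun x => (hd 0 1 x).continuousAt
  have hdd : ∀ x : ℝ, HasDerivAt (fun x => ε * (realMono q L t 0 0 x + realMono q L t 1 1 x))
      (ε * ((specDeriv q t x L 0 0).re + (specDeriv q t x L 1 1).re)) x := fun x =>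
    ((hd 0 0 x).add (hd 1 1 x)).const_mul ε
  have hra : 0 ≤ ε * ((specDeriv q t a L 0 0).re + (specDeriv q t a L 1 1).re) := by
    refine ge_of_tendsto (hdd a).tendsto_slope_zero_right ?_
    have hmem : Set.Ioo 0 (b - a) ∈ 𝓝[>] (0 : ℝ) := Ioo_mem_nhdsGT (by linarith)
    filter_upwards [hmem] with w hw
    have := hcl (a + w) ⟨by linarith [hw.1], by linarith [hw.2]⟩
    rw [hda, smul_eq_mul]
    exact mul_nonneg (inv_nonneg.2 hw.1.le) (by linarith)
  have hrb : ε * ((specDeriv q t b L 0 0).re + (specDeriv q t b L 1 1).re) ≤ 0 := by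
    refine le_of_tendsto (hdd b).tendsto_slope_zero_left ?_
    have hmem : Set.Ioo (a - b) 0 ∈ 𝓝[<] (0 : ℝ) := Ioo_mem_nhdsLT (by linarith)
    filter_upwards [hmem] with w hw
    have := hcl (b + w) ⟨by linarith [hw.1], by linarith [hw.2]⟩
    rw [hdb, smul_eq_mul]
    exact mul_nonpos_of_nonpos_of_nonneg (inv_nonpos.2 hw.2.le) (by linarith)
  obtain ⟨μ, hμ, hμ0⟩ : ∃ μ ∈ Set.Icc a b, realMono q L t 0 1 μ = 0 := by
    by_cases h1 : realMono q L t 0 1 a = 0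
    · exact ⟨a, ⟨le_rfl, hab.le⟩, h1⟩
    by_cases h2 : realMono q L t 0 1 b = 0
    · exact ⟨b, ⟨hab.le, le_rfl⟩, h2⟩
    have h3 := h.deriv_discriminant_mul_lt he hda h1
    have h4 := h.deriv_discriminant_mul_lt he hdb h2
    have h5 : ε * realMono q L t 0 1 a < 0 := by
      by_contra hle
      exact absurd h3 (not_lt.2 (mul_nonneg hra (not_lt.1 hle)))
    have h6 : 0 < ε * realMono q L t 0 1 b := by
      by_contra hle
      exact absurd h4 (not_lt.2 (mul_nonneg_of_nonpos_of_nonpos hrb (not_lt.1 hle)))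
    obtain ⟨μ, hμ, hμ0⟩ := intermediate_value_Icc hab.le
      (f := fun x => ε * realMono q L t 0 1 x) (continuous_const.mul hcont).continuousOn
      (show (0 : ℝ) ∈ _ from ⟨h5.le, h6.le⟩)
    refine ⟨μ, hμ, ?_⟩
    have hε0 : ε ≠ 0 := by rintro rfl; simp at he
    exact (mul_eq_zero.1 hμ0).resolve_left hε0
  refine ⟨μ, ⟨hμ, hμ0⟩, fun ν hν => ?_⟩
  exact le_one_zero_of_deriv_pos (f := fun x => ε * realMono q L t 0 1 x) (a := a) (b := b)
    (fun x _ => (hd 0 1 x).const_mul ε)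
    (fun x hx h0 => h.deriv_dirichlet_pos hε (hcl x hx) (by
      have hε0 : ε ≠ 0 := by rintro rfl; simp at he
      exact (mul_eq_zero.1 h0).resolve_left hε0))
    hν.1 hμ (by simp [hν.2]) (by simp [hμ0])

theorem IsPeriodicNLSSolution.gapDirichlet_spec (hq : IsPeriodicNLSSolution q L T)
    (hL : 0 < L) (hT : IsOpen T) (ht : t ∈ T) {a b : ℝ} (hg : IsSpectralGap q t a b) :
    gapDirichlet q L a b t ∈ Set.Icc a b ∧
      (gapDirichlet q L a b t : ℂ) ∈ dirichletSpectrum q L t :=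
  Classical.epsilon_spec (p := fun μ : ℝ => μ ∈ Set.Icc a b ∧ (μ : ℂ) ∈ dirichletSpectrum q L t)
    (hq.gap_exists_unique hL hT ht hg).exists

theorem IsPeriodicNLSSolution.gapDirichlet_eq (hq : IsPeriodicNLSSolution q L T)
    (hL : 0 < L) (hT : IsOpen T) (ht : t ∈ T) {a b : ℝ} (hg : IsSpectralGap q t a b) {μ : ℝ}
    (hμ : μ ∈ Set.Icc a b) (hμ' : (μ : ℂ) ∈ dirichletSpectrum q L t) :
    gapDirichlet q L a b t = μ :=
  (hq.gap_exists_unique hL hT ht hg).unique (hq.gapDirichlet_spec hL hT ht hg) ⟨hμ, hμ'⟩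

/-- A Dirichlet eigenvalue with nonzero sign lies off the Lax spectrum. -/
theorem IsPeriodicPotential.not_mem_lax_of_sign_ne_zero (h : IsPeriodicPotential q L t) {μ : ℝ}
    (hμ : (μ : ℂ) ∈ dirichletSpectrum q L t) (hσ : dirichletSign q L t μ ≠ 0) :
    (μ : ℂ) ∉ laxSpectrum q t := by
  rw [h.ofReal_mem_lax, not_le]
  have hdet := h.realMono_det μ
  rw [(h.ofReal_mem_dirichlet μ).1 hμ, zero_mul, sub_zero] at hdet
  rw [dirichletSign, ← h.ofReal_realMono, Complex.norm_real, Real.norm_eq_abs] at hσ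
  set A := realMono q L t 0 0 μ
  set D := realMono q L t 1 1 μ
  have hD1 : |D| ≠ 1 := fun h1 => hσ (by rw [h1]; simp)
  by_contra hle
  have h1 := abs_le.1 (not_lt.1 hle)
  -- Since AD = 1, (A - D)² = (A + D)² - 4; in the spectrum this forces A = D = ±1, that is, sign
  -- zero.
  have h2 : (A - D) ^ 2 ≤ 0 := by nlinarith
  have h3 : A = D := by nlinarith
  rw [h3] at hdet
  exact hD1 (by rw [← sq_eq_sq₀ (abs_nonneg D) zero_le_one, sq_abs]; linarith)

/-- The real spectrum is closed; the ends of the gap are its nearest points on either side, which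
exist because it is unbounded in both directions. -/
theorem IsPeriodicNLSSolution.exists_gap (hq : IsPeriodicNLSSolution q L T)
    (hL : 0 < L) (hT : IsOpen T) (ht : t ∈ T)
    (hup : ∀ R : ℝ, ∃ x > R, (x : ℂ) ∈ laxSpectrum q t)
    (hdown : ∀ R : ℝ, ∃ x < R, (x : ℂ) ∈ laxSpectrum q t) {μ : ℝ}
    (hμ : (μ : ℂ) ∉ laxSpectrum q t) : ∃ a b : ℝ, IsSpectralGap q t a b ∧ μ ∈ Set.Icc a b := by
  have h := hq.isPeriodicPotential hL ht
  set K : Set ℝ := {x | (x : ℂ) ∈ laxSpectrum q t} with hK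
  have hKc : IsClosed K := by
    have : K = {x | |realMono q L t 0 0 x + realMono q L t 1 1 x| ≤ 2} := by
      ext x; exact h.ofReal_mem_lax x
    rw [this]
    refine isClosed_le (continuous_iff_continuousAt.2 fun x => ?_) continuous_const
    exact ((hq.hasDerivAt_realMono hL hT ht 0 0 x).continuousAt.add
      (hq.hasDerivAt_realMono hL hT ht 1 1 x).continuousAt).abs
  obtain ⟨x0, hx0, hx0K⟩ := hdown μ
  obtain ⟨x1, hx1, hx1K⟩ := hup μ
  have ha : sSup (K ∩ Set.Iic μ) ∈ K ∩ Set.Iic μ :=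
    (hKc.inter isClosed_Iic).csSup_mem ⟨x0, hx0K, hx0.le⟩ ⟨μ, fun y hy => hy.2⟩
  have hb : sInf (K ∩ Set.Ici μ) ∈ K ∩ Set.Ici μ :=
    (hKc.inter isClosed_Ici).csInf_mem ⟨x1, hx1K, hx1.le⟩ ⟨μ, fun y hy => hy.2⟩
  set a := sSup (K ∩ Set.Iic μ) with hadef
  set b := sInf (K ∩ Set.Ici μ) with hbdef
  have haμ : a < μ := lt_of_le_of_ne ha.2 fun he => hμ (by have := ha.1; rwa [he] at this)
  have hbμ : μ ≤ b := hb.2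
  refine ⟨a, b, ⟨haμ.trans_le hbμ, ha.1, hb.1, fun x hx hxK => ?_⟩, haμ.le, hbμ⟩
  rcases le_total x μ with hle | hle
  · exact absurd (le_csSup ⟨μ, fun y hy => hy.2⟩ ⟨hxK, hle⟩ : x ≤ a) (not_le.2 hx.1)
  · exact absurd (csInf_le ⟨μ, fun y hy => hy.2⟩ ⟨hxK, hle⟩ : b ≤ x) (not_le.2 hx.2)

/-! ### Analyticity and boundary values of the multiplier and of α. -/

/-- Local analytic branches of the roots of `r² - 2 D r + 1 = 0` away from `D² = 1`. -/
theorem exists_analytic_root {D : ℂ → ℂ} {z₀ r₀ : ℂ} (hD : AnalyticAt ℂ D z₀)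
    (hr : r₀ ^ 2 - 2 * D z₀ * r₀ + 1 = 0) (hne : D z₀ ^ 2 ≠ 1) :
    ∃ r : ℂ → ℂ, AnalyticAt ℂ r z₀ ∧ r z₀ = r₀ ∧ ∀ z, r z ^ 2 - 2 * D z * r z + 1 = 0 := by
  set c := r₀ - D z₀ with hc
  have hc2 : c ^ 2 = D z₀ ^ 2 - 1 := by rw [hc]; linear_combination hr
  have hc0 : c ^ 2 ≠ 0 := by rw [hc2]; exact sub_ne_zero.2 hne
  have h1 : (D z₀ ^ 2 - 1) / c ^ 2 = 1 := by rw [← hc2]; exact div_self hc0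
  -- Dividing by c² moves the argument of the square root to 1 at z₀, away from the branch cut, and
  -- the prefactor c selects the branch through r₀.
  refine ⟨fun z => D z + c * ((D z ^ 2 - 1) / c ^ 2) ^ (((2 : ℕ) : ℂ)⁻¹), ?_, ?_, fun z => ?_⟩
  · refine hD.add (analyticAt_const.mul (AnalyticAt.cpow ?_ analyticAt_const ?_))
    · exact ((hD.pow 2).sub analyticAt_const).div analyticAt_const hc0
    · rw [h1]; exact Complex.one_mem_slitPlane
  · change D z₀ + c * ((D z₀ ^ 2 - 1) / c ^ 2) ^ (((2 : ℕ) : ℂ)⁻¹) = r₀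
    rw [h1, Complex.one_cpow, hc]; ring
  · have h2 := Complex.cpow_nat_inv_pow ((D z ^ 2 - 1) / c ^ 2) two_ne_zero
    set w := ((D z ^ 2 - 1) / c ^ 2) ^ (((2 : ℕ) : ℂ)⁻¹)
    have h3 : c ^ 2 * w ^ 2 = D z ^ 2 - 1 := by
      rw [h2, mul_div_cancel₀ _ hc0]
    linear_combination h3

theorem multiplier_eq_of_small {z r : ℂ} (hr : r ^ 2 - 2 * discriminant q L t z * r + 1 = 0)
    (h1 : ‖r‖ < 1) : multiplier q L t z = r := by
  have := Classical.epsilon_spec (p := IsSmallMultiplier q L t z) ⟨r, hr, h1⟩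
  exact small_root_unique this.1 this.2 hr h1

theorem IsPeriodicPotential.not_mem_lax_of_small (h : IsPeriodicPotential q L t) {z r : ℂ}
    (hr : r ^ 2 - 2 * discriminant q L t z * r + 1 = 0) (h1 : ‖r‖ < 1) :
    z ∉ laxSpectrum q t := by
  intro hz
  obtain ⟨w, hw, hw1⟩ := h.mem_laxSpectrum_iff.1 hz
  obtain ⟨h0, hs, -⟩ := root_inv hr
  rw [hs] at hw
  have : (w - r) * (w - r⁻¹) = 0 := by
    field_simp at hw ⊢
    linear_combination hw
  rcases mul_eq_zero.1 this with h2 | h2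
  · rw [sub_eq_zero.1 h2] at hw1; linarith
  · rw [sub_eq_zero.1 h2, norm_inv, inv_eq_one] at hw1; linarith

theorem IsPeriodicNLSSolution.differentiable_modMatrix (hq : IsPeriodicNLSSolution q L T)
    (hL : 0 < L) (hT : IsOpen T) (ht : t ∈ T) (i j : Fin 2) :
    Differentiable ℂ fun z => modMatrix q t z L i j :=
  fun z => (hq.hasDerivAt_modMatrix_spec hL hT ht z L i j).differentiableAt

theorem IsPeriodicNLSSolution.differentiable_discriminant (hq : IsPeriodicNLSSolution q L T)
    (hL : 0 < L) (hT : IsOpen T) (ht : t ∈ T) : Differentiable ℂ (discriminant q L t) := by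
  have h2 : discriminant q L t
      = fun z => (modMatrix q t z L 0 0 + modMatrix q t z L 1 1) / 2 := by
    funext z
    rw [← discriminant_eq (q := q) (L := L) (t := t) z]; ring
  rw [h2]
  exact ((hq.differentiable_modMatrix hL hT ht 0 0).add
    (hq.differentiable_modMatrix hL hT ht 1 1)).div_const 2

theorem discriminant_sq_ne_one {D r : ℂ} (hr : r ^ 2 - 2 * D * r + 1 = 0) (h1 : ‖r‖ < 1) :
    D ^ 2 ≠ 1 := by
  intro hD
  have h2 : (r - D) ^ 2 = 0 := by linear_combination hr + hD
  have h3 : r = D := sub_eq_zero.1 (by simpa using h2)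
  have h4 : ‖D‖ ^ 2 = 1 := by rw [← norm_pow, hD, norm_one]
  rw [h3] at h1
  nlinarith [norm_nonneg D]

/-- The analytic branch through ρ(z) stays of modulus less than 1 nearby. By uniqueness of the small
root it is the multiplier there, and its existence keeps the neighbourhood off the spectrum. -/
theorem IsPeriodicNLSSolution.analyticAt_multiplier (hq : IsPeriodicNLSSolution q L T)
    (hL : 0 < L) (hT : IsOpen T) (ht : t ∈ T) {z : ℂ} (hz : z ∉ laxSpectrum q t) :
    AnalyticAt ℂ (multiplier q L t) z ∧ ∀ᶠ w in 𝓝 z, w ∉ laxSpectrum q t := by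
  have h := hq.isPeriodicPotential hL ht
  obtain ⟨hr, h1⟩ := h.isSmallMultiplier hz
  obtain ⟨r, hra, hr0, hroot⟩ := exists_analytic_root
    ((hq.differentiable_discriminant hL hT ht).analyticAt z) hr (discriminant_sq_ne_one hr h1)
  have hev : ∀ᶠ w in 𝓝 z, ‖r w‖ < 1 :=
    hra.continuousAt.norm.eventually_lt continuousAt_const (by rwa [hr0])
  refine ⟨hra.congr (hev.mono fun w hw => (multiplier_eq_of_small (hroot w) hw).symm), ?_⟩
  exact hev.mono fun w hw => h.not_mem_lax_of_small (hroot w) hw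

theorem IsPeriodicNLSSolution.analyticAt_multiplier_zpow (hq : IsPeriodicNLSSolution q L T)
    (hL : 0 < L) (hT : IsOpen T) (ht : t ∈ T) (s : ℤˣ) {z : ℂ} (hz : z ∉ laxSpectrum q t) :
    AnalyticAt ℂ (fun w => multiplier q L t w ^ (s : ℤ)) z := by
  have h := hq.isPeriodicPotential hL ht
  exact (hq.analyticAt_multiplier hL hT ht hz).1.fun_zpow (n := (s : ℤ))
    (root_inv (h.isSmallMultiplier hz).1).1

theorem analyticAt_laxB (i j : Fin 2) (x : ℝ) (z : ℂ) :
    AnalyticAt ℂ (fun w => laxB q t w x i j) z := by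
  refine Differentiable.analyticAt (f := fun w => laxB q t w x i j) ?_ z
  fin_cases i <;> fin_cases j <;> simp [laxB] <;> fun_prop

/-- The first row of the eigenvector relation, solved for the slope. All singularities of α are
visible here: branch points of ρ and zeros of M₀₁. -/
theorem IsPeriodicPotential.alpha_eq_div (h : IsPeriodicPotential q L t) {z : ℂ}
    (hz : z ∉ laxSpectrum q t) (hB : modMatrix q t z L 0 1 ≠ 0) (s : ℤˣ) :
    alpha s q L t z = laxB q t z 0 0 0 + laxB q t z 0 0 1
      * ((multiplier q L t z ^ (s : ℤ) - modMatrix q t z L 0 0) / modMatrix q t z L 0 1) := by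
  have hd : ¬ (z ∈ dirichletSpectrum q L t ∧ dirichletSign q L t z = (s : ℤ)) := fun hd =>
    hB (h.mem_dirichletSpectrum_iff.1 hd.1)
  rw [alpha_eq]
  congr 2
  rw [eq_div_iff hB]
  linear_combination (h.isBlochSlope hz hd).1

theorem IsPeriodicNLSSolution.continuousAt_alpha (hq : IsPeriodicNLSSolution q L T)
    (hL : 0 < L) (hT : IsOpen T) (ht : t ∈ T) (s : ℤˣ) {z : ℂ} (hz : z ∉ laxSpectrum q t)
    (hB : z ∉ dirichletSpectrum q L t) : ContinuousAt (alpha s q L t) z := by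
  have h := hq.isPeriodicPotential hL ht
  rw [h.mem_dirichletSpectrum_iff] at hB
  have hM := fun i j => (hq.differentiable_modMatrix hL hT ht i j z).continuousAt
  have hev : alpha s q L t =ᶠ[𝓝 z] fun z => laxB q t z 0 0 0 + laxB q t z 0 0 1
      * ((multiplier q L t z ^ (s : ℤ) - modMatrix q t z L 0 0) / modMatrix q t z L 0 1) := by
    filter_upwards [(hq.analyticAt_multiplier hL hT ht hz).2, (hM 0 1).eventually_ne hB]
      with w hw hwB using h.alpha_eq_div hw hwB s
  refine ContinuousAt.congr ?_ hev.symm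
  exact (analyticAt_laxB 0 0 0 z).continuousAt.add ((analyticAt_laxB 0 1 0 z).continuousAt.mul
    (((hq.analyticAt_multiplier_zpow hL hT ht s hz).continuousAt.sub (hM 0 0)).div (hM 0 1) hB))

/-- The open upper or lower half-plane. -/
def openHalfPlane (e : ℤˣ) : Set ℂ := {z | 0 < ((e : ℤ) : ℝ) * z.im}

theorem convex_openHalfPlane (e : ℤˣ) : Convex ℝ (openHalfPlane e) :=
  convex_halfSpace_gt ((((e : ℤ) : ℝ) • Complex.imLm).isLinear) 0

theorem units_sq_real (e : ℤˣ) : ((e : ℤ) : ℝ) * ((e : ℤ) : ℝ) = 1 := by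
  rcases Int.units_eq_one_or e with rfl | rfl <;> simp

theorem im_ne_zero_of_mem {e : ℤˣ} {z : ℂ} (hz : z ∈ openHalfPlane e) : z.im ≠ 0 := by
  rintro h
  simp [openHalfPlane, h] at hz

/-- Vertical approach to a point of the closed half-plane. -/
theorem vertical_mem {e : ℤˣ} {z : ℂ} (hz : z ∈ halfPlane e) {y : ℝ} (hy : 0 < y) :
    z + (((e : ℤ) : ℝ) * y : ℝ) * Complex.I ∈ openHalfPlane e := by
  have h1 : 0 ≤ ((e : ℤ) : ℝ) * z.im := hz
  have h2 := units_sq_real e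
  have h3 : (z + (((e : ℤ) : ℝ) * y : ℝ) * Complex.I).im = z.im + ((e : ℤ) : ℝ) * y := by simp
  change 0 < ((e : ℤ) : ℝ) * (z + (((e : ℤ) : ℝ) * y : ℝ) * Complex.I).im
  rw [h3, mul_add, ← mul_assoc, h2]
  linarith

theorem tendsto_vertical {e : ℤˣ} {z : ℂ} (hz : z ∈ halfPlane e) :
    Filter.Tendsto (fun y : ℝ => z + (((e : ℤ) : ℝ) * y : ℝ) * Complex.I) (𝓝[>] 0)
      (𝓝[openHalfPlane e] z) := by
  refine tendsto_nhdsWithin_iff.2 ⟨?_, ?_⟩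
  · have : Continuous fun y : ℝ => z + (((e : ℤ) : ℝ) * y : ℝ) * Complex.I := by fun_prop
    have h2 := this.tendsto 0
    simp only [mul_zero, Complex.ofReal_zero, zero_mul, add_zero] at h2
    exact h2.mono_left nhdsWithin_le_nhds
  · filter_upwards [self_mem_nhdsWithin] with y hy using vertical_mem hz hy

theorem halfPlane_subset_closure (e : ℤˣ) : halfPlane e ⊆ closure (openHalfPlane e) := fun _ hz =>
  mem_closure_iff_nhdsWithin_neBot.2 ((tendsto_vertical hz).neBot)

theorem IsPeriodicPotential.not_mem_lax_of_openHalfPlane (h : IsPeriodicPotential q L t)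
    {e : ℤˣ} {z : ℂ} (hz : z ∈ openHalfPlane e) : z ∉ laxSpectrum q t := fun hl =>
  im_ne_zero_of_mem hz (h.im_eq_zero_of_lax hl)

/-- The multiplier has boundary values on the real axis. -/
theorem IsPeriodicNLSSolution.exists_tendsto_multiplier (hq : IsPeriodicNLSSolution q L T)
    (hL : 0 < L) (hT : IsOpen T) (ht : t ∈ T) (e : ℤˣ) (z : ℂ) :
    ∃ l : ℂ, l ≠ 0 ∧
      Filter.Tendsto (multiplier q L t) (𝓝[openHalfPlane e] z) (𝓝 l) := by
  have h := hq.isPeriodicPotential hL ht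
  have hDa := (hq.differentiable_discriminant hL hT ht).analyticAt z
  by_cases hD1 : discriminant q L t z ^ 2 = 1
  -- At a branch point no analytic branch is available, but (ρ - Δ)² = Δ² - 1 tends to 0, so ρ tends
  -- to Δ(z).
  · refine ⟨discriminant q L t z, fun h0 => by rw [h0] at hD1; simp at hD1, ?_⟩
    have hD := hDa.continuousAt.tendsto.mono_left (nhdsWithin_le_nhds (s := openHalfPlane e))
    have h1 : Filter.Tendsto (fun w => ‖discriminant q L t w ^ 2 - 1‖)
        (𝓝[openHalfPlane e] z) (𝓝 0) := by
      have := ((hD.pow 2).sub_const 1).norm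
      rwa [hD1, sub_self, norm_zero] at this
    have h2 : Filter.Tendsto (fun w => Real.sqrt ‖discriminant q L t w ^ 2 - 1‖)
        (𝓝[openHalfPlane e] z) (𝓝 0) := by
      have := h1.sqrt
      rwa [Real.sqrt_zero] at this
    have h3 : Filter.Tendsto (fun w => multiplier q L t w - discriminant q L t w)
        (𝓝[openHalfPlane e] z) (𝓝 0) := by
      rw [tendsto_zero_iff_norm_tendsto_zero]
      refine h2.congr' ?_
      filter_upwards [self_mem_nhdsWithin] with w hw
      have hr := (h.isSmallMultiplier (h.not_mem_lax_of_openHalfPlane hw)).1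
      have : discriminant q L t w ^ 2 - 1
          = (multiplier q L t w - discriminant q L t w) ^ 2 := by linear_combination -hr
      rw [this, norm_pow, Real.sqrt_sq (norm_nonneg _)]
    have := h3.add hD
    simpa using this
  · obtain ⟨r₀, hr₀⟩ := exists_root (discriminant q L t z)
    obtain ⟨r, hra, hr0, hroot⟩ := exists_analytic_root hDa hr₀ hD1
    obtain ⟨δ, hδ, hball⟩ := Metric.eventually_nhds_iff_ball.1 hra.eventually_analyticAt
    -- On the half-disc S, which is connected and off the spectrum, |r| never equals 1. So either r
    -- or 1/r is the multiplier throughout S, and both are continuous at z.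
    set S := Metric.ball z δ ∩ openHalfPlane e with hS
    have hSpre : IsPreconnected S := ((convex_ball z δ).inter (convex_openHalfPlane e)).isPreconnected
    have hSmem : S ∈ 𝓝[openHalfPlane e] z :=
      Filter.inter_mem (mem_nhdsWithin_of_mem_nhds (Metric.ball_mem_nhds z hδ)) self_mem_nhdsWithin
    have hrc : ContinuousOn (fun w => ‖r w‖) S := fun w hw =>
      (hball w hw.1).continuousAt.norm.continuousWithinAt
    have hne : ∀ w ∈ S, ‖r w‖ ≠ 1 := fun w hw h1 =>
      h.not_mem_lax_of_openHalfPlane hw.2 (h.mem_laxSpectrum_iff.2 ⟨r w, hroot w, h1⟩)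
    have hrz : r z ≠ 0 := (root_inv (hroot z)).1
    have hrt := hra.continuousAt.tendsto.mono_left (nhdsWithin_le_nhds (s := openHalfPlane e))
    by_cases hlt : ∃ w ∈ S, ‖r w‖ < 1
    · obtain ⟨w, hw, hw1⟩ := hlt
      refine ⟨r z, hrz, hrt.congr' ?_⟩
      filter_upwards [hSmem] with y hy
      refine (multiplier_eq_of_small (hroot y) ?_).symm
      by_contra hy1
      obtain ⟨x, hx, hx1⟩ := hSpre.intermediate_value hw hy hrc ⟨hw1.le, not_lt.1 hy1⟩
      exact hne x hx hx1
    · push Not at hlt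
      refine ⟨(r z)⁻¹, inv_ne_zero hrz, (hrt.inv₀ hrz).congr' ?_⟩
      filter_upwards [hSmem] with y hy
      refine (multiplier_eq_of_small (root_inv (hroot y)).2.2 ?_).symm
      rw [norm_inv]
      exact inv_lt_one_of_one_lt₀ (lt_of_le_of_ne (hlt y hy) (hne y hy).symm)

theorem IsPeriodicNLSSolution.exists_tendsto_alpha (hq : IsPeriodicNLSSolution q L T)
    (hL : 0 < L) (hT : IsOpen T) (ht : t ∈ T) (s e : ℤˣ) {z : ℂ}
    (hB : z ∉ dirichletSpectrum q L t) :
    ∃ l : ℂ, Filter.Tendsto (alpha s q L t) (𝓝[openHalfPlane e] z) (𝓝 l) := by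
  have h := hq.isPeriodicPotential hL ht
  rw [h.mem_dirichletSpectrum_iff] at hB
  obtain ⟨l, hl0, hl⟩ := hq.exists_tendsto_multiplier hL hT ht e z
  have hM := fun i j => (hq.differentiable_modMatrix hL hT ht i j z).continuousAt
  have hM' := fun i j => (hM i j).tendsto.mono_left (nhdsWithin_le_nhds (s := openHalfPlane e))
  have hb := fun j => (analyticAt_laxB (q := q) (t := t) 0 j 0 z).continuousAt.tendsto.mono_left
    (nhdsWithin_le_nhds (s := openHalfPlane e))
  refine ⟨_, ((hb 0).add ((hb 1).mul
    (((hl.zpow₀ (s : ℤ) (Or.inl hl0)).sub (hM' 0 0)).div (hM' 0 1) hB))).congr' ?_⟩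
  filter_upwards [self_mem_nhdsWithin,
    mem_nhdsWithin_of_mem_nhds ((hM 0 1).eventually_ne hB)] with w hw hwB
  exact (h.alpha_eq_div (h.not_mem_lax_of_openHalfPlane hw) hwB s).symm

/-- `α` has a continuous extension to the points of the closed half-plane that are not Dirichlet
eigenvalues. -/
theorem IsPeriodicNLSSolution.exists_extension (hq : IsPeriodicNLSSolution q L T)
    (hL : 0 < L) (hT : IsOpen T) (ht : t ∈ T) (s e : ℤˣ) :
    ∃ β : ℂ → ℂ, Set.EqOn β (alpha s q L t) (halfPlane e \ laxSpectrum q t) ∧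
      ContinuousOn β (halfPlane e \ dirichletSpectrum q L t) := by
  classical
  -- The limit is used only on the spectrum; elsewhere α itself is kept, so the agreement with α
  -- includes Dirichlet eigenvalues off the spectrum, where no limit need exist.
  refine ⟨fun z => if z ∈ laxSpectrum q t then extendFrom (openHalfPlane e) (alpha s q L t) z
    else alpha s q L t z, fun z hz => if_neg hz.2, ?_⟩
  refine ContinuousOn.congr (continuousOn_extendFrom (A := openHalfPlane e) (f := alpha s q L t)
    (fun z hz => halfPlane_subset_closure e hz.1)
    (fun z hz => hq.exists_tendsto_alpha hL hT ht s e hz.2)) fun z hz => ?_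
  by_cases hzl : z ∈ laxSpectrum q t
  · exact if_pos hzl
  · rw [if_neg hzl]
    exact (extendFrom_eq (halfPlane_subset_closure e hz.1)
      ((hq.continuousAt_alpha hL hT ht s hzl hz.2).tendsto.mono_left nhdsWithin_le_nhds)).symm

/-! ### Motion of the Dirichlet eigenvalues and the poles of α. -/

/-- Differentiability at one point of a continuous implicit function. -/
theorem hasDerivAt_of_implicit {F : ℝ × ℝ → ℝ} {g : ℝ → ℝ} {t ft fx : ℝ}
    (hF : HasFDerivAt F ((ContinuousLinearMap.fst ℝ ℝ ℝ).smulRight ft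
      + (ContinuousLinearMap.snd ℝ ℝ ℝ).smulRight fx) (t, g t))
    (hg : ContinuousAt g t) (hfx : fx ≠ 0) (h0 : ∀ᶠ τ in 𝓝 t, F (τ, g τ) = 0) :
    HasDerivAt g (-ft / fx) t := by
  rw [hasDerivAt_iff_isLittleO, Asymptotics.isLittleO_iff]
  intro c hc
  have hfx' : 0 < |fx| := abs_pos.2 hfx
  set K := |ft / fx| with hK
  have hK0 : 0 ≤ K := abs_nonneg _
  -- The error X satisfies X ≤ ε (|h| + X + K |h|). The bound ε ≤ 1/2 absorbs X on the right,
  -- leaving 2ε(1 + K)|h|, which the second bound makes at most c |h|.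
  set ε := min (1 / 2) (c / (2 * (1 + K))) with hε
  have hεpos : 0 < ε := lt_min (by norm_num) (by positivity)
  have ht : Filter.Tendsto (fun τ => (τ, g τ)) (𝓝 t) (𝓝 (t, g t)) :=
    (continuousAt_id.prodMk hg).tendsto
  have h1 := ht.eventually ((Asymptotics.isLittleO_iff.1 (hasFDerivAt_iff_isLittleO.1 hF))
    (c := ε * |fx|) (by positivity))
  filter_upwards [h1, h0] with τ h2 h3
  have h00 : F (t, g t) = 0 := h0.self_of_nhds
  simp only [h3, h00, Prod.mk_sub_mk, add_apply,
    ContinuousLinearMap.smulRight_apply, ContinuousLinearMap.coe_fst',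
    ContinuousLinearMap.coe_snd', smul_eq_mul, sub_zero, zero_sub, norm_neg] at h2
  set h := τ - t with hh
  set u := g τ - g t with hu
  have h4 : |u + h * (ft / fx)| ≤ ε * (|h| + |u|) := by
    have e : h * ft + u * fx = (u + h * (ft / fx)) * fx := by field_simp; ring
    rw [e, Real.norm_eq_abs, abs_mul, Prod.norm_mk] at h2
    have h5 : max ‖h‖ ‖u‖ ≤ |h| + |u| :=
      max_le (by simp) (by simp)
    have h6 : |u + h * (ft / fx)| * |fx| ≤ (ε * (|h| + |u|)) * |fx| := by
      calc _ ≤ ε * |fx| * max ‖h‖ ‖u‖ := h2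
        _ ≤ ε * |fx| * (|h| + |u|) := by gcongr
        _ = _ := by ring
    exact le_of_mul_le_mul_right h6 hfx'
  have h7 : |u| ≤ |u + h * (ft / fx)| + |h| * K := by
    calc |u| = |(u + h * (ft / fx)) - h * (ft / fx)| := by rw [add_sub_cancel_right]
      _ ≤ _ := by rw [hK, ← abs_mul]; exact abs_sub _ _
  have hε2 : ε ≤ 1 / 2 := min_le_left _ _
  have hε3 : ε * (2 * (1 + K)) ≤ c := by
    rw [← le_div_iff₀ (by positivity)]; exact min_le_right _ _
  have h8 : |u + h * (ft / fx)| ≤ c * |h| := by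
    set X := |u + h * (ft / fx)|
    have h9 : X ≤ ε * (|h| + (X + |h| * K)) := h4.trans (by gcongr)
    have hX : 0 ≤ X := abs_nonneg _
    have hh0 := abs_nonneg h
    have h10 : ε * X ≤ 1 / 2 * X := by gcongr
    have h11 : ε * (2 * (1 + K)) * |h| ≤ c * |h| := by gcongr
    nlinarith
  have e2 : g τ - g t - (τ - t) • (-ft / fx) = u + h * (ft / fx) := by
    rw [smul_eq_mul]; ring
  rw [e2]
  exact h8

theorem IsPeriodicNLSSolution.hasFDerivAt_realMono (hq : IsPeriodicNLSSolution q L T)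
    (hL : 0 < L) (hT : IsOpen T) (ht : t ∈ T) (i j : Fin 2) (μ : ℝ) :
    HasFDerivAt (fun p : ℝ × ℝ => realMono q L p.1 i j p.2)
      ((ContinuousLinearMap.fst ℝ ℝ ℝ).smulRight (timeDeriv q t μ L i j).re
        + (ContinuousLinearMap.snd ℝ ℝ ℝ).smulRight (specDeriv q t μ L i j).re) (t, μ) := by
  have h1 := hq.hasFDerivAt_modMatrix hL hT ht (μ : ℂ) L i j
  have h2 : HasFDerivAt (fun p : ℝ × ℝ => (p.1, (p.2 : ℂ)))
      ((ContinuousLinearMap.fst ℝ ℝ ℝ).prod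
        (Complex.ofRealCLM.comp (ContinuousLinearMap.snd ℝ ℝ ℝ))) (t, μ) :=
    ((ContinuousLinearMap.fst ℝ ℝ ℝ).prod
        (Complex.ofRealCLM.comp (ContinuousLinearMap.snd ℝ ℝ ℝ))).hasFDerivAt
  have h3 := (Complex.reCLM.hasFDerivAt.comp _ (h1.comp (t, μ) h2))
  convert! h3 using 1
  refine ContinuousLinearMap.ext fun p => ?_
  simp

theorem IsPeriodicNLSSolution.specDeriv_eq_re (hq : IsPeriodicNLSSolution q L T) (hL : 0 < L)
    (hT : IsOpen T) (ht : t ∈ T) (i j : Fin 2) (μ : ℝ) :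
    (((specDeriv q t μ L i j).re : ℝ) : ℂ) = specDeriv q t μ L i j := by
  have h1 := (hq.hasDerivAt_modMatrix_spec hL hT ht μ L i j).comp_ofReal
  have h2 := (hq.hasDerivAt_realMono hL hT ht i j μ).ofReal_comp
  simp only [(hq.isPeriodicPotential hL ht).ofReal_realMono] at h2
  exact h2.unique h1

theorem IsPeriodicNLSSolution.timeDeriv_eq_re (hq : IsPeriodicNLSSolution q L T) (hL : 0 < L)
    (hT : IsOpen T) (ht : t ∈ T) (i j : Fin 2) (μ : ℝ) :
    (((timeDeriv q t μ L i j).re : ℝ) : ℂ) = timeDeriv q t μ L i j := by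
  have h1 := hq.hasDerivAt_modMatrix_time hL hT ht μ L i j
  have h2 := (hasDerivAt_re_im h1).1
  refine (h2.congr_of_eventuallyEq ?_).unique h1
  filter_upwards [hT.mem_nhds ht] with τ hτ
  exact (hq.isPeriodicPotential hL hτ).modMatrix_ofReal μ L i j

theorem IsPeriodicNLSSolution.eventually_isSpectralGap (hq : IsPeriodicNLSSolution q L T)
    (hL : 0 < L) (hT : IsOpen T) (ht : t ∈ T) {a b : ℝ} (hg : IsSpectralGap q t a b) :
    ∀ᶠ τ in 𝓝 t, IsSpectralGap q τ a b := by
  filter_upwards [hq.eventually_laxSpectrum_eq hL hT ht] with τ hτ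
  simpa only [IsSpectralGap, hτ] using hg

theorem eventually_sign_of_deriv_pos {f : ℝ → ℝ} {f' x : ℝ} (hf : HasDerivAt f f' x)
    (h0 : f x = 0) (hpos : 0 < f') :
    ∀ᶠ w in 𝓝[>] (0 : ℝ), f (x - w) < 0 ∧ 0 < f (x + w) := by
  have h1 := hf.tendsto_slope_zero_right.eventually (lt_mem_nhds hpos)
  have h2 := hf.tendsto_slope_zero_left.eventually (lt_mem_nhds hpos)
  have hneg : Filter.Tendsto (fun w : ℝ => -w) (𝓝[>] 0) (𝓝[<] 0) := by
    simpa using tendsto_neg_nhdsGT (a := (0 : ℝ))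
  filter_upwards [h1, hneg.eventually h2, self_mem_nhdsWithin] with w hw1 hw2 hw
  have hw0 : (0 : ℝ) < w := hw
  rw [h0, sub_zero, smul_eq_mul] at hw1 hw2
  constructor
  · rw [sub_eq_add_neg]
    exact (pos_iff_neg_of_mul_pos_aux hw0 hw2)
  · exact (mul_pos_iff_of_pos_left (inv_pos.2 hw0)).1 hw1
where
  pos_iff_neg_of_mul_pos_aux {w y : ℝ} (hw : 0 < w) (h : 0 < (-w)⁻¹ * y) : y < 0 := by
    by_contra hy
    have h1 : (-w)⁻¹ ≤ 0 := inv_nonpos.2 (by linarith)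
    exact absurd h (not_lt.2 (mul_nonpos_of_nonpos_of_nonneg h1 (not_lt.1 hy)))

/-- The moving Dirichlet eigenvalue is differentiable while it is inside its gap. -/
theorem IsPeriodicNLSSolution.hasDerivAt_gapDirichlet (hq : IsPeriodicNLSSolution q L T)
    (hL : 0 < L) (hT : IsOpen T) (ht : t ∈ T) {a b : ℝ} (hg : IsSpectralGap q t a b)
    (hμ : (gapDirichlet q L a b t : ℂ) ∉ laxSpectrum q t) :
    (specDeriv q t (gapDirichlet q L a b t) L 0 1).re ≠ 0 ∧
    HasDerivAt (gapDirichlet q L a b)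
      (-(timeDeriv q t (gapDirichlet q L a b t) L 0 1).re
        / (specDeriv q t (gapDirichlet q L a b t) L 0 1).re) t := by
  have h := hq.isPeriodicPotential hL ht
  obtain ⟨hmem, hdir⟩ := hq.gapDirichlet_spec hL hT ht hg
  obtain ⟨ε, hε, hcl, -, -⟩ := hq.gap_sign hL hT ht hg
  set μ := gapDirichlet q L a b t with hμdef
  have hB0 := (h.ofReal_mem_dirichlet μ).1 hdir
  have hpos := h.deriv_dirichlet_pos hε (hcl μ hmem) hB0
  have hε0 : ε ≠ 0 := by rcases hε with rfl | rfl <;> norm_num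
  have hne : (specDeriv q t μ L 0 1).re ≠ 0 := fun h0 => by simp [h0] at hpos
  have haμ : a < μ := lt_of_le_of_ne hmem.1 fun he => hμ (by rw [← he]; exact hg.2.1)
  have hbμ : μ < b := lt_of_le_of_ne hmem.2 fun he => hμ (by rw [he]; exact hg.2.2.1)
  have hgapev := hq.eventually_isSpectralGap hL hT ht hg
  refine ⟨hne, ?_⟩
  refine hasDerivAt_of_implicit (F := fun p : ℝ × ℝ => realMono q L p.1 0 1 p.2)
    (hq.hasFDerivAt_realMono hL hT ht 0 1 μ) ?_ hne ?_
  -- The opposite signs of ε M₀₁ at μ - w and μ + w persist for nearby times and enclose a zero. As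
  -- these points lie in the gap, uniqueness identifies the zero with the gap eigenvalue at that
  -- time.
  · rw [Metric.continuousAt_iff']
    intro η hη
    have hs := eventually_sign_of_deriv_pos
      ((hq.hasDerivAt_realMono hL hT ht 0 1 μ).const_mul ε) (by simp [hB0]) hpos
    have hmin : 0 < min η (min (μ - a) (b - μ)) :=
      lt_min hη (lt_min (by linarith) (by linarith))
    obtain ⟨w, ⟨hw1, hw2⟩, hw0, hwmin⟩ := (hs.and (Ioo_mem_nhdsGT hmin)).exists
    have hwη : w < η := hwmin.trans_le (min_le_left _ _)
    have hwa : w < μ - a := hwmin.trans_le ((min_le_right _ _).trans (min_le_left _ _))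
    have hwb : w < b - μ := hwmin.trans_le ((min_le_right _ _).trans (min_le_right _ _))
    have hct : ∀ x : ℝ, ContinuousAt (fun τ => ε * realMono q L τ 0 1 x) t := fun x =>
      continuousAt_const.mul
        (Complex.continuous_re.continuousAt.comp
          (hq.hasDerivAt_modMatrix_time hL hT ht x L 0 1).continuousAt)
    filter_upwards [(hct (μ - w)).eventually_lt continuousAt_const hw1,
      continuousAt_const.eventually_lt (hct (μ + w)) hw2, hgapev, hT.mem_nhds ht]
      with τ h1 h2 hgτ hτ
    have hcont : Continuous (realMono q L τ 0 1) := continuous_iff_continuousAt.2 fun x =>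
      (hq.hasDerivAt_realMono hL hT hτ 0 1 x).continuousAt
    obtain ⟨ν, hν, hν0⟩ := intermediate_value_Icc (by linarith : μ - w ≤ μ + w)
      (f := fun x => ε * realMono q L τ 0 1 x) (continuous_const.mul hcont).continuousOn
      (show (0 : ℝ) ∈ _ from ⟨h1.le, h2.le⟩)
    have hνB : realMono q L τ 0 1 ν = 0 := (mul_eq_zero.1 hν0).resolve_left hε0
    have he := hq.gapDirichlet_eq hL hT hτ hgτ (μ := ν)
      ⟨by linarith [hν.1], by linarith [hν.2]⟩
      (((hq.isPeriodicPotential hL hτ).ofReal_mem_dirichlet ν).2 hνB)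
    rw [he, Real.dist_eq, abs_lt]
    constructor <;> linarith [hν.1, hν.2]
  · filter_upwards [hgapev, hT.mem_nhds ht] with τ hgτ hτ
    exact ((hq.isPeriodicPotential hL hτ).ofReal_mem_dirichlet _).1
      (hq.gapDirichlet_spec hL hT hτ hgτ).2

theorem analyticAt_dslope {f : ℂ → ℂ} {z : ℂ} (hf : AnalyticAt ℂ f z) :
    AnalyticAt ℂ (dslope f z) z := by
  obtain ⟨p, hp⟩ := hf
  exact ⟨_, hp.has_fpower_series_dslope_fslope⟩

/-- The poles of `α` and their residues. -/
theorem IsPeriodicNLSSolution.alpha_pole (hq : IsPeriodicNLSSolution q L T)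
    (hL : 0 < L) (hT : IsOpen T) (ht : t ∈ T) {a b : ℝ} (hg : IsSpectralGap q t a b) {s : ℤˣ}
    (hσ : dirichletSign q L t (gapDirichlet q L a b t) = (s : ℤ)) :
    ∃ μ' : ℝ, HasDerivAt (fun τ => gapDirichlet q L a b τ) μ' t ∧
      (∃ g : ℂ → ℂ, AnalyticAt ℂ g (gapDirichlet q L a b t) ∧
        ∀ᶠ z in 𝓝[≠] (gapDirichlet q L a b t : ℂ), alpha s q L t z =
          -(μ' : ℂ) / (z - (gapDirichlet q L a b t : ℂ)) + g z) ∧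
      (μ' ≠ 0 → meromorphicOrderAt (alpha s q L t) (gapDirichlet q L a b t : ℂ) = -1) := by
  have h := hq.isPeriodicPotential hL ht
  obtain ⟨hmem, hdir⟩ := hq.gapDirichlet_spec hL hT ht hg
  have hμl : (gapDirichlet q L a b t : ℂ) ∉ laxSpectrum q t :=
    h.not_mem_lax_of_sign_ne_zero hdir (by
      rw [hσ]; rcases Int.units_eq_one_or s with rfl | rfl <;> simp)
  obtain ⟨hne, hder⟩ := hq.hasDerivAt_gapDirichlet hL hT ht hg hμl
  set μ := gapDirichlet q L a b t with hμdef
  obtain ⟨hB0, hDr⟩ := (h.dirichlet_sign_iff hμl).1 ⟨hdir, hσ⟩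
  set μ' := -(timeDeriv q t μ L 0 1).re / (specDeriv q t μ L 0 1).re with hμ'
  have hM := fun i j => (hq.differentiable_modMatrix hL hT ht i j).analyticAt (μ : ℂ)
  have hBd := hq.hasDerivAt_modMatrix_spec hL hT ht μ L 0 1
  -- M₀₁(z) = (z - μ) B1(z) with B1 analytic and nonzero at μ, the zero being simple.
  set B1 := dslope (fun z => modMatrix q t z L 0 1) (μ : ℂ) with hB1
  have hB1a : AnalyticAt ℂ B1 μ := analyticAt_dslope (hM 0 1)
  have hB1v : B1 μ = ((specDeriv q t μ L 0 1).re : ℂ) := by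
    rw [hB1, dslope_same, hBd.deriv, hq.specDeriv_eq_re hL hT ht]
  have hB1ne : B1 μ ≠ 0 := by rw [hB1v]; exact_mod_cast hne
  set N : ℂ → ℂ := fun z => laxB q t z 0 0 1
    * (multiplier q L t z ^ (s : ℤ) - modMatrix q t z L 0 0) / B1 z with hN
  have hNa : AnalyticAt ℂ N μ :=
    ((analyticAt_laxB 0 1 0 _).mul
      ((hq.analyticAt_multiplier_zpow hL hT ht s hμl).sub (hM 0 0))).div hB1a hB1ne
  have hNv : N μ = -(μ' : ℂ) := by
    -- With M₀₁ = 0 the commutator [B(0), M] has upper right entry B₀₁(0) (M₁₁ - M₀₀), and M₁₁ = ρ^s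
    -- since the sign is s. Hence N(μ) = ∂_t M₀₁ / ∂_z M₀₁ = -μ_t.
    have hp := hq.laxB_periodic ht μ 0
    rw [zero_add] at hp
    have e1 : timeDeriv q t μ L 0 1
        = laxB q t μ 0 0 1 * (modMatrix q t μ L 1 1 - modMatrix q t μ L 0 0) := by
      simp only [timeDeriv, hp, Matrix.sub_apply, Matrix.mul_apply, Fin.sum_univ_two, hB0]
      ring
    rw [hN, hμ']
    push_cast
    rw [hq.timeDeriv_eq_re hL hT ht, e1, hDr, hB1v]
    ring
  have hgood : ∀ᶠ z in 𝓝[≠] (μ : ℂ), alpha s q L t z =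
      -(μ' : ℂ) / (z - (μ : ℂ)) + (laxB q t z 0 0 0 + dslope N (μ : ℂ) z) := by
    filter_upwards [self_mem_nhdsWithin,
      mem_nhdsWithin_of_mem_nhds (hq.analyticAt_multiplier hL hT ht hμl).2,
      mem_nhdsWithin_of_mem_nhds (hB1a.continuousAt.eventually_ne hB1ne)] with z hz hzl hzB
    have hz' : z - μ ≠ 0 := sub_ne_zero.2 hz
    have hBz : modMatrix q t z L 0 1 = (z - μ) * B1 z := by
      have := sub_smul_dslope (fun z => modMatrix q t z L 0 1) (μ : ℂ) z
      simp only [hB0, sub_zero, smul_eq_mul] at this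
      exact this.symm
    have hBne : modMatrix q t z L 0 1 ≠ 0 := by rw [hBz]; exact mul_ne_zero hz' hzB
    have hNz : N z = -(μ' : ℂ) + (z - μ) * dslope N (μ : ℂ) z := by
      have := sub_smul_dslope N (μ : ℂ) z
      rw [hNv, smul_eq_mul] at this
      linear_combination -this
    rw [h.alpha_eq_div hzl hBne s, hBz]
    have e2 : laxB q t z 0 0 1 * ((multiplier q L t z ^ (s : ℤ) - modMatrix q t z L 0 0)
        / ((z - μ) * B1 z)) = N z / (z - μ) := by
      rw [hN]; field_simp
    rw [e2, hNz]
    field_simp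
    ring
  have hga : AnalyticAt ℂ (fun z => laxB q t z 0 0 0 + dslope N (μ : ℂ) z) μ :=
    (analyticAt_laxB 0 0 0 _).add (analyticAt_dslope hNa)
  refine ⟨μ', hder, ⟨_, hga, hgood⟩, fun hμ'0 => ?_⟩
  have hG : AnalyticAt ℂ (fun z => -(μ' : ℂ)
      + (z - μ) * (laxB q t z 0 0 0 + dslope N (μ : ℂ) z)) μ :=
    analyticAt_const.add ((analyticAt_id.sub analyticAt_const).mul hga)
  have hform : ∀ᶠ z in 𝓝[≠] (μ : ℂ), alpha s q L t z = (z - (μ : ℂ)) ^ (-1 : ℤ)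
      • (-(μ' : ℂ) + (z - μ) * (laxB q t z 0 0 0 + dslope N (μ : ℂ) z)) := by
    filter_upwards [hgood, self_mem_nhdsWithin] with z hz hzne
    have hz' : z - μ ≠ 0 := sub_ne_zero.2 hzne
    rw [hz, zpow_neg_one, smul_eq_mul]
    field_simp
  have hmero : MeromorphicAt (alpha s q L t) μ := by
    refine MeromorphicAt.congr (f := fun z => (z - (μ : ℂ)) ^ (-1 : ℤ)
      • (-(μ' : ℂ) + (z - μ) * (laxB q t z 0 0 0 + dslope N (μ : ℂ) z))) ?_
      (hform.mono fun z hz => hz.symm)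
    exact (((analyticAt_id.sub analyticAt_const).meromorphicAt).zpow (-1)).smul hG.meromorphicAt
  have := (meromorphicOrderAt_eq_int_iff (n := -1) hmero).2
    ⟨_, hG, by simpa using hμ'0, hform⟩
  exact_mod_cast this

/-! ### Approximate Riccati solutions and estimates for Bloch solutions at large spectral parameter.
-/

/-- The Zakharov-Shabat system with potential `u` and spectral parameter `ζ`, written out for the
two components `p`, `w`. -/
structure IsZSPair (u : ℝ → ℂ) (ζ : ℂ) (p w : ℝ → ℂ) : Prop where
  fst : ∀ x, HasDerivAt p (-(Complex.I * ζ) * p x + u x * w x) x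
  snd : ∀ x, HasDerivAt w (conj (u x) * p x + Complex.I * ζ * w x) x

namespace IsZSPair

variable {u p w : ℝ → ℂ} {ζ : ℂ} {C : ℝ}

/-- This symmetry transfers each estimate for the first component to the second. -/
theorem swap (h : IsZSPair u ζ p w) : IsZSPair (fun x => conj (u x)) (-ζ) w p where
  fst x := by convert! h.snd x using 1; ring
  snd x := by convert! h.fst x using 1; simp; ring

/-- The real part of ζ drops out of the derivative of |p|² + |w|², which is at most 2(|Im ζ| + C)
times the quantity itself. So the ζ-dependence of the growth is that of the free exponentials. -/
theorem norm_sq_le (h : IsZSPair u ζ p w) (hC : ∀ x, ‖u x‖ ≤ C) {x : ℝ} (hx : 0 ≤ x) :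
    ‖p x‖ ^ 2 + ‖w x‖ ^ 2
      ≤ Real.exp (2 * (|ζ.im| + C) * x) * (‖p 0‖ ^ 2 + ‖w 0‖ ^ 2) := by
  have hE : ∀ y, HasDerivAt (fun y => (‖p y‖ ^ 2 + ‖w y‖ ^ 2) * Real.exp (-(2 * (|ζ.im| + C)) * y))
      ((2 * ζ.im * (‖p y‖ ^ 2 - ‖w y‖ ^ 2) + 4 * (u y * w y * conj (p y)).re
        - 2 * (|ζ.im| + C) * (‖p y‖ ^ 2 + ‖w y‖ ^ 2))
          * Real.exp (-(2 * (|ζ.im| + C)) * y)) y := by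
    intro y
    have h1 := (hasDerivAt_norm_sq (h.fst y)).add (hasDerivAt_norm_sq (h.snd y))
    have h2 : HasDerivAt (fun y => Real.exp (-(2 * (|ζ.im| + C)) * y)) _ y :=
      ((hasDerivAt_id y).const_mul (-(2 * (|ζ.im| + C)))).exp
    convert! h1.mul h2 using 1
    simp only [Complex.sq_norm, Complex.normSq_apply, Complex.mul_re, Complex.add_re,
      Complex.add_im, Complex.mul_im, Complex.neg_re, Complex.neg_im, Complex.I_re, Complex.I_im,
      Complex.conj_re, Complex.conj_im, Pi.add_apply, id]
    ring
  have hanti := antitone_of_hasDerivAt_nonpos hE (fun y => by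
    refine mul_nonpos_of_nonpos_of_nonneg ?_ (Real.exp_pos _).le
    have a1 : (u y * w y * conj (p y)).re ≤ C * ‖w y‖ * ‖p y‖ := by
      refine (Complex.re_le_norm _).trans ?_
      rw [norm_mul, norm_mul, RCLike.norm_conj]
      gcongr
      exact hC y
    have a2 : ζ.im * (‖p y‖ ^ 2 - ‖w y‖ ^ 2) ≤ |ζ.im| * (‖p y‖ ^ 2 + ‖w y‖ ^ 2) := by
      refine (le_abs_self _).trans ?_
      rw [abs_mul]
      gcongr
      rw [abs_le]
      constructor <;> nlinarith [sq_nonneg ‖p y‖, sq_nonneg ‖w y‖]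
    have hC0 : 0 ≤ C := (norm_nonneg _).trans (hC 0)
    nlinarith [mul_nonneg hC0 (sq_nonneg (‖p y‖ - ‖w y‖))])
  have := hanti hx
  simp only [mul_zero, Real.exp_zero, mul_one] at this
  rw [neg_mul, Real.exp_neg, ← div_eq_mul_inv, div_le_iff₀ (Real.exp_pos _)] at this
  linarith

theorem norm_snd_le (h : IsZSPair u ζ p w) (hC : ∀ x, ‖u x‖ ≤ C) {x : ℝ} (hx : 0 ≤ x) :
    ‖w x‖ ≤ Real.exp ((|ζ.im| + C) * x) * (‖p 0‖ + ‖w 0‖) := by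
  have h1 := h.norm_sq_le hC hx
  rw [show 2 * (|ζ.im| + C) * x = (|ζ.im| + C) * x + (|ζ.im| + C) * x by ring, Real.exp_add] at h1
  rw [← sq_le_sq₀ (norm_nonneg _) (by positivity), mul_pow]
  have h2 : ‖p 0‖ ^ 2 + ‖w 0‖ ^ 2 ≤ (‖p 0‖ + ‖w 0‖) ^ 2 := by
    nlinarith [norm_nonneg (p 0), norm_nonneg (w 0)]
  have h3 := mul_le_mul_of_nonneg_left h2 (sq_nonneg (Real.exp ((|ζ.im| + C) * x)))
  nlinarith [sq_nonneg ‖p x‖]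

/-- If `N` nearly solves the Riccati equation for `p / w`, then `p - N w` nearly propagates by
a scalar factor close to `exp (-i ζ L)`. -/
theorem exists_transport (h : IsZSPair u ζ p w) (hu : Continuous u) (hC : ∀ x, ‖u x‖ ≤ C)
    {N r : ℝ → ℂ} {L B η : ℝ} (hL : 0 < L)
    (hN : ∀ x, HasDerivAt N (u x - 2 * Complex.I * ζ * N x - conj (u x) * N x ^ 2 + r x) x)
    (hB : ∀ x, ‖N x‖ ≤ B) (hCB : C * B * L ≤ 1) (hr : ∀ x, ‖r x‖ ≤ η) :
    ∃ κ : ℂ, ‖κ - 1‖ ≤ 2 * (C * B * L) ∧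
      ‖(p L - N L * w L) - κ * Complex.exp (-(Complex.I * ζ) * L) * (p 0 - N 0 * w 0)‖
        ≤ Real.exp (2 + C * L) * L * η * Real.exp (|ζ.im| * L) * (‖p 0‖ + ‖w 0‖) := by
  have hC0 : 0 ≤ C := (norm_nonneg _).trans (hC 0)
  have hB0 : 0 ≤ B := (norm_nonneg _).trans (hB 0)
  have hη0 : 0 ≤ η := (norm_nonneg _).trans (hr 0)
  have hNc : Continuous N := continuous_iff_continuousAt.2 fun x => (hN x).continuousAt
  have hfc : Continuous fun x => conj (u x) * N x :=
    (Complex.continuous_conj.comp hu).mul hNc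
  -- The Riccati equation for N gives (p - N w)' = -(iζ + u* N)(p - N w) - r w, so A is the
  -- correction to the free exponent.
  set A : ℝ → ℂ := fun x => ∫ y in (0 : ℝ)..x, conj (u y) * N y with hA
  have hAd : ∀ x, HasDerivAt A (conj (u x) * N x) x := fun x =>
    intervalIntegral.integral_hasDerivAt_right (hfc.intervalIntegrable _ _)
      hfc.aestronglyMeasurable.stronglyMeasurableAtFilter hfc.continuousAt
  have hAb : ∀ x ∈ Set.Icc 0 L, ‖A x‖ ≤ 1 := fun x hx => by
    have := intervalIntegral.norm_integral_le_of_norm_le_const (a := 0) (b := x) (C := C * B)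
      (f := fun y => conj (u y) * N y) (fun y _ => by
        rw [norm_mul, RCLike.norm_conj]
        exact mul_le_mul (hC y) (hB y) (norm_nonneg _) hC0)
    refine this.trans (le_trans ?_ hCB)
    rw [sub_zero, abs_of_nonneg hx.1]
    exact mul_le_mul_of_nonneg_left hx.2 (by positivity)
  have hAL : ‖A L‖ ≤ C * B * L := by
    have := intervalIntegral.norm_integral_le_of_norm_le_const (a := 0) (b := L) (C := C * B)
      (f := fun y => conj (u y) * N y) (fun y _ => by
        rw [norm_mul, RCLike.norm_conj]
        exact mul_le_mul (hC y) (hB y) (norm_nonneg _) hC0)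
    rwa [sub_zero, abs_of_pos hL] at this
  refine ⟨Complex.exp (-A L), ?_, ?_⟩
  · refine (Complex.norm_exp_sub_one_le ?_).trans ?_
    · rw [norm_neg]; exact hAL.trans hCB
    · rw [norm_neg]; linarith
  -- The integrating factor is normalized to be 1 at x = L; then f(L) - f(0) is the quantity to
  -- estimate.
  set f : ℝ → ℂ := fun x =>
    Complex.exp (Complex.I * ζ * (x - L) + (A x - A L)) * (p x - N x * w x) with hf
  have hfd : ∀ x, HasDerivAt f
      (-(Complex.exp (Complex.I * ζ * (x - L) + (A x - A L)) * (r x * w x))) x := fun x => by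
    have h1 : HasDerivAt (fun x : ℝ => Complex.I * ζ * ((x : ℂ) - L) + (A x - A L))
        (Complex.I * ζ * 1 + conj (u x) * N x) x :=
      ((((hasDerivAt_id x).ofReal_comp).sub_const (L : ℂ)).const_mul _).add
        ((hAd x).sub_const _)
    have h2 := (h.fst x).sub ((hN x).mul (h.snd x))
    convert! h1.cexp.mul h2 using 1
    simp only [Pi.sub_apply, Pi.mul_apply]
    ring
  have key := norm_image_sub_le_of_norm_deriv_le_segment' (f := f) (a := 0) (b := L)
    (C := Real.exp (2 + C * L) * η * Real.exp (|ζ.im| * L) * (‖p 0‖ + ‖w 0‖))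
    (fun x _ => (hfd x).hasDerivWithinAt) (fun x hx => by
      rw [norm_neg, norm_mul, norm_mul, Complex.norm_exp]
      have e1 : (Complex.I * ζ * ((x : ℂ) - L) + (A x - A L)).re ≤ |ζ.im| * (L - x) + 2 := by
        have a1 : (Complex.I * ζ * ((x : ℂ) - L)).re = ζ.im * (L - x) := by
          simp
          ring
        have a2 : (A x - A L).re ≤ 2 := by
          refine (Complex.re_le_norm _).trans ((norm_sub_le _ _).trans ?_)
          linarith [hAb x ⟨hx.1, hx.2.le⟩, hAb L ⟨hL.le, le_rfl⟩]
        rw [Complex.add_re, a1]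
        have := mul_le_mul_of_nonneg_right (le_abs_self ζ.im) (sub_nonneg.2 hx.2.le)
        linarith
      have e2 := h.norm_snd_le hC hx.1
      -- The factor contributes exp(|Im ζ|(L - x)) and w contributes exp(|Im ζ| x); the product is
      -- independent of x.
      calc _ ≤ Real.exp (|ζ.im| * (L - x) + 2)
            * (η * (Real.exp ((|ζ.im| + C) * x) * (‖p 0‖ + ‖w 0‖))) := by
            gcongr
            exact hr x
        _ = Real.exp (2 + C * x) * η * Real.exp (|ζ.im| * L) * (‖p 0‖ + ‖w 0‖) := by
            have : Real.exp (|ζ.im| * (L - x) + 2) * Real.exp ((|ζ.im| + C) * x)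
                = Real.exp (2 + C * x) * Real.exp (|ζ.im| * L) := by
              rw [← Real.exp_add, ← Real.exp_add]; congr 1; ring
            linear_combination (η * (‖p 0‖ + ‖w 0‖)) * this
        _ ≤ _ := by
            gcongr
            exact hx.2.le) L ⟨hL.le, le_rfl⟩
  have e0 : f 0 = Complex.exp (-A L) * Complex.exp (-(Complex.I * ζ) * L)
      * (p 0 - N 0 * w 0) := by
    have : A 0 = 0 := by simp [hA]
    simp only [hf, this]
    rw [← Complex.exp_add]
    congr 2
    push_cast; ring
  have eL : f L = p L - N L * w L := by simp [hf]
  rw [e0, eL, sub_zero] at key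
  refine key.trans (le_of_eq ?_)
  ring

end IsZSPair

/-- `N` solves the Riccati equation `N' = u - 2 i ζ N - u* N²` up to `O(ζ⁻ᵏ)`. -/
def IsApproxSlope (u : ℝ → ℂ) (L : ℝ) (k : ℕ) (N : ℂ → ℝ → ℂ) : Prop :=
  (∀ ζ x, N ζ (x + L) = N ζ x) ∧ ∃ D : ℝ, 0 ≤ D ∧ ∀ ζ : ℂ, 1 ≤ ‖ζ‖ → ∃ r : ℝ → ℂ, ∀ x,
    ‖N ζ x‖ ≤ D / ‖ζ‖ ∧ ‖r x‖ ≤ D / ‖ζ‖ ^ k ∧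
    HasDerivAt (N ζ) (u x - 2 * Complex.I * ζ * N ζ x - conj (u x) * N ζ x ^ 2 + r x) x

/-- The first two terms of the asymptotic solution of the Riccati equation. -/
def slopeTwo (u u₁ : ℝ → ℂ) (ζ : ℂ) (x : ℝ) : ℂ :=
  -(Complex.I * u x) / (2 * ζ) + u₁ x / (4 * ζ ^ 2)

/-- The first three terms of the asymptotic solution of the Riccati equation. -/
def slopeThree (u u₁ u₂ : ℝ → ℂ) (ζ : ℂ) (x : ℝ) : ℂ :=
  slopeTwo u u₁ ζ x + Complex.I * (u₂ x - conj (u x) * u x ^ 2) / (8 * ζ ^ 3)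

section

variable {u u₁ u₂ u₃ : ℝ → ℂ} {L C : ℝ}

theorem norm_slopeTwo_le (hC : ∀ x, ‖u x‖ ≤ C ∧ ‖u₁ x‖ ≤ C) {ζ : ℂ} (hζ : 1 ≤ ‖ζ‖) (x : ℝ) :
    ‖slopeTwo u u₁ ζ x‖ ≤ C / ‖ζ‖ := by
  have hz : 0 < ‖ζ‖ := by linarith
  have hC0 : 0 ≤ C := (norm_nonneg _).trans (hC 0).1
  have h1 : ‖-(Complex.I * u x) / (2 * ζ)‖ ≤ C / (2 * ‖ζ‖) := by
    rw [norm_div, norm_neg, norm_mul, norm_mul, Complex.norm_I, one_mul, Complex.norm_ofNat]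
    gcongr
    exact (hC x).1
  have h2 : ‖u₁ x / (4 * ζ ^ 2)‖ ≤ C / (4 * ‖ζ‖) := by
    rw [norm_div, norm_mul, norm_pow, Complex.norm_ofNat]
    gcongr
    · exact (hC x).2
    · nlinarith
  refine (norm_add_le _ _).trans ((add_le_add h1 h2).trans ?_)
  rw [div_add_div _ _ (by positivity) (by positivity), div_le_div_iff₀ (by positivity) hz]
  nlinarith [mul_nonneg hC0 (mul_pos hz hz).le]

/-- The coefficients are chosen so that 2iζN cancels u at order ζ⁰ and N' at order ζ⁻¹. What remains
is u₂/(4ζ²) + u* N², so two derivatives suffice. -/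
theorem isApproxSlope_slopeTwo (hu : ∀ x, HasDerivAt u (u₁ x) x)
    (hu₁ : ∀ x, HasDerivAt u₁ (u₂ x) x) (hp : ∀ x, u (x + L) = u x ∧ u₁ (x + L) = u₁ x)
    (hC : ∀ x, ‖u x‖ ≤ C ∧ ‖u₁ x‖ ≤ C) (hC₂ : ∀ x, ‖u₂ x‖ ≤ C) :
    IsApproxSlope u L 2 (slopeTwo u u₁) := by
  have hC0 : 0 ≤ C := (norm_nonneg _).trans (hC 0).1
  refine ⟨fun ζ x => by simp only [slopeTwo, hp x], C + C ^ 3, by positivity, fun ζ hζ => ?_⟩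
  have hz : 0 < ‖ζ‖ := by linarith
  have hz0 : ζ ≠ 0 := norm_pos_iff.1 hz
  refine ⟨fun x => u₂ x / (4 * ζ ^ 2) + conj (u x) * slopeTwo u u₁ ζ x ^ 2, fun x => ⟨?_, ?_, ?_⟩⟩
  · refine (norm_slopeTwo_le hC hζ x).trans ?_
    gcongr
    have : 0 ≤ C ^ 3 := by positivity
    linarith
  · have h1 : ‖u₂ x / (4 * ζ ^ 2)‖ ≤ C / ‖ζ‖ ^ 2 := by
      rw [norm_div, norm_mul, norm_pow, Complex.norm_ofNat]
      gcongr
      · exact hC₂ x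
      · nlinarith
    have h2 : ‖conj (u x) * slopeTwo u u₁ ζ x ^ 2‖ ≤ C ^ 3 / ‖ζ‖ ^ 2 := by
      rw [norm_mul, RCLike.norm_conj, norm_pow]
      calc _ ≤ C * (C / ‖ζ‖) ^ 2 := by
            gcongr
            · exact (hC x).1
            · exact norm_slopeTwo_le hC hζ x
        _ = _ := by rw [div_pow]; ring
    refine (norm_add_le _ _).trans ((add_le_add h1 h2).trans (le_of_eq ?_))
    ring
  · have h1 : HasDerivAt (slopeTwo u u₁ ζ)
        (-(Complex.I * u₁ x) / (2 * ζ) + u₂ x / (4 * ζ ^ 2)) x :=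
      (((hu x).const_mul Complex.I).neg.div_const _).add ((hu₁ x).div_const _)
    convert! h1 using 1
    have hI := Complex.I_sq
    have h2 : 2 * Complex.I * ζ * slopeTwo u u₁ ζ x = u x + Complex.I * u₁ x / (2 * ζ) := by
      simp only [slopeTwo]
      field_simp
      linear_combination (-u x * ζ * 8) * hI
    rw [h2]
    ring

theorem norm_cubicTerm_le (hC : ∀ x, ‖u x‖ ≤ C) (hC₂ : ∀ x, ‖u₂ x‖ ≤ C) {ζ : ℂ}
    (hζ : 1 ≤ ‖ζ‖) (x : ℝ) :
    ‖Complex.I * (u₂ x - conj (u x) * u x ^ 2) / (8 * ζ ^ 3)‖ ≤ (C + C ^ 3) / ‖ζ‖ ^ 3 := by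
  have hz : 0 < ‖ζ‖ := by linarith
  have hC0 : 0 ≤ C := (norm_nonneg _).trans (hC 0)
  rw [norm_div, norm_mul, norm_mul, norm_pow, Complex.norm_I, one_mul, Complex.norm_ofNat]
  have h2 : ‖u₂ x - conj (u x) * u x ^ 2‖ ≤ C + C ^ 3 := by
    refine (norm_sub_le _ _).trans (add_le_add (hC₂ x) ?_)
    rw [norm_mul, RCLike.norm_conj, norm_pow]
    calc _ ≤ C * C ^ 2 := by gcongr <;> exact hC x
      _ = _ := by ring
  gcongr
  have : 0 < ‖ζ‖ ^ 3 := by positivity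
  linarith

/-- The cubic term removes the residual of order ζ⁻², namely u₂/4 and the leading part -u* u²/4 of
u* N². Its own derivative contains u₃, which is where C³ is needed. -/
theorem isApproxSlope_slopeThree (hu : ∀ x, HasDerivAt u (u₁ x) x)
    (hu₁ : ∀ x, HasDerivAt u₁ (u₂ x) x) (hu₂ : ∀ x, HasDerivAt u₂ (u₃ x) x)
    (hp : ∀ x, u (x + L) = u x ∧ u₁ (x + L) = u₁ x) (hp₂ : ∀ x, u₂ (x + L) = u₂ x)
    (hC : ∀ x, ‖u x‖ ≤ C ∧ ‖u₁ x‖ ≤ C) (hC₂ : ∀ x, ‖u₂ x‖ ≤ C) (hC₃ : ∀ x, ‖u₃ x‖ ≤ C) :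
    IsApproxSlope u L 3 (slopeThree u u₁ u₂) := by
  have hC0 : 0 ≤ C := (norm_nonneg _).trans (hC 0).1
  refine ⟨fun ζ x => by simp only [slopeThree, slopeTwo, hp x, hp₂ x],
    (2 * C + C ^ 3) + (C + 3 * C ^ 3) + C * (2 * C + C ^ 3) * (3 * C + C ^ 3), by positivity,
    fun ζ hζ => ?_⟩
  have hz : 0 < ‖ζ‖ := by linarith
  have hz0 : ζ ≠ 0 := norm_pos_iff.1 hz
  have hz3 : ‖ζ‖ ≤ ‖ζ‖ ^ 3 := by nlinarith [mul_pos hz hz]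
  have hz23 : ‖ζ‖ ^ 2 ≤ ‖ζ‖ ^ 3 := by nlinarith [mul_pos hz hz]
  have hN : ∀ x, ‖slopeThree u u₁ u₂ ζ x‖ ≤ (2 * C + C ^ 3) / ‖ζ‖ := fun x => by
    refine (norm_add_le _ _).trans ((add_le_add (norm_slopeTwo_le hC hζ x)
      (norm_cubicTerm_le (fun x => (hC x).1) hC₂ hζ x)).trans ?_)
    have : (C + C ^ 3) / ‖ζ‖ ^ 3 ≤ (C + C ^ 3) / ‖ζ‖ := by gcongr
    calc _ ≤ C / ‖ζ‖ + (C + C ^ 3) / ‖ζ‖ := by gcongr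
      _ = _ := by ring
  have hF : ∀ x, ‖-(Complex.I * u x) / (2 * ζ)‖ ≤ C / ‖ζ‖ := fun x => by
    rw [norm_div, norm_neg, norm_mul, norm_mul, Complex.norm_I, one_mul, Complex.norm_ofNat]
    gcongr
    · exact (hC x).1
    · linarith
  have hNF : ∀ x, ‖slopeThree u u₁ u₂ ζ x - -(Complex.I * u x) / (2 * ζ)‖
      ≤ (2 * C + C ^ 3) / ‖ζ‖ ^ 2 := fun x => by
    have e : slopeThree u u₁ u₂ ζ x - -(Complex.I * u x) / (2 * ζ) = u₁ x / (4 * ζ ^ 2)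
        + Complex.I * (u₂ x - conj (u x) * u x ^ 2) / (8 * ζ ^ 3) := by
      simp only [slopeThree, slopeTwo]; ring
    have h1 : ‖u₁ x / (4 * ζ ^ 2)‖ ≤ C / ‖ζ‖ ^ 2 := by
      rw [norm_div, norm_mul, norm_pow, Complex.norm_ofNat]
      gcongr
      · exact (hC x).2
      · nlinarith
    have h2 : (C + C ^ 3) / ‖ζ‖ ^ 3 ≤ (C + C ^ 3) / ‖ζ‖ ^ 2 := by gcongr
    rw [e]
    refine (norm_add_le _ _).trans ((add_le_add h1
      (norm_cubicTerm_le (fun x => (hC x).1) hC₂ hζ x)).trans ?_)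
    calc _ ≤ C / ‖ζ‖ ^ 2 + (C + C ^ 3) / ‖ζ‖ ^ 2 := by gcongr
      _ = _ := by ring
  refine ⟨fun x => Complex.I * (u₃ x - (conj (u₁ x) * u x ^ 2 + conj (u x) * (2 * u x * u₁ x)))
      / (8 * ζ ^ 3) + conj (u x) * (slopeThree u u₁ u₂ ζ x ^ 2 + u x ^ 2 / (4 * ζ ^ 2)),
    fun x => ⟨?_, ?_, ?_⟩⟩
  · refine (hN x).trans (div_le_div_of_nonneg_right ?_ hz.le)
    have h1 : 0 ≤ C + 3 * C ^ 3 := by positivity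
    have h2 : 0 ≤ C * (2 * C + C ^ 3) * (3 * C + C ^ 3) := by positivity
    linarith
  · have h1 : ‖Complex.I * (u₃ x - (conj (u₁ x) * u x ^ 2 + conj (u x) * (2 * u x * u₁ x)))
        / (8 * ζ ^ 3)‖ ≤ (C + 3 * C ^ 3) / ‖ζ‖ ^ 3 := by
      rw [norm_div, norm_mul, norm_mul, norm_pow, Complex.norm_I, one_mul, Complex.norm_ofNat]
      have a : ‖u₃ x - (conj (u₁ x) * u x ^ 2 + conj (u x) * (2 * u x * u₁ x))‖
          ≤ C + 3 * C ^ 3 := by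
        refine (norm_sub_le _ _).trans ?_
        have b1 : ‖conj (u₁ x) * u x ^ 2‖ ≤ C * C ^ 2 := by
          rw [norm_mul, RCLike.norm_conj, norm_pow]
          gcongr
          exacts [(hC x).2, (hC x).1]
        have b2 : ‖conj (u x) * (2 * u x * u₁ x)‖ ≤ C * (2 * C * C) := by
          rw [norm_mul, RCLike.norm_conj, norm_mul, norm_mul, Complex.norm_ofNat]
          gcongr
          exacts [(hC x).1, (hC x).1, (hC x).2]
        have := norm_add_le (conj (u₁ x) * u x ^ 2) (conj (u x) * (2 * u x * u₁ x))
        nlinarith [hC₃ x]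
      gcongr
      have : 0 < ‖ζ‖ ^ 3 := by positivity
      linarith
    have h2 : ‖conj (u x) * (slopeThree u u₁ u₂ ζ x ^ 2 + u x ^ 2 / (4 * ζ ^ 2))‖
        ≤ C * (2 * C + C ^ 3) * (3 * C + C ^ 3) / ‖ζ‖ ^ 3 := by
      -- The square of the leading term is -u²/(4ζ²), so this is a difference of squares, of order
      -- ζ⁻² times ζ⁻¹.
      have e : slopeThree u u₁ u₂ ζ x ^ 2 + u x ^ 2 / (4 * ζ ^ 2)
          = (slopeThree u u₁ u₂ ζ x - -(Complex.I * u x) / (2 * ζ))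
            * (slopeThree u u₁ u₂ ζ x + -(Complex.I * u x) / (2 * ζ)) := by
        have hI := Complex.I_sq
        field_simp
        linear_combination (4 * u x ^ 2) * hI
      rw [e, norm_mul, RCLike.norm_conj, norm_mul]
      have h3 : ‖slopeThree u u₁ u₂ ζ x + -(Complex.I * u x) / (2 * ζ)‖
          ≤ (3 * C + C ^ 3) / ‖ζ‖ := by
        refine (norm_add_le _ _).trans ((add_le_add (hN x) (hF x)).trans (le_of_eq ?_))
        ring
      calc _ ≤ C * ((2 * C + C ^ 3) / ‖ζ‖ ^ 2 * ((3 * C + C ^ 3) / ‖ζ‖)) := by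
            gcongr
            exacts [(hC x).1, hNF x]
        _ = _ := by field_simp
    refine (norm_add_le _ _).trans ((add_le_add h1 h2).trans ?_)
    rw [← add_div]
    refine div_le_div_of_nonneg_right ?_ (by positivity)
    have : 0 ≤ C ^ 3 := by positivity
    linarith
  · have hconj : HasDerivAt (fun x => conj (u x)) (conj (u₁ x)) x := (hu x).star
    have h1 : HasDerivAt (slopeThree u u₁ u₂ ζ)
        (-(Complex.I * u₁ x) / (2 * ζ) + u₂ x / (4 * ζ ^ 2)
          + Complex.I * (u₃ x - (conj (u₁ x) * u x ^ 2 + conj (u x) * (2 * u x * u₁ x)))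
            / (8 * ζ ^ 3)) x := by
      convert! ((((hu x).const_mul Complex.I).neg.div_const (2 * ζ)).add
        ((hu₁ x).div_const (4 * ζ ^ 2))).add
        ((((hu₂ x).sub (hconj.mul ((hu x).pow 2))).const_mul Complex.I).div_const (8 * ζ ^ 3))
        using 1
      simp
    convert! h1 using 1
    have hI := Complex.I_sq
    have h2 : 2 * Complex.I * ζ * slopeThree u u₁ u₂ ζ x = u x + Complex.I * u₁ x / (2 * ζ)
        - (u₂ x - conj (u x) * u x ^ 2) / (4 * ζ ^ 2) := by
      simp only [slopeThree, slopeTwo]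
      field_simp
      linear_combination (16 * (u₂ x - conj (u x) * u x ^ 2) - 64 * u x * ζ ^ 2) * hI
    rw [h2]
    ring

end

section

variable {u : ℝ → ℂ} {L C : ℝ} {k : ℕ} {N P : ℂ → ℝ → ℂ}

theorem norm_exp_le_exp_abs_im (hL : 0 < L) (ζ : ℂ) :
    ‖Complex.exp (-(Complex.I * ζ) * L)‖ ≤ Real.exp (|ζ.im| * L) := by
  rw [Complex.norm_exp]
  gcongr
  have : (-(Complex.I * ζ) * (L : ℂ)).re = ζ.im * L := by simp
  rw [this]
  exact mul_le_mul_of_nonneg_right (le_abs_self _) hL.le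

/-- `IsZSPair.exists_transport` with constants independent of ζ and of the solution; periodicity
puts the same N at both ends of the period. -/
theorem IsApproxSlope.exists_transport (hN : IsApproxSlope u L k N) (hL : 0 < L)
    (hu : Continuous u) (hC : ∀ x, ‖u x‖ ≤ C) :
    ∃ K : ℝ, 0 ≤ K ∧ ∃ R : ℝ, 1 ≤ R ∧ ∀ ζ : ℂ, R ≤ ‖ζ‖ → ∀ p w : ℝ → ℂ, IsZSPair u ζ p w →
      (∀ x, ‖N ζ x‖ ≤ K / ‖ζ‖) ∧ N ζ L = N ζ 0 ∧ ∃ κ : ℂ, ‖κ - 1‖ ≤ K / ‖ζ‖ ∧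
        ‖(p L - N ζ 0 * w L)
            - κ * Complex.exp (-(Complex.I * ζ) * L) * (p 0 - N ζ 0 * w 0)‖
          ≤ K / ‖ζ‖ ^ k * Real.exp (|ζ.im| * L) * (‖p 0‖ + ‖w 0‖) := by
  obtain ⟨hper, D, hD0, hD⟩ := hN
  have hC0 : 0 ≤ C := (norm_nonneg _).trans (hC 0)
  have hK1 : 0 ≤ 2 * (C * D * L) := by positivity
  have hK2 : 0 ≤ Real.exp (2 + C * L) * L * D := by positivity
  refine ⟨D + 2 * (C * D * L) + Real.exp (2 + C * L) * L * D, by positivity,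
    max 1 (C * D * L), le_max_left _ _, fun ζ hζ p w h => ?_⟩
  have hζ1 : 1 ≤ ‖ζ‖ := (le_max_left _ _).trans hζ
  have hz : 0 < ‖ζ‖ := by linarith
  obtain ⟨r, hr⟩ := hD ζ hζ1
  have hLper : N ζ L = N ζ 0 := by simpa using hper ζ 0
  have hsmall : C * (D / ‖ζ‖) * L ≤ 1 := by
    rw [show C * (D / ‖ζ‖) * L = C * D * L / ‖ζ‖ by ring, div_le_one hz]
    exact (le_max_right _ _).trans hζ
  obtain ⟨κ, hκ, hT⟩ := h.exists_transport hu hC hL (fun x => (hr x).2.2) (fun x => (hr x).1)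
    hsmall (fun x => (hr x).2.1)
  refine ⟨fun x => (hr x).1.trans ?_, hLper, κ, hκ.trans ?_, ?_⟩
  · exact div_le_div_of_nonneg_right (by linarith) hz.le
  · rw [show 2 * (C * (D / ‖ζ‖) * L) = 2 * (C * D * L) / ‖ζ‖ by ring]
    exact div_le_div_of_nonneg_right (by linarith) hz.le
  · rw [hLper] at hT
    refine hT.trans ?_
    rw [show Real.exp (2 + C * L) * L * (D / ‖ζ‖ ^ k) = Real.exp (2 + C * L) * L * D / ‖ζ‖ ^ k
      by ring]
    refine mul_le_mul_of_nonneg_right (mul_le_mul_of_nonneg_right ?_ (Real.exp_pos _).le)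
      (by positivity)
    exact div_le_div_of_nonneg_right (by linarith) (by positivity)

/-- Over a period, the first component is multiplied by `exp (-i ζ L)` up to `O(1/ζ)`. -/
theorem IsApproxSlope.exists_norm_sub_exp_le (hN : IsApproxSlope u L k N) (hk : 1 ≤ k) (hL : 0 < L)
    (hu : Continuous u) (hC : ∀ x, ‖u x‖ ≤ C) :
    ∃ K : ℝ, ∃ R : ℝ, 1 ≤ R ∧ ∀ ζ : ℂ, R ≤ ‖ζ‖ → ∀ p w : ℝ → ℂ, IsZSPair u ζ p w →
      ‖p L - Complex.exp (-(Complex.I * ζ) * L) * p 0‖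
        ≤ K / ‖ζ‖ * Real.exp (|ζ.im| * L) * (‖p 0‖ + ‖w 0‖) := by
  obtain ⟨K, hK0, R, hR, hT⟩ := hN.exists_transport hL hu hC
  refine ⟨K + K * Real.exp (C * L) + (K * (1 + K) + K), R, hR, fun ζ hζ p w h => ?_⟩
  have hζ1 : 1 ≤ ‖ζ‖ := hR.trans hζ
  have hz : 0 < ‖ζ‖ := by linarith
  obtain ⟨hB, -, κ, hκ, hT⟩ := hT ζ hζ p w h
  set H := ‖p 0‖ + ‖w 0‖
  set E := Real.exp (|ζ.im| * L) with hE
  set X := Complex.exp (-(Complex.I * ζ) * L)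
  have hX : ‖X‖ ≤ E := norm_exp_le_exp_abs_im hL ζ
  have hE0 : 0 < E := Real.exp_pos _
  have hH : 0 ≤ H := by positivity
  have hKz : K / ‖ζ‖ ≤ K := div_le_self hK0 hζ1
  have hkz : K / ‖ζ‖ ^ k ≤ K / ‖ζ‖ := by
    gcongr
    exact le_self_pow₀ hζ1 (by omega)
  have hg : ‖p 0 - N ζ 0 * w 0‖ ≤ (1 + K) * H := by
    refine (norm_sub_le _ _).trans ?_
    rw [norm_mul]
    have : ‖N ζ 0‖ * ‖w 0‖ ≤ K * ‖w 0‖ :=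
      mul_le_mul_of_nonneg_right ((hB 0).trans hKz) (norm_nonneg _)
    simp only [H]
    nlinarith [norm_nonneg (p 0), norm_nonneg (w 0), mul_nonneg hK0 (norm_nonneg (p 0))]
  have hw : ‖w L‖ ≤ Real.exp (C * L) * E * H := by
    have := h.norm_snd_le hC hL.le
    rwa [add_mul, Real.exp_add, mul_comm (Real.exp _)] at this
  -- The first bracket is the transport error; the other terms carry a factor N or κ - 1, each
  -- O(1/ζ).
  have e : p L - X * p 0 = ((p L - N ζ 0 * w L) - κ * X * (p 0 - N ζ 0 * w 0))
      + N ζ 0 * w L + (κ - 1) * X * (p 0 - N ζ 0 * w 0) - X * N ζ 0 * w 0 := by ring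
  have b1 : ‖N ζ 0 * w L‖ ≤ K / ‖ζ‖ * (Real.exp (C * L) * E * H) := by
    rw [norm_mul]; gcongr; exact hB 0
  have b2 : ‖(κ - 1) * X * (p 0 - N ζ 0 * w 0)‖ ≤ K / ‖ζ‖ * E * ((1 + K) * H) := by
    rw [norm_mul, norm_mul]; gcongr
  have b3 : ‖X * N ζ 0 * w 0‖ ≤ E * (K / ‖ζ‖) * H := by
    rw [norm_mul, norm_mul]; gcongr
    · exact hB 0
    · simp [H]
  have b4 := hT.trans (mul_le_mul_of_nonneg_right
    (mul_le_mul_of_nonneg_right hkz hE0.le) hH)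
  rw [e]
  refine (norm_sub_le _ _).trans ((add_le_add ((norm_add_le _ _).trans (add_le_add
    ((norm_add_le _ _).trans (add_le_add b4 b1)) b2)) b3).trans (le_of_eq ?_))
  ring

/-- The slope of a Bloch solution, in the strip around the real axis and above: its distance
from the approximate slope when the multiplier exponentials are well separated. -/
theorem IsApproxSlope.exists_norm_bloch_sub_le (hN : IsApproxSlope u L k N)
    (hP : IsApproxSlope (fun x => conj (u x)) L k P) (hk : 1 ≤ k) (hL : 0 < L)
    (hu : Continuous u) (hC : ∀ x, ‖u x‖ ≤ C) {c : ℝ} (hc : 0 < c) :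
    ∃ K : ℝ, ∃ R : ℝ, 1 ≤ R ∧ ∀ ζ : ℂ, R ≤ ‖ζ‖ → ∀ p w : ℝ → ℂ, IsZSPair u ζ p w →
      ∀ ρ : ℂ, p L = ρ * p 0 → w L = ρ * w 0 → ‖p 0‖ ≤ ‖w 0‖ → w 0 ≠ 0 →
        c * Real.exp (|ζ.im| * L) ≤ ‖Complex.sin (ζ * L)‖ →
          ‖p 0 - N ζ 0 * w 0‖ ≤ K / ‖ζ‖ ^ k * ‖w 0‖ := by
  obtain ⟨K₁, hK₁, R₁, hR₁, hT₁⟩ := hN.exists_transport hL hu hC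
  obtain ⟨K₂, hK₂, R₂, hR₂, hT₂⟩ := hP.exists_transport hL (Complex.continuous_conj.comp hu)
    (fun x => (RCLike.norm_conj _).le.trans (hC x))
  -- The transport error K' E (‖p 0‖ + ‖w 0‖) is at most 2 K' E ‖w 0‖ and will be divided by c E /
  -- 2, whence the factor 4 / c.
  set M := 4 / c * (K₁ + K₂) with hM
  have hM0 : 0 ≤ M := by positivity
  -- Beyond (K₁ + K₂)/c the corrected factors κ₁X and κ₂Y stay separated; beyond K₂ + M + 1 the
  -- wrong alternative for ρ is contradictory.
  refine ⟨M, max (max R₁ R₂) (max ((K₁ + K₂) / c) (K₂ + M + 1)),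
    hR₁.trans ((le_max_left _ _).trans (le_max_left _ _)),
    fun ζ hζ p w h ρ hp hw hpw hw0 hsin => ?_⟩
  have hζR₁ : R₁ ≤ ‖ζ‖ := ((le_max_left _ _).trans (le_max_left _ _)).trans hζ
  have hζR₂ : R₂ ≤ ‖ζ‖ := ((le_max_right _ _).trans (le_max_left _ _)).trans hζ
  have hζ1 : 1 ≤ ‖ζ‖ := hR₁.trans hζR₁
  have hz : 0 < ‖ζ‖ := by linarith
  have hζ3 : (K₁ + K₂) / c ≤ ‖ζ‖ := ((le_max_left _ _).trans (le_max_right _ _)).trans hζ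
  have hζ4 : K₂ + M + 1 ≤ ‖ζ‖ := ((le_max_right _ _).trans (le_max_right _ _)).trans hζ
  obtain ⟨-, -, κ₁, hκ₁, hA⟩ := hT₁ ζ hζR₁ p w h
  obtain ⟨hB, -, κ₂, hκ₂, hA'⟩ := hT₂ (-ζ) (by rwa [norm_neg]) w p h.swap
  have hwpos : 0 < ‖w 0‖ := norm_pos_iff.2 hw0
  simp only [norm_neg, Complex.neg_im, abs_neg] at hB hκ₂ hA'
  set E := Real.exp (|ζ.im| * L) with hE
  have hE0 : 0 < E := Real.exp_pos _
  set X := Complex.exp (-(Complex.I * ζ) * L) with hXd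
  set Y := Complex.exp (-(Complex.I * -ζ) * L) with hYd
  have hX : ‖X‖ ≤ E := norm_exp_le_exp_abs_im hL ζ
  have hY : ‖Y‖ ≤ E := by
    rw [hE, ← abs_neg, ← Complex.neg_im]
    exact norm_exp_le_exp_abs_im hL (-ζ)
  have hXY : 2 * (c * E) ≤ ‖X - Y‖ := by
    have e : Complex.sin (ζ * L) = (X - Y) * (Complex.I / 2) := by
      rw [Complex.sin, hXd, hYd]
      rw [show -(ζ * (L : ℂ)) * Complex.I = -(Complex.I * ζ) * L by ring,
        show ζ * (L : ℂ) * Complex.I = -(Complex.I * -ζ) * L by ring]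
      ring
    rw [e, norm_mul, norm_div, Complex.norm_I, Complex.norm_ofNat] at hsin
    linarith
  have hsep : c * E ≤ ‖κ₁ * X - κ₂ * Y‖ := by
    have e : X - Y = (κ₁ * X - κ₂ * Y) - (κ₁ - 1) * X + (κ₂ - 1) * Y := by ring
    have a1 : ‖(κ₁ - 1) * X‖ ≤ K₁ / ‖ζ‖ * E := by rw [norm_mul]; gcongr
    have a2 : ‖(κ₂ - 1) * Y‖ ≤ K₂ / ‖ζ‖ * E := by rw [norm_mul]; gcongr
    have a3 := (norm_add_le ((κ₁ * X - κ₂ * Y) - (κ₁ - 1) * X) ((κ₂ - 1) * Y)).trans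
      (add_le_add (norm_sub_le _ _) le_rfl)
    rw [← e] at a3
    have a4 : K₁ / ‖ζ‖ * E + K₂ / ‖ζ‖ * E ≤ c * E := by
      rw [← add_mul, ← add_div]
      refine mul_le_mul_of_nonneg_right ?_ hE0.le
      rw [div_le_iff₀ hz]
      rwa [div_le_iff₀ hc, mul_comm] at hζ3
    linarith
  have hone : ∀ (κX g : ℂ) (K' : ℝ), 0 ≤ K' → K' ≤ K₁ + K₂ → c * E / 2 ≤ ‖ρ - κX‖ →
      ‖ρ * g - κX * g‖ ≤ K' / ‖ζ‖ ^ k * E * (2 * ‖w 0‖) → ‖g‖ ≤ M / ‖ζ‖ ^ k * ‖w 0‖ := by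
    intro κX g K' hK' hKK h1 h2
    rw [← sub_mul, norm_mul] at h2
    have h3 := (mul_le_mul_of_nonneg_right h1 (norm_nonneg g)).trans h2
    have h4 : c / 2 * ‖g‖ ≤ K' / ‖ζ‖ ^ k * (2 * ‖w 0‖) := by
      refine le_of_mul_le_mul_right ?_ hE0
      linarith
    have h5 : ‖g‖ ≤ 4 / c * K' / ‖ζ‖ ^ k * ‖w 0‖ := by
      have : ‖g‖ = 2 / c * (c / 2 * ‖g‖) := by field_simp
      rw [this]
      refine (mul_le_mul_of_nonneg_left h4 (by positivity)).trans (le_of_eq ?_)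
      ring
    refine h5.trans (mul_le_mul_of_nonneg_right (div_le_div_of_nonneg_right ?_ (by positivity))
      hwpos.le)
    exact mul_le_mul_of_nonneg_left hKK (by positivity)
  -- ρ cannot be close to both factors. If it is far from κ₁X, then p - N w, which is multiplied by
  -- ρ exactly and by κ₁X approximately, must be small.
  have hcase : c * E / 2 ≤ ‖ρ - κ₁ * X‖ ∨ c * E / 2 ≤ ‖ρ - κ₂ * Y‖ := by
    by_contra! hcon
    have e : κ₁ * X - κ₂ * Y = (ρ - κ₂ * Y) - (ρ - κ₁ * X) := by ring
    have := norm_sub_le (ρ - κ₂ * Y) (ρ - κ₁ * X)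
    rw [← e] at this
    linarith [hcon.1, hcon.2]
  rcases hcase with h1 | h1
  · refine hone _ _ K₁ hK₁ (by linarith) h1 ?_
    rw [hp, hw, show ρ * p 0 - N ζ 0 * (ρ * w 0) = ρ * (p 0 - N ζ 0 * w 0) by ring] at hA
    refine hA.trans (mul_le_mul_of_nonneg_left (by linarith) (by positivity))
  · exfalso
    -- Otherwise w would be close to P p, impossible since P is O(1/ζ) and |p| ≤ |w|.
    have h2 := hone _ (w 0 - P (-ζ) 0 * p 0) K₂ hK₂ (by linarith) h1 (by
      rw [hp, hw, show ρ * w 0 - P (-ζ) 0 * (ρ * p 0) = ρ * (w 0 - P (-ζ) 0 * p 0) by ring] at hA'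
      exact hA'.trans (mul_le_mul_of_nonneg_left (by linarith) (by positivity)))
    have h3 : ‖w 0‖ ≤ ‖w 0 - P (-ζ) 0 * p 0‖ + ‖P (-ζ) 0‖ * ‖p 0‖ := by
      rw [← norm_mul]
      simpa using norm_add_le (w 0 - P (-ζ) 0 * p 0) (P (-ζ) 0 * p 0)
    have h4 : ‖P (-ζ) 0‖ * ‖p 0‖ ≤ K₂ / ‖ζ‖ * ‖w 0‖ := by gcongr; exact hB 0
    have h5 : M / ‖ζ‖ ^ k ≤ M / ‖ζ‖ := by
      gcongr
      exact le_self_pow₀ hζ1 (by omega)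
    have h6 : M / ‖ζ‖ + K₂ / ‖ζ‖ < 1 := by
      rw [← add_div, div_lt_one hz]; linarith
    have h7 := mul_le_mul_of_nonneg_right h5 hwpos.le
    nlinarith

/-- The slope of a Bloch solution in a sector off the real axis. -/
theorem IsApproxSlope.exists_norm_bloch_sub_le_of_sector (hN : IsApproxSlope u L k N) (hL : 0 < L)
    (hC : ∀ x, ‖u x‖ ≤ C) {θ : ℝ} (hθ : 0 < θ) :
    ∃ K : ℝ, ∃ R : ℝ, 1 ≤ R ∧ ∀ ζ : ℂ, R ≤ ‖ζ‖ → ∀ p w : ℝ → ℂ, IsZSPair u ζ p w →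
      ∀ ρ : ℂ, (∀ x, p (x + L) = ρ * p x) → (∀ x, w (x + L) = ρ * w x) →
        (∀ x, ‖p x‖ ≤ ‖w x‖) → (∀ x, w x ≠ 0) → θ * ‖ζ‖ ≤ |ζ.im| →
          ‖p 0 - N ζ 0 * w 0‖ ≤ K / ‖ζ‖ ^ (k + 1) * ‖w 0‖ := by
  obtain ⟨hper, D, hD0, hD⟩ := hN
  have hC0 : 0 ≤ C := (norm_nonneg _).trans (hC 0)
  refine ⟨D / θ, max (max 1 D) (2 * C / θ), (le_max_left _ _).trans (le_max_left _ _),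
    fun ζ hζ p w h ρ hp hw hpw hw0 hθζ => ?_⟩
  have hζ1 : 1 ≤ ‖ζ‖ := ((le_max_left _ _).trans (le_max_left _ _)).trans hζ
  have hζ2 : D ≤ ‖ζ‖ := ((le_max_right _ _).trans (le_max_left _ _)).trans hζ
  have hζ3 : 2 * C / θ ≤ ‖ζ‖ := (le_max_right _ _).trans hζ
  have hz : 0 < ‖ζ‖ := by linarith
  obtain ⟨r, hr⟩ := hD ζ hζ1
  -- |e|² is periodic and attains its maximum. There its derivative vanishes, which equates 2 Im ζ
  -- |e|² to terms of size C |e|² and |r| |e|. In the sector Im ζ dominates, so |e| is of order |r|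
  -- / |ζ|: this is the extra power.
  set e : ℝ → ℂ := fun x => p x / w x - N ζ x with he
  have hρ : ρ ≠ 0 := fun h0 => hw0 (0 + L) (by rw [hw, h0, zero_mul])
  have hep : Function.Periodic (fun x => ‖e x‖ ^ 2) L := fun x => by
    simp only [he, hp, hw, hper, mul_div_mul_left _ _ hρ]
  have hed : ∀ x, HasDerivAt e (-2 * Complex.I * ζ * e x
      - conj (u x) * (p x / w x + N ζ x) * e x - r x) x := fun x => by
    convert! ((h.fst x).div (h.snd x) (hw0 x)).sub (hr x).2.2 using 1
    have := hw0 x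
    simp only [he]
    field_simp
    ring
  have hec : Continuous fun x => ‖e x‖ ^ 2 :=
    (continuous_iff_continuousAt.2 fun x => (hed x).continuousAt).norm.pow 2
  obtain ⟨x, -, hx⟩ := isCompact_Icc.exists_isMaxOn (Set.nonempty_Icc.2 hL.le) hec.continuousOn
  have hmax : ∀ y, ‖e y‖ ^ 2 ≤ ‖e x‖ ^ 2 := fun y => by
    obtain ⟨y', hy', hyy⟩ := hep.exists_mem_Ico₀ hL y
    rw [hyy]
    exact hx ⟨hy'.1, hy'.2.le⟩
  have hzero := IsLocalMax.hasDerivAt_eq_zero (Filter.Eventually.of_forall hmax)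
    (hasDerivAt_norm_sq (hed x))
  have hid : 2 * ζ.im * ‖e x‖ ^ 2
      = (conj (u x) * (p x / w x + N ζ x)).re * ‖e x‖ ^ 2 + (r x * conj (e x)).re := by
    simp only [Complex.sq_norm, Complex.normSq_apply]
    generalize conj (u x) * (p x / w x + N ζ x) = f at hzero ⊢
    simp only [Complex.mul_re, Complex.sub_re, Complex.sub_im, Complex.mul_im, Complex.neg_re,
      Complex.neg_im, Complex.I_re, Complex.I_im, Complex.conj_re, Complex.conj_im,
      Complex.re_ofNat, Complex.im_ofNat] at hzero ⊢
    linear_combination (1 / 2) * hzero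
  have hn : ‖p x / w x + N ζ x‖ ≤ 2 := by
    refine (norm_add_le _ _).trans ?_
    have h1 : ‖p x / w x‖ ≤ 1 := by
      rw [norm_div]; exact div_le_one_of_le₀ (hpw x) (norm_nonneg _)
    have h2 : D / ‖ζ‖ ≤ 1 := (div_le_one hz).2 hζ2
    linarith [(hr x).1]
  have hf : |(conj (u x) * (p x / w x + N ζ x)).re| ≤ 2 * C := by
    refine (Complex.abs_re_le_norm _).trans ?_
    rw [norm_mul, RCLike.norm_conj]
    calc _ ≤ C * 2 := by gcongr; exact hC x
      _ = _ := by ring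
  have hre : |(r x * conj (e x)).re| ≤ D / ‖ζ‖ ^ k * ‖e x‖ := by
    refine (Complex.abs_re_le_norm _).trans ?_
    rw [norm_mul, RCLike.norm_conj]
    gcongr
    exact (hr x).2.1
  have hineq : 2 * |ζ.im| * ‖e x‖ ^ 2 ≤ 2 * C * ‖e x‖ ^ 2 + D / ‖ζ‖ ^ k * ‖e x‖ := by
    have h1 : |2 * ζ.im * ‖e x‖ ^ 2| = 2 * |ζ.im| * ‖e x‖ ^ 2 := by
      rw [abs_mul, abs_mul, abs_two, abs_of_nonneg (sq_nonneg ‖e x‖)]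
    rw [← h1, hid]
    refine (abs_add_le _ _).trans (add_le_add ?_ hre)
    rw [abs_mul, abs_of_nonneg (sq_nonneg ‖e x‖)]
    gcongr
  have hb : ‖e x‖ ≤ D / θ / ‖ζ‖ ^ (k + 1) := by
    rcases (norm_nonneg (e x)).eq_or_lt with h0 | h0
    · rw [← h0]; positivity
    have h1 : 2 * C ≤ θ * ‖ζ‖ := by
      rwa [div_le_iff₀ hθ, mul_comm ‖ζ‖] at hζ3
    have h2 : θ * ‖ζ‖ * ‖e x‖ ≤ D / ‖ζ‖ ^ k := by
      refine le_of_mul_le_mul_right ?_ h0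
      have h3 := mul_le_mul_of_nonneg_right hθζ (sq_nonneg ‖e x‖)
      have h4 := mul_le_mul_of_nonneg_right h1 (sq_nonneg ‖e x‖)
      nlinarith
    rw [le_div_iff₀ (by positivity)] at h2
    rw [div_div, le_div_iff₀ (by positivity), pow_succ]
    linarith
  have h0 : ‖e 0‖ ≤ ‖e x‖ := by
    rw [← sq_le_sq₀ (norm_nonneg _) (norm_nonneg _)]; exact hmax 0
  have e1 : p 0 - N ζ 0 * w 0 = e 0 * w 0 := by
    have := hw0 0
    simp only [he]; field_simp
  rw [e1, norm_mul]
  exact mul_le_mul_of_nonneg_right (h0.trans hb) (norm_nonneg _)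

end

/-! ### From the slope of the Bloch solution to α. -/

theorem exists_norm_le_of_periodic {f : ℝ → ℂ} {L : ℝ} (hf : Continuous f) (hL : 0 < L)
    (hp : ∀ x, f (x + L) = f x) : ∃ C, ∀ x, ‖f x‖ ≤ C := by
  obtain ⟨C, hC⟩ := (Function.Periodic.isBounded_of_continuous (c := L) hp hL.ne' hf).exists_norm_le
  exact ⟨C, fun x => hC _ ⟨x, rfl⟩⟩

theorem deriv_periodic {f f' : ℝ → ℂ} {L : ℝ} (hf : ∀ x, HasDerivAt f (f' x) x)
    (hp : ∀ x, f (x + L) = f x) (x : ℝ) : f' (x + L) = f' x := by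
  have h := (hf (x + L)).comp_add_const x L
  rw [funext hp] at h
  exact h.unique (hf x)

/-- `f` or its complex conjugate, according to the sign `σ`. -/
def signedConj (σ : ℤˣ) (f : ℝ → ℂ) (x : ℝ) : ℂ := if σ = 1 then f x else conj (f x)

@[simp] theorem signedConj_one (f : ℝ → ℂ) : signedConj 1 f = f := by
  funext x; simp [signedConj]

@[simp] theorem signedConj_neg_one (f : ℝ → ℂ) : signedConj (-1) f = fun x => conj (f x) := by
  funext x; simp [signedConj]

theorem conj_signedConj (σ : ℤˣ) (f : ℝ → ℂ) :
    (fun x => conj (signedConj σ f x)) = signedConj (-σ) f := by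
  rcases Int.units_eq_one_or σ with rfl | rfl <;> simp

theorem norm_signedConj (σ : ℤˣ) (f : ℝ → ℂ) (x : ℝ) : ‖signedConj σ f x‖ = ‖f x‖ := by
  rcases Int.units_eq_one_or σ with rfl | rfl <;> simp

theorem hasDerivAt_signedConj (σ : ℤˣ) {f : ℝ → ℂ} {f' : ℝ → ℂ} {x : ℝ}
    (hf : HasDerivAt f (f' x) x) : HasDerivAt (signedConj σ f) (signedConj σ f' x) x := by
  rcases Int.units_eq_one_or σ with rfl | rfl
  · simpa using hf
  · simpa using hf.star

theorem signedConj_periodic (σ : ℤˣ) {f : ℝ → ℂ} (hf : ∀ x, f (x + L) = f x) (x : ℝ) :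
    signedConj σ f (x + L) = signedConj σ f x := by
  simp only [signedConj, hf]

theorem IsPeriodicNLSSolution.continuous_dxx_slice (hq : IsPeriodicNLSSolution q L T)
    (ht : t ∈ T) : Continuous fun x => dxx q x t :=
  hq.continuous_dxx.comp_continuous (f := fun x => (x, t)) (by fun_prop) (fun x => ⟨trivial, ht⟩)

theorem IsPeriodicNLSSolution.exists_bound (hq : IsPeriodicNLSSolution q L T) (hL : 0 < L)
    (ht : t ∈ T) : ∃ C : ℝ, ∀ x, ‖q x t‖ ≤ C ∧ ‖dx q x t‖ ≤ C ∧ ‖dxx q x t‖ ≤ C := by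
  obtain ⟨C₀, h₀⟩ := exists_norm_le_of_periodic (hq.isPeriodicPotential hL ht).continuous hL
    (hq.periodic t ht)
  obtain ⟨C₁, h₁⟩ := exists_norm_le_of_periodic (hq.continuous_dx_slice ht) hL (hq.dx_periodic ht)
  obtain ⟨C₂, h₂⟩ := exists_norm_le_of_periodic (hq.continuous_dxx_slice ht) hL
    (deriv_periodic (fun x => hq.hasDerivAt_dx ht x) (hq.dx_periodic ht))
  exact ⟨max C₀ (max C₁ C₂), fun x => ⟨(h₀ x).trans (le_max_left _ _),
    (h₁ x).trans ((le_max_left _ _).trans (le_max_right _ _)),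
    (h₂ x).trans ((le_max_right _ _).trans (le_max_right _ _))⟩⟩

theorem IsPeriodicNLSSolution.isApproxSlope_slopeTwo (hq : IsPeriodicNLSSolution q L T)
    (hL : 0 < L) (ht : t ∈ T) (σ : ℤˣ) :
    IsApproxSlope (signedConj σ fun x => q x t) L 2
      (slopeTwo (signedConj σ fun x => q x t) (signedConj σ fun x => dx q x t)) := by
  obtain ⟨C, hC⟩ := hq.exists_bound hL ht
  exact PeriodicNLS.isApproxSlope_slopeTwo (C := C)
    (fun x => hasDerivAt_signedConj σ (f' := fun x => dx q x t) (hq.hasDerivAt_x ht x))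
    (fun x => hasDerivAt_signedConj σ (f' := fun x => dxx q x t) (hq.hasDerivAt_dx ht x))
    (fun x => ⟨signedConj_periodic σ (hq.periodic t ht) x,
      signedConj_periodic σ (hq.dx_periodic ht) x⟩)
    (fun x => by simpa only [norm_signedConj] using ⟨(hC x).1, (hC x).2.1⟩)
    (fun x => by simpa only [norm_signedConj] using (hC x).2.2)

theorem IsPeriodicNLSSolution.isApproxSlope_slopeThree (hq : IsPeriodicNLSSolution q L T)
    (hL : 0 < L) (ht : t ∈ T) (h3 : ContDiff ℝ 3 fun x => q x t) (σ : ℤˣ) :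
    IsApproxSlope (signedConj σ fun x => q x t) L 3
      (slopeThree (signedConj σ fun x => q x t) (signedConj σ fun x => dx q x t)
        (signedConj σ fun x => dxx q x t)) := by
  obtain ⟨C, hC⟩ := hq.exists_bound hL ht
  have h1 : ContDiff ℝ 1 fun x => dxx q x t := by
    have e3 : ContDiff ℝ (2 + 1) fun x => q x t := by
      convert h3 using 1
      norm_num
    have e2 : ContDiff ℝ (1 + 1) fun x => dx q x t := by
      rw [one_add_one_eq_two]
      exact (contDiff_succ_iff_deriv.1 e3).2.2
    exact (contDiff_succ_iff_deriv.1 e2).2.2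
  have hd : ∀ x, HasDerivAt (fun x => dxx q x t) (deriv (fun x => dxx q x t) x) x := fun x =>
    (h1.differentiable one_ne_zero x).hasDerivAt
  have hp₂ := deriv_periodic (fun x => hq.hasDerivAt_dx ht x) (hq.dx_periodic ht)
  obtain ⟨C₃, hC₃⟩ := exists_norm_le_of_periodic (h1.continuous_deriv le_rfl) hL
    (deriv_periodic hd hp₂)
  exact PeriodicNLS.isApproxSlope_slopeThree (C := max C C₃)
    (fun x => hasDerivAt_signedConj σ (f' := fun x => dx q x t) (hq.hasDerivAt_x ht x))
    (fun x => hasDerivAt_signedConj σ (f' := fun x => dxx q x t) (hq.hasDerivAt_dx ht x))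
    (fun x => hasDerivAt_signedConj σ (f' := deriv fun x => dxx q x t) (hd x))
    (fun x => ⟨signedConj_periodic σ (hq.periodic t ht) x,
      signedConj_periodic σ (hq.dx_periodic ht) x⟩)
    (signedConj_periodic σ hp₂)
    (fun x => by
      simpa only [norm_signedConj] using
        ⟨(hC x).1.trans (le_max_left _ _), (hC x).2.1.trans (le_max_left _ _)⟩)
    (fun x => by simpa only [norm_signedConj] using (hC x).2.2.trans (le_max_left _ _))
    (fun x => by simpa only [norm_signedConj] using (hC₃ x).trans (le_max_right _ _))

/-- The coefficient `α` in terms of the ratio `n` of the components of the Bloch solution. -/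
def alphaForm (a b ζ n : ℂ) : ℂ :=
  ζ * (a + conj a) + (Complex.I / 2) * (b - conj b)
    + (2 * ζ ^ 2 + Complex.I * ζ * (conj a - a) + a * conj a + (1 / 2) * (b + conj b))
      * (Complex.I * (1 - n) / (1 + n))

/-- Two terms of the expansion of n, with an error of third order, cancel everything in α down to
order ζ⁰ except 2iζ². Multiplication by 1 + n, which is bounded away from 0, makes this an exact
identity. -/
theorem norm_alphaForm_sub_le {a b ζ n : ℂ} {C K : ℝ} (ha : ‖a‖ ≤ C) (hb : ‖b‖ ≤ C)
    (hζ : 1 ≤ ‖ζ‖) (hζK : 2 * (C + K) ≤ ‖ζ‖)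
    (hn : ‖n - (-(Complex.I * a) / (2 * ζ) + b / (4 * ζ ^ 2))‖ ≤ K / ‖ζ‖ ^ 3) :
    ‖alphaForm a b ζ n - 2 * Complex.I * ζ ^ 2‖
      ≤ 2 * (4 * K + 2 * C * K + C ^ 2 + (C + C ^ 2) * (C + K)) / ‖ζ‖ := by
  have hz : 0 < ‖ζ‖ := by linarith
  have hz0 : ζ ≠ 0 := norm_pos_iff.1 hz
  have hC0 : 0 ≤ C := (norm_nonneg _).trans ha
  have hK0 : 0 ≤ K := by
    have h1 := (norm_nonneg _).trans hn
    rwa [le_div_iff₀ (by positivity), zero_mul] at h1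
  set N := -(Complex.I * a) / (2 * ζ) + b / (4 * ζ ^ 2) with hN
  have hNb : ‖N‖ ≤ C / ‖ζ‖ :=
    norm_slopeTwo_le (u := fun _ => a) (u₁ := fun _ => b) (fun _ => ⟨ha, hb⟩) hζ 0
  have hz3 : ‖ζ‖ ≤ ‖ζ‖ ^ 3 := by nlinarith [mul_pos hz hz]
  have hnb : ‖n‖ ≤ (C + K) / ‖ζ‖ := by
    have h1 : ‖n‖ ≤ ‖n - N‖ + ‖N‖ := by simpa using norm_add_le (n - N) N
    have h2 : K / ‖ζ‖ ^ 3 ≤ K / ‖ζ‖ := by gcongr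
    rw [add_div]; linarith
  have hn2 : ‖n‖ ≤ 1 / 2 := by
    refine hnb.trans ?_
    rw [div_le_iff₀ hz]; linarith
  have h1n : 1 / 2 ≤ ‖1 + n‖ := by
    have := norm_sub_le (1 + n) n
    rw [add_sub_cancel_right, norm_one] at this
    linarith
  have h1n0 : 1 + n ≠ 0 := norm_pos_iff.1 (by linarith)
  have key : (alphaForm a b ζ n - 2 * Complex.I * ζ ^ 2) * (1 + n)
      = -(4 * Complex.I * ζ ^ 2) * (n - N) + 2 * ζ * conj a * (n - N) + conj a * b / (2 * ζ)
        - Complex.I * (conj b + a * conj a) * n := by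
    have hI := Complex.I_sq
    rw [alphaForm, hN]
    field_simp
    generalize conj a = a'
    generalize conj b = b'
    grind
  have b1 : ‖-(4 * Complex.I * ζ ^ 2) * (n - N)‖ ≤ 4 * K / ‖ζ‖ := by
    rw [norm_mul, norm_neg, norm_mul, norm_mul, norm_pow, Complex.norm_I, Complex.norm_ofNat]
    calc _ ≤ 4 * 1 * ‖ζ‖ ^ 2 * (K / ‖ζ‖ ^ 3) := by gcongr
      _ = _ := by field_simp
  have b2 : ‖2 * ζ * conj a * (n - N)‖ ≤ 2 * C * K / ‖ζ‖ := by
    rw [norm_mul, norm_mul, norm_mul, RCLike.norm_conj, Complex.norm_ofNat]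
    calc _ ≤ 2 * ‖ζ‖ * C * (K / ‖ζ‖ ^ 3) := by gcongr
      _ = 2 * C * K / ‖ζ‖ ^ 2 := by field_simp
      _ ≤ _ := by
        gcongr
        nlinarith
  have b3 : ‖conj a * b / (2 * ζ)‖ ≤ C ^ 2 / ‖ζ‖ := by
    rw [norm_div, norm_mul, norm_mul, RCLike.norm_conj, Complex.norm_ofNat]
    calc _ ≤ C * C / (1 * ‖ζ‖) := by
          gcongr
          norm_num
      _ = _ := by ring
  have b4 : ‖Complex.I * (conj b + a * conj a) * n‖ ≤ (C + C ^ 2) * (C + K) / ‖ζ‖ := by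
    rw [norm_mul, norm_mul, Complex.norm_I, one_mul]
    have : ‖conj b + a * conj a‖ ≤ C + C ^ 2 := by
      refine (norm_add_le _ _).trans ?_
      rw [norm_mul, RCLike.norm_conj, RCLike.norm_conj]
      nlinarith [norm_nonneg a]
    calc _ ≤ (C + C ^ 2) * ((C + K) / ‖ζ‖) := by gcongr
      _ = _ := by ring
  have hsum := (norm_sub_le _ _).trans (add_le_add ((norm_add_le _ _).trans (add_le_add
    ((norm_add_le _ _).trans (add_le_add b1 b2)) b3)) b4)
  rw [← key, norm_mul, ← add_div, ← add_div, ← add_div] at hsum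
  have h2 := mul_le_mul_of_nonneg_left h1n
    (norm_nonneg (alphaForm a b ζ n - 2 * Complex.I * ζ ^ 2))
  rw [mul_div_assoc]
  linarith

/-- The Bloch solution off the real axis as a pair of functions whose ratio is small. -/
theorem IsPeriodicPotential.exists_bloch_pair (h : IsPeriodicPotential q L t) (s e : ℤˣ) {z : ℂ}
    (hz : 0 < ((e : ℤ) : ℝ) * z.im) :
    ∃ (p w : ℝ → ℂ) (ρ : ℂ),
      IsZSPair (signedConj (s * e) fun x => q x t) (((s * e : ℤˣ) : ℤ) * z) p w ∧
      (∀ x, p (x + L) = ρ * p x) ∧ (∀ x, w (x + L) = ρ * w x) ∧ (∀ x, ‖p x‖ < ‖w x‖) ∧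
      alpha s q L t z = (((s * e : ℤˣ) : ℤ) : ℂ) *
        alphaForm (signedConj (s * e) (fun x => q x t) 0) (signedConj (s * e) (fun x => dx q x t) 0)
          (((s * e : ℤˣ) : ℤ) * z) (p 0 / w 0) := by
  have hz0 : z.im ≠ 0 := fun h0 => by simp [h0] at hz
  have hzl : z ∉ laxSpectrum q t := fun hmem => hz0 (h.im_eq_zero_of_lax hmem)
  have hb := h.isNormalizedBloch (s := s) hzl
    (fun hd => hz0 (h.im_eq_zero_of_dirichlet hd.1))
  have hsgn := h.bloch_energy_sign hz0 s hb
  obtain ⟨hm, hper, hone⟩ := hb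
  set ψ := bloch s q L t z with hψ
  set V : ℝ → Fin 2 → ℂ := fun x => U⁻¹ *ᵥ ψ x with hV
  have hzs : ∀ x, HasDerivAt (fun y => V y 0) (-(Complex.I * z) * V x 0 + q x t * V x 1) x ∧
      HasDerivAt (fun y => V y 1) (conj (q x t) * V x 0 + Complex.I * z * V x 1) x :=
    isZSSolution_iff.1 (isModZSSolution_iff.1 hm)
  have hVper : ∀ x i, V (x + L) i = multiplier q L t z ^ (s : ℤ) * V x i := fun x i => by
    simp only [hV, hper x, Matrix.mulVec_smul, Pi.smul_apply, smul_eq_mul]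
  have hV0 : ψ 0 = U *ᵥ V 0 := by
    simp only [hV, Matrix.mulVec_mulVec, U_mul_inv, Matrix.one_mulVec]
  have e0 : V 0 0 + V 0 1 = 1 := by
    rw [← hone, hV0]; simp [U, Matrix.mulVec, dotProduct, Fin.sum_univ_two]
  have e1 : ψ 0 1 = -Complex.I * V 0 0 + Complex.I * V 0 1 := by
    conv_lhs => rw [hV0]
    simp [U, Matrix.mulVec, dotProduct, Fin.sum_univ_two]
  have hse : (((s * e : ℤˣ) : ℤ) : ℝ) = ((s : ℤ) : ℝ) * ((e : ℤ) : ℝ) := by push_cast; ring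
  have hnorm : (‖q 0 t‖ : ℂ) ^ 2 = q 0 t * conj (q 0 t) := (Complex.mul_conj' _).symm
  have hee : ((e : ℤ) : ℝ) * ((e : ℤ) : ℝ) = 1 := by
    rcases Int.units_eq_one_or e with rfl | rfl <;> simp
  have hsgn' : ∀ x, (((s * e : ℤˣ) : ℤ) : ℝ) * (‖V x 0‖ ^ 2 - ‖V x 1‖ ^ 2) < 0 := fun x => by
    have h1 := hsgn x
    by_contra! hcon
    have h2 := mul_nonneg hz.le hcon
    rw [hse] at h2
    have h3 : ((e : ℤ) : ℝ) * z.im * (((s : ℤ) : ℝ) * ((e : ℤ) : ℝ) * (‖V x 0‖ ^ 2 - ‖V x 1‖ ^ 2))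
        = ((e : ℤ) : ℝ) * ((e : ℤ) : ℝ)
          * (((s : ℤ) : ℝ) * z.im * (‖V x 0‖ ^ 2 - ‖V x 1‖ ^ 2)) := by ring
    rw [h3, hee, one_mul] at h2
    exact absurd h1 (not_lt.2 h2)
  -- By the energy sign, the second component is the larger one if se = 1 and the first if se = -1;
  -- in the latter case the components are exchanged, with spectral parameter -z and conjugate
  -- potential.
  rcases Int.units_eq_one_or (s * e) with hσ | hσ
  · rw [hσ] at hsgn' ⊢
    simp only [Units.val_one, Int.cast_one, one_mul, sub_neg] at hsgn' ⊢
    have hlt : ∀ x, ‖V x 0‖ < ‖V x 1‖ := fun x =>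
      lt_of_pow_lt_pow_left₀ 2 (norm_nonneg _) (hsgn' x)
    refine ⟨fun x => V x 0, fun x => V x 1, _, ⟨fun x => ?_, fun x => ?_⟩,
      fun x => hVper x 0, fun x => hVper x 1, hlt, ?_⟩
    · simp only [signedConj_one]
      exact (hzs x).1
    · simp only [signedConj_one]
      exact (hzs x).2
    have hw : V 0 1 ≠ 0 := norm_pos_iff.1 ((norm_nonneg _).trans_lt (hlt 0))
    -- The normalization ψ₁(0) = 1 reads V₀ + V₁ = 1 at x = 0, so 1 + n = 1/V₁.
    have hr : Complex.I * (1 - V 0 0 / V 0 1) / (1 + V 0 0 / V 0 1) = ψ 0 1 := by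
      have : 1 + V 0 0 / V 0 1 = 1 / V 0 1 := by
        rw [eq_div_iff hw, add_mul, div_mul_cancel₀ _ hw, one_mul, add_comm, e0]
      rw [this, e1]; field_simp; ring
    simp only [alphaForm, hr, alpha, signedConj_one, hnorm, ← hψ]
    ring
  · rw [hσ] at hsgn' ⊢
    simp only [Units.val_neg, Units.val_one, Int.cast_neg, Int.cast_one, neg_mul, one_mul,
      Left.neg_neg_iff, sub_pos] at hsgn' ⊢
    have hlt : ∀ x, ‖V x 1‖ < ‖V x 0‖ := fun x =>
      lt_of_pow_lt_pow_left₀ 2 (norm_nonneg _) (hsgn' x)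
    have hp : IsZSPair (fun x => q x t) z (fun x => V x 0) (fun x => V x 1) :=
      ⟨fun x => (hzs x).1, fun x => (hzs x).2⟩
    refine ⟨fun x => V x 1, fun x => V x 0, _, by simpa using hp.swap,
      fun x => hVper x 1, fun x => hVper x 0, hlt, ?_⟩
    have hw : V 0 0 ≠ 0 := norm_pos_iff.1 ((norm_nonneg _).trans_lt (hlt 0))
    have hr : Complex.I * (1 - V 0 1 / V 0 0) / (1 + V 0 1 / V 0 0) = -ψ 0 1 := by
      have : 1 + V 0 1 / V 0 0 = 1 / V 0 0 := by
        rw [eq_div_iff hw, add_mul, div_mul_cancel₀ _ hw, one_mul, e0]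
      rw [this, e1]; field_simp; ring
    simp only [alphaForm, hr, alpha, signedConj_neg_one, hnorm, ← hψ, Complex.conj_conj]
    ring

/-! ### Lower bounds for the sine and the spectra far out on the real axis. -/

theorem norm_sin_sq (w : ℂ) :
    ‖Complex.sin w‖ ^ 2 = Real.sin w.re ^ 2 + Real.sinh w.im ^ 2 := by
  have h1 : Complex.sin w = (Real.sin w.re * Real.cosh w.im : ℝ)
      + (Real.cos w.re * Real.sinh w.im : ℝ) * Complex.I := by
    conv_lhs => rw [← Complex.re_add_im w, Complex.sin_add_mul_I]
    push_cast; ring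
  rw [h1, Complex.sq_norm, Complex.normSq_add_mul_I]
  linear_combination (Real.sin w.re ^ 2) * Real.cosh_sq w.im
    + (Real.sinh w.im ^ 2) * Real.cos_sq_add_sin_sq w.re

/-- Jordan's inequality for the real part, at the nearest multiple of π, and |sinh y| ≥ |y| for the
imaginary part. -/
theorem exists_le_norm_sin (w : ℂ) : ∃ k : ℤ, 2 / Real.pi * ‖w - k * Real.pi‖ ≤ ‖Complex.sin w‖ := by
  have hpi := Real.pi_pos
  refine ⟨round (w.re / Real.pi), ?_⟩
  set k := round (w.re / Real.pi)
  have h1 : |w.re - k * Real.pi| ≤ Real.pi / 2 := by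
    have h2 := mul_le_mul_of_nonneg_right (abs_sub_round (w.re / Real.pi)) hpi.le
    rw [← abs_of_pos hpi, ← abs_mul, abs_of_pos hpi, sub_mul, div_mul_cancel₀ _ hpi.ne'] at h2
    linarith
  have h2 := Real.mul_abs_le_abs_sin h1
  rw [Real.sin_sub_int_mul_pi, abs_mul, abs_zpow, abs_neg, abs_one, one_zpow, one_mul] at h2
  have h3 : |w.im| ≤ |Real.sinh w.im| := by
    rw [Real.abs_sinh]; exact Real.self_le_sinh_iff.2 (abs_nonneg _)
  have h4 : 2 / Real.pi ≤ 1 := by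
    rw [div_le_one hpi]; exact Real.two_le_pi
  have h5 : 2 / Real.pi * |w.im| ≤ |Real.sinh w.im| :=
    (mul_le_of_le_one_left (abs_nonneg _) h4).trans h3
  rw [← sq_le_sq₀ (by positivity) (norm_nonneg _), norm_sin_sq, mul_pow, Complex.sq_norm,
    Complex.normSq_apply]
  have e1 : (w - k * Real.pi).re = w.re - k * Real.pi := by simp
  have e2 : (w - k * Real.pi).im = w.im := by simp
  rw [e1, e2]
  have h6 := pow_le_pow_left₀ (by positivity) h2 2
  have h7 := pow_le_pow_left₀ (by positivity) h5 2
  rw [mul_pow, sq_abs, sq_abs] at h6 h7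
  linarith

theorem exp_div_four_le_norm_sin {w : ℂ} (hw : 1 ≤ |w.im|) :
    1 / 4 * Real.exp |w.im| ≤ ‖Complex.sin w‖ := by
  have h1 : |Real.sinh w.im| ≤ ‖Complex.sin w‖ := by
    rw [← sq_le_sq₀ (abs_nonneg _) (norm_nonneg _), norm_sin_sq, sq_abs]
    linarith [sq_nonneg (Real.sin w.re)]
  refine le_trans ?_ h1
  rw [Real.abs_sinh, Real.sinh_eq]
  have h2 : Real.exp (-|w.im|) ≤ 1 := Real.exp_le_one_iff.2 (by linarith)
  have h3 : 2 ≤ Real.exp |w.im| := by linarith [Real.add_one_le_exp |w.im|]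
  linarith

/-- On the real axis the monodromy matrix approaches that of the zero potential. -/
theorem IsPeriodicNLSSolution.exists_realMono_asymptotics (hq : IsPeriodicNLSSolution q L T)
    (hL : 0 < L) (ht : t ∈ T) : ∃ K R : ℝ, 1 ≤ R ∧ 0 ≤ K ∧ ∀ x : ℝ, R ≤ |x| →
      |realMono q L t 0 1 x - Real.sin (x * L)| ≤ K / |x| ∧
      |realMono q L t 0 0 x + realMono q L t 1 1 x - 2 * Real.cos (x * L)| ≤ K / |x| := by
  have h := hq.isPeriodicPotential hL ht
  obtain ⟨C, hC⟩ := hq.exists_bound hL ht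
  have hcont : ∀ σ : ℤˣ, Continuous (signedConj σ fun x => q x t) := fun σ => by
    rcases Int.units_eq_one_or σ with rfl | rfl
    · simpa using h.continuous
    · simpa [Function.comp_def] using Complex.continuous_conj.comp h.continuous
  obtain ⟨K₁, R₁, hR₁, hK₁⟩ := (hq.isApproxSlope_slopeTwo hL ht 1).exists_norm_sub_exp_le
    one_le_two hL (hcont 1) (fun x => by simpa only [norm_signedConj] using (hC x).1)
  obtain ⟨K₂, R₂, hR₂, hK₂⟩ := (hq.isApproxSlope_slopeTwo hL ht (-1)).exists_norm_sub_exp_le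
    one_le_two hL (hcont (-1)) (fun x => by simpa only [norm_signedConj] using (hC x).1)
  refine ⟨2 * max (max K₁ K₂) 0, max R₁ R₂, hR₁.trans (le_max_left _ _), by positivity,
    fun x hx => ?_⟩
  have hx1 : R₁ ≤ ‖(x : ℂ)‖ := by
    rw [Complex.norm_real]; exact (le_max_left _ _).trans hx
  have hx2 : R₂ ≤ ‖-(x : ℂ)‖ := by
    rw [norm_neg, Complex.norm_real]; exact (le_max_right _ _).trans hx
  have hx0 : 0 < |x| := by linarith [le_max_left R₁ R₂]
  set K := max (max K₁ K₂) 0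
  have hY := h.isPrincipalMatrix x
  set Y := principalMatrix q t x with hYd
  have hpair : ∀ j, IsZSPair (fun x => q x t) x (fun y => Y y 0 j) (fun y => Y y 1 j) := fun j =>
    ⟨fun y => (isZSSolution_iff.1 (hY.2 j) y).1, fun y => (isZSSolution_iff.1 (hY.2 j) y).2⟩
  have hone : ∀ j, ‖Y 0 0 j‖ + ‖Y 0 1 j‖ = 1 := by
    rw [hY.1, Fin.forall_fin_two]; simp
  have hfst : ∀ j, ‖Y L 0 j - Complex.exp (-(Complex.I * x) * L) * Y 0 0 j‖ ≤ K / |x| := fun j => by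
    have := hK₁ x hx1 _ _ (by simpa using hpair j)
    refine this.trans ?_
    rw [hone j, Complex.ofReal_im, abs_zero, zero_mul, Real.exp_zero, mul_one, mul_one,
      Complex.norm_real, Real.norm_eq_abs]
    exact div_le_div_of_nonneg_right ((le_max_left _ _).trans (le_max_left _ _)) hx0.le
  have hsnd : ∀ j, ‖Y L 1 j - Complex.exp (Complex.I * x * L) * Y 0 1 j‖ ≤ K / |x| := fun j => by
    have := hK₂ (-x) hx2 _ _ (by simpa using (hpair j).swap)
    rw [show -(Complex.I * -(x : ℂ)) * L = Complex.I * x * L by ring] at this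
    refine this.trans ?_
    rw [add_comm ‖Y 0 1 j‖, hone j, Complex.neg_im, Complex.ofReal_im, neg_zero, abs_zero, zero_mul, Real.exp_zero, mul_one,
      mul_one, norm_neg, Complex.norm_real, Real.norm_eq_abs]
    exact div_le_div_of_nonneg_right ((le_max_right _ _).trans (le_max_left _ _)) hx0.le
  have f0 := hfst 0
  have f1 := hfst 1
  have s0 := hsnd 0
  have s1 := hsnd 1
  simp only [hY.1, Matrix.one_apply_eq, Matrix.one_apply_ne (zero_ne_one' (Fin 2)),
    Matrix.one_apply_ne (one_ne_zero' (Fin 2)), mul_one, mul_zero, sub_zero] at f0 f1 s0 s1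
  have hKx : 0 ≤ K / |x| := (norm_nonneg _).trans f0
  constructor
  · rw [← Real.norm_eq_abs, ← Complex.norm_real, Complex.ofReal_sub, h.ofReal_realMono]
    have e : modMatrix q t x L 0 1 = Complex.I / 2 * (Y L 0 0 + Y L 1 0 - Y L 0 1 - Y L 1 1) := by
      rw [modMatrix, U_inv, ← hYd]
      simp only [U, Matrix.mul_apply, Fin.sum_univ_two]
      simp
      ring
    have e2 : ((Real.sin (x * L) : ℝ) : ℂ) = Complex.I / 2
        * (Complex.exp (-(Complex.I * x) * L) - Complex.exp (Complex.I * x * L)) := by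
      rw [Complex.ofReal_sin, Complex.sin]
      push_cast
      rw [show -((x : ℂ) * L) * Complex.I = -(Complex.I * x) * L by ring,
        show (x : ℂ) * L * Complex.I = Complex.I * x * L by ring]
      ring
    have e3 : modMatrix q t x L 0 1 - (Real.sin (x * L) : ℝ) = Complex.I / 2
        * ((Y L 0 0 - Complex.exp (-(Complex.I * x) * L)) + Y L 1 0 - Y L 0 1
          - (Y L 1 1 - Complex.exp (Complex.I * x * L))) := by
      rw [e, e2]; ring
    rw [e3, norm_mul, norm_div, Complex.norm_I, Complex.norm_ofNat]
    have := (norm_sub_le _ _).trans (add_le_add ((norm_sub_le _ _).trans (add_le_add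
      ((norm_add_le _ _).trans (add_le_add f0 s0)) f1)) s1)
    rw [mul_div_assoc]
    linarith
  · rw [← Real.norm_eq_abs, ← Complex.norm_real, Complex.ofReal_sub, Complex.ofReal_add,
      h.ofReal_realMono, h.ofReal_realMono, ← discriminant_eq, discriminant, Matrix.trace_fin_two]
    have e2 : ((2 * Real.cos (x * L) : ℝ) : ℂ)
        = Complex.exp (-(Complex.I * x) * L) + Complex.exp (Complex.I * x * L) := by
      rw [Complex.ofReal_mul, Complex.ofReal_cos, Complex.cos]
      push_cast
      rw [show -((x : ℂ) * L) * Complex.I = -(Complex.I * x) * L by ring,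
        show (x : ℂ) * L * Complex.I = Complex.I * x * L by ring]
      ring
    have e3 : 2 * (1 / 2 * (Y L 0 0 + Y L 1 1)) - ((2 * Real.cos (x * L) : ℝ) : ℂ)
        = (Y L 0 0 - Complex.exp (-(Complex.I * x) * L))
          + (Y L 1 1 - Complex.exp (Complex.I * x * L)) := by
      rw [e2]; ring
    rw [e3, mul_div_assoc]
    refine (norm_add_le _ _).trans ?_
    linarith

/-- At these points the leading term 2 cos(xL) of the trace vanishes, so the trace is O(1/x) and
eventually below 2 in modulus. This yields the unboundedness of the spectrum in both directions. -/
theorem IsPeriodicNLSSolution.exists_half_integer_mem_lax (hq : IsPeriodicNLSSolution q L T)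
    (hL : 0 < L) (ht : t ∈ T) : ∃ R : ℝ, ∀ k : ℤ, R ≤ |(Real.pi / 2 + k * Real.pi) / L| →
      (((Real.pi / 2 + k * Real.pi) / L : ℝ) : ℂ) ∈ laxSpectrum q t := by
  obtain ⟨K, R, hR, hK, hmono⟩ := hq.exists_realMono_asymptotics hL ht
  refine ⟨max R K, fun k hk => ?_⟩
  rw [(hq.isPeriodicPotential hL ht).ofReal_mem_lax]
  have h1 := (hmono _ ((le_max_left _ _).trans hk)).2
  rw [div_mul_cancel₀ _ hL.ne', Real.cos_add_int_mul_pi, Real.cos_pi_div_two, mul_zero, mul_zero,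
    sub_zero] at h1
  refine h1.trans ?_
  have h2 := div_le_one_of_le₀ ((le_max_right R K).trans hk) (abs_nonneg _)
  linarith

theorem IsPeriodicNLSSolution.lax_unbounded_above (hq : IsPeriodicNLSSolution q L T)
    (hL : 0 < L) (ht : t ∈ T) (R : ℝ) : ∃ x > R, (x : ℂ) ∈ laxSpectrum q t := by
  obtain ⟨R₀, h₀⟩ := hq.exists_half_integer_mem_lax hL ht
  have hpi := Real.pi_pos
  obtain ⟨k, hk⟩ := exists_int_gt ((max R R₀) * L / Real.pi)
  have h1 : max R R₀ < (Real.pi / 2 + k * Real.pi) / L := by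
    rw [lt_div_iff₀ hL]
    rw [div_lt_iff₀ hpi] at hk
    linarith
  exact ⟨_, (le_max_left _ _).trans_lt h1, h₀ k ((le_max_right _ _).trans
    (h1.le.trans (le_abs_self _)))⟩

theorem IsPeriodicNLSSolution.lax_unbounded_below (hq : IsPeriodicNLSSolution q L T)
    (hL : 0 < L) (ht : t ∈ T) (R : ℝ) : ∃ x < R, (x : ℂ) ∈ laxSpectrum q t := by
  obtain ⟨R₀, h₀⟩ := hq.exists_half_integer_mem_lax hL ht
  have hpi := Real.pi_pos
  obtain ⟨k, hk⟩ := exists_int_lt ((min R (-R₀)) * L / Real.pi - 1)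
  have h1 : (Real.pi / 2 + k * Real.pi) / L < min R (-R₀) := by
    rw [div_lt_iff₀ hL]
    rw [lt_sub_iff_add_lt, lt_div_iff₀ hpi] at hk
    linarith
  refine ⟨_, h1.trans_le (min_le_left _ _), h₀ k ?_⟩
  have h2 := neg_le_abs ((Real.pi / 2 + k * Real.pi) / L)
  have h3 := h1.le.trans (min_le_right R (-R₀))
  linarith

/-- Far out, the Dirichlet eigenvalues come close to every point of `(π / L) ℤ`. -/
theorem IsPeriodicNLSSolution.exists_dirichlet_near (hq : IsPeriodicNLSSolution q L T)
    (hL : 0 < L) (hT : IsOpen T) (ht : t ∈ T) {δ : ℝ} (hδ : 0 < δ) :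
    ∃ R : ℝ, ∀ k : ℤ, R ≤ |k * Real.pi / L| →
      ∃ μ : ℝ, (μ : ℂ) ∈ dirichletSpectrum q L t ∧ |μ - k * Real.pi / L| ≤ δ := by
  have h := hq.isPeriodicPotential hL ht
  have hpi := Real.pi_pos
  obtain ⟨K, R, hR, hK, hmono⟩ := hq.exists_realMono_asymptotics hL ht
  -- The second bound keeps εL in (0, π), so that sin(εL) > 0.
  set ε := min δ (Real.pi / (2 * L)) with hε
  have hε0 : 0 < ε := lt_min hδ (by positivity)
  have hεL : ε * L < Real.pi := by
    have h1 := mul_le_mul_of_nonneg_right (min_le_right δ (Real.pi / (2 * L))) hL.le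
    have h2 : Real.pi / (2 * L) * L = Real.pi / 2 := by field_simp
    linarith
  have hsin : 0 < Real.sin (ε * L) := Real.sin_pos_of_pos_of_lt_pi (by positivity) hεL
  -- The summand ε keeps m ± ε beyond the threshold past which the error K/|x| is smaller than
  -- sin(εL); M₀₁ then has the signs of the sine at m ± ε.
  refine ⟨max R (K / Real.sin (ε * L) + 1) + ε, fun k hk => ?_⟩
  set m := k * Real.pi / L with hm
  have hmL : m * L = k * Real.pi := by rw [hm]; field_simp
  have hbound : ∀ y : ℝ, |y| = ε → |realMono q L t 0 1 (m + y) - Real.sin ((m + y) * L)|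
      < Real.sin (ε * L) := fun y hy => by
    have h1 : max R (K / Real.sin (ε * L) + 1) ≤ |m + y| := by
      have := abs_sub_abs_le_abs_sub m (-y)
      rw [abs_neg, sub_neg_eq_add] at this
      linarith
    refine (hmono _ ((le_max_left _ _).trans h1)).1.trans_lt ?_
    have h2 : K / Real.sin (ε * L) + 1 ≤ |m + y| := (le_max_right _ _).trans h1
    have h3 : 0 ≤ K / Real.sin (ε * L) := by positivity
    have h4 : K / Real.sin (ε * L) < |m + y| := by linarith
    rw [div_lt_iff₀ (by linarith)]
    rw [div_lt_iff₀ hsin] at h4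
    linarith
  have hp := hbound ε (abs_of_pos hε0)
  have hn := hbound (-ε) (by rw [abs_neg, abs_of_pos hε0])
  rw [add_mul, hmL, add_comm (k * Real.pi), Real.sin_add_int_mul_pi] at hp hn
  rw [neg_mul, Real.sin_neg] at hn
  have hcont : Continuous (realMono q L t 0 1) := continuous_iff_continuousAt.2 fun x =>
    (hq.hasDerivAt_realMono hL hT ht 0 1 x).continuousAt
  have hle : m - ε ≤ m + ε := by linarith
  have hzero : ∃ μ ∈ Set.Icc (m - ε) (m + ε), realMono q L t 0 1 μ = 0 := by
    rw [abs_lt] at hp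
    rw [← sub_eq_add_neg, abs_lt] at hn
    rcases Int.even_or_odd k with hk' | hk'
    · rw [hk'.neg_one_zpow] at hp hn
      exact intermediate_value_Icc hle hcont.continuousOn
        ⟨by linarith [hn.2], by linarith [hp.1]⟩
    · rw [hk'.neg_one_zpow] at hp hn
      exact intermediate_value_Icc' hle hcont.continuousOn
        ⟨by linarith [hp.2], by linarith [hn.1]⟩
  obtain ⟨μ, hμ, h0⟩ := hzero
  refine ⟨μ, (h.ofReal_mem_dirichlet μ).2 h0, ?_⟩
  rw [abs_le]
  have := min_le_left δ (Real.pi / (2 * L))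
  constructor <;> linarith [hμ.1, hμ.2]

/-- Away from the Dirichlet eigenvalues, `sin (z L)` is as large as it can be. -/
theorem IsPeriodicNLSSolution.exists_le_norm_sin_of_dist (hq : IsPeriodicNLSSolution q L T)
    (hL : 0 < L) (hT : IsOpen T) (ht : t ∈ T) {δ : ℝ} (hδ : 0 < δ) :
    ∃ c > 0, ∃ R : ℝ, ∀ z : ℂ, R ≤ ‖z‖ → (∀ μ ∈ dirichletSpectrum q L t, δ ≤ dist z μ) →
      c * Real.exp (|z.im| * L) ≤ ‖Complex.sin (z * L)‖ := by
  have hpi := Real.pi_pos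
  -- A Dirichlet eigenvalue within δ/4 of each far zero of the sine keeps z, at distance δ from the
  -- eigenvalues, at least δ/2 away from that zero.
  obtain ⟨R, hR⟩ := hq.exists_dirichlet_near hL hT ht (show 0 < δ / 4 by positivity)
  set c := min (1 / 4) (L * δ / (Real.pi * Real.exp 1)) with hc
  refine ⟨c, by positivity, R + δ / 2, fun z hz hdist => ?_⟩
  have him : |(z * (L : ℂ)).im| = |z.im| * L := by
    rw [Complex.im_mul_ofReal, abs_mul, abs_of_pos hL]
  -- Away from the real axis the sine is exponentially large by itself; in the remaining strip the
  -- exponential is at most e and the distance to the zeros decides.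
  rcases le_total 1 (|z.im| * L) with h1 | h1
  · have h2 := exp_div_four_le_norm_sin (w := z * L) (by rwa [him])
    rw [him] at h2
    refine le_trans ?_ h2
    gcongr
    exact min_le_left _ _
  · obtain ⟨k, hk⟩ := exists_le_norm_sin (z * L)
    have e : z * (L : ℂ) - k * Real.pi = L * (z - (k * Real.pi / L : ℝ)) := by
      have : (L : ℂ) ≠ 0 := by exact_mod_cast hL.ne'
      push_cast; field_simp
    rw [e, norm_mul, Complex.norm_real, Real.norm_eq_abs, abs_of_pos hL] at hk
    have hfar : δ / 2 ≤ ‖z - (k * Real.pi / L : ℝ)‖ := by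
      by_contra! hcon
      have h2 : R ≤ |k * Real.pi / L| := by
        have := norm_sub_norm_le z ((k * Real.pi / L : ℝ) : ℂ)
        rw [Complex.norm_real, Real.norm_eq_abs] at this
        linarith
      obtain ⟨μ, hμ, hμk⟩ := hR k h2
      have h3 := hdist μ hμ
      have h4 := dist_triangle z ((k * Real.pi / L : ℝ) : ℂ) μ
      have h5 : dist ((k * Real.pi / L : ℝ) : ℂ) μ = |μ - k * Real.pi / L| := by
        rw [dist_comm, dist_eq_norm, ← Complex.ofReal_sub, Complex.norm_real, Real.norm_eq_abs]
      rw [h5, dist_eq_norm z ((k * Real.pi / L : ℝ) : ℂ)] at h4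
      linarith
    refine le_trans ?_ hk
    calc c * Real.exp (|z.im| * L) ≤ L * δ / (Real.pi * Real.exp 1) * Real.exp 1 := by
          gcongr
          exact min_le_right _ _
      _ = 2 / Real.pi * (L * (δ / 2)) := by field_simp
      _ ≤ _ := by gcongr

/-! ### Asymptotics of α in sectors and up to the real axis. -/

theorem norm_units_mul (σ : ℤˣ) (z : ℂ) : ‖((σ : ℤ) : ℂ) * z‖ = ‖z‖ := by
  rcases Int.units_eq_one_or σ with rfl | rfl <;> simp

theorem abs_im_units_mul (σ : ℤˣ) (z : ℂ) : |(((σ : ℤ) : ℂ) * z).im| = |z.im| := by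
  rcases Int.units_eq_one_or σ with rfl | rfl <;> simp

theorem norm_alpha_sub_le {s σ : ℤˣ} {z p w : ℂ} {C K : ℝ}
    (hC : ∀ x, ‖q x t‖ ≤ C ∧ ‖dx q x t‖ ≤ C ∧ ‖dxx q x t‖ ≤ C) (hz : 1 ≤ ‖z‖)
    (hzK : 2 * (C + K) ≤ ‖z‖) (hw : w ≠ 0)
    (hα : alpha s q L t z = ((σ : ℤ) : ℂ) * alphaForm (signedConj σ (fun x => q x t) 0)
      (signedConj σ (fun x => dx q x t) 0) ((σ : ℤ) * z) (p / w))
    (hp : ‖p - slopeTwo (signedConj σ fun x => q x t) (signedConj σ fun x => dx q x t)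
      ((σ : ℤ) * z) 0 * w‖ ≤ K / ‖z‖ ^ 3 * ‖w‖) :
    ‖alpha s q L t z - ((σ : ℤ) : ℂ) * (2 * Complex.I * z ^ 2)‖
      ≤ 2 * (4 * K + 2 * C * K + C ^ 2 + (C + C ^ 2) * (C + K)) / ‖z‖ := by
  have hσ2 : (((σ : ℤ) : ℂ) * z) ^ 2 = z ^ 2 := by
    rcases Int.units_eq_one_or σ with rfl | rfl <;> simp
  have hwpos : 0 < ‖w‖ := norm_pos_iff.2 hw
  have key := norm_alphaForm_sub_le (a := signedConj σ (fun x => q x t) 0)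
    (b := signedConj σ (fun x => dx q x t) 0) (ζ := (σ : ℤ) * z) (n := p / w) (C := C) (K := K)
    (by rw [norm_signedConj]; exact (hC 0).1) (by rw [norm_signedConj]; exact (hC 0).2.1)
    (by rwa [norm_units_mul]) (by rwa [norm_units_mul]) (by
      rw [norm_units_mul]
      refine le_of_mul_le_mul_right ?_ hwpos
      rw [← norm_mul, sub_mul, div_mul_cancel₀ _ hw]
      exact hp)
  rw [norm_units_mul, hσ2] at key
  rwa [hα, ← mul_sub, norm_units_mul]

/-- The asymptotics of `α` in sectors of the open half-plane. -/
theorem IsPeriodicNLSSolution.exists_norm_alpha_sub_le_of_sector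
    (hq : IsPeriodicNLSSolution q L T) (hL : 0 < L) (ht : t ∈ T) (s e : ℤˣ) {θ : ℝ}
    (hθ : 0 < θ) : ∃ K R : ℝ, 1 ≤ R ∧ ∀ z : ℂ, R ≤ ‖z‖ → θ * ‖z‖ ≤ ((e : ℤ) : ℝ) * z.im →
      ‖alpha s q L t z - (((s * e : ℤˣ) : ℤ) : ℂ) * (2 * Complex.I * z ^ 2)‖ ≤ K / ‖z‖ := by
  have h := hq.isPeriodicPotential hL ht
  obtain ⟨C, hC⟩ := hq.exists_bound hL ht
  -- The residual exponent k = 2 becomes 3 in the sector, exactly the order that `norm_alpha_sub_le`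
  -- needs.
  obtain ⟨K, R, hR, hK⟩ :=
    (hq.isApproxSlope_slopeTwo hL ht (s * e)).exists_norm_bloch_sub_le_of_sector hL
      (fun x => by simpa only [norm_signedConj] using (hC x).1) hθ
  refine ⟨2 * (4 * K + 2 * C * K + C ^ 2 + (C + C ^ 2) * (C + K)), max R (2 * (C + K)), hR.trans (le_max_left _ _), fun z hz hsec => ?_⟩
  have hzR : R ≤ ‖z‖ := (le_max_left _ _).trans hz
  have hz1 : 1 ≤ ‖z‖ := hR.trans hzR
  have him : 0 < ((e : ℤ) : ℝ) * z.im := lt_of_lt_of_le (by positivity) hsec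
  obtain ⟨p, w, ρ, hpw, hp, hw, hlt, hα⟩ := h.exists_bloch_pair s e him
  have hw0 : ∀ x, w x ≠ 0 := fun x => norm_pos_iff.1 ((norm_nonneg _).trans_lt (hlt x))
  refine norm_alpha_sub_le (p := p 0) (w := w 0) hC hz1 ((le_max_right _ _).trans hz) (hw0 0) hα ?_
  have := hK _ (by rwa [norm_units_mul]) p w hpw ρ hp hw (fun x => (hlt x).le) hw0 (by
    rw [norm_units_mul, abs_im_units_mul]
    refine hsec.trans ((le_abs_self _).trans (le_of_eq ?_))
    rcases Int.units_eq_one_or e with rfl | rfl <;> simp)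
  rwa [norm_units_mul] at this

/-- The asymptotics of `α` in the open half-plane away from the Dirichlet eigenvalues. -/
theorem IsPeriodicNLSSolution.exists_norm_alpha_sub_le_of_dist
    (hq : IsPeriodicNLSSolution q L T) (hL : 0 < L) (hT : IsOpen T) (ht : t ∈ T)
    (h3 : ContDiff ℝ 3 fun x => q x t) (s e : ℤˣ) {δ : ℝ} (hδ : 0 < δ) :
    ∃ K R : ℝ, 1 ≤ R ∧ ∀ z : ℂ, R ≤ ‖z‖ → z ∈ openHalfPlane e →
      (∀ μ ∈ dirichletSpectrum q L t, δ ≤ dist z μ) →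
      ‖alpha s q L t z - (((s * e : ℤˣ) : ℤ) : ℂ) * (2 * Complex.I * z ^ 2)‖ ≤ K / ‖z‖ := by
  have h := hq.isPeriodicPotential hL ht
  obtain ⟨C, hC⟩ := hq.exists_bound hL ht
  obtain ⟨c, hc, R₀, hsin⟩ := hq.exists_le_norm_sin_of_dist hL hT ht hδ
  have hcont : Continuous (signedConj (s * e) fun x => q x t) :=
    continuous_iff_continuousAt.2 fun x => (hasDerivAt_signedConj (s * e)
      (f' := fun x => dx q x t) (hq.hasDerivAt_x ht x)).continuousAt
  obtain ⟨K, R, hR, hK⟩ :=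
    (hq.isApproxSlope_slopeThree hL ht h3 (s * e)).exists_norm_bloch_sub_le
      (by rw [conj_signedConj]; exact hq.isApproxSlope_slopeThree hL ht h3 (-(s * e)))
      (by norm_num) hL hcont (fun x => by simpa only [norm_signedConj] using (hC x).1) hc
  set K' := K + (C + C ^ 3) with hK'
  refine ⟨2 * (4 * K' + 2 * C * K' + C ^ 2 + (C + C ^ 2) * (C + K')),
    max (max R R₀) (2 * (C + K')),
    hR.trans ((le_max_left _ _).trans (le_max_left _ _)), fun z hz him hdist => ?_⟩
  have hzR : R ≤ ‖z‖ := ((le_max_left _ _).trans (le_max_left _ _)).trans hz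
  have hz1 : 1 ≤ ‖z‖ := hR.trans hzR
  obtain ⟨p, w, ρ, hpw, hp, hw, hlt, hα⟩ := h.exists_bloch_pair s e him
  have hw0 : w 0 ≠ 0 := norm_pos_iff.1 ((norm_nonneg _).trans_lt (hlt 0))
  refine norm_alpha_sub_le (p := p 0) (w := w 0) hC hz1 ((le_max_right _ _).trans hz) hw0 hα ?_
  set σ := s * e
  have h1 := hK (((σ : ℤ) : ℂ) * z) (by rwa [norm_units_mul]) p w hpw ρ (by simpa using hp 0)
    (by simpa using hw 0) (hlt 0).le hw0 (by
      rw [abs_im_units_mul]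
      refine (hsin z (((le_max_right _ _).trans (le_max_left _ _)).trans hz) hdist).trans
        (le_of_eq ?_)
      rcases Int.units_eq_one_or σ with hσ | hσ <;> rw [hσ] <;> simp)
  rw [norm_units_mul] at h1
  -- The cubic term only served to reach residual order 3; being itself O(ζ⁻³), it can now be
  -- dropped.
  have h2 := norm_cubicTerm_le (u := signedConj σ fun x => q x t)
    (u₂ := signedConj σ fun x => dxx q x t) (C := C)
    (fun x => by rw [norm_signedConj]; exact (hC x).1)
    (fun x => by rw [norm_signedConj]; exact (hC x).2.2)
    (ζ := (σ : ℤ) * z) (by rwa [norm_units_mul]) 0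
  rw [norm_units_mul] at h2
  have h4 := mul_le_mul_of_nonneg_right h2 (norm_nonneg (w 0))
  rw [← norm_mul] at h4
  have h5 := (norm_add_le _ _).trans (add_le_add h1 h4)
  rw [← add_mul, ← add_div] at h5
  refine le_trans (le_of_eq ?_) h5
  congr 1
  rw [slopeThree]
  ring

theorem isBigO_one_div_of_bound {f : ℂ → ℂ} {S : Set ℂ} {K R : ℝ}
    (hf : ∀ z, R ≤ ‖z‖ → z ∈ S → ‖f z‖ ≤ K / ‖z‖) :
    f =O[Bornology.cobounded ℂ ⊓ Filter.principal S] fun z => 1 / z := by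
  rw [Asymptotics.isBigO_iff]
  refine ⟨K, Filter.mem_inf_principal.2 ?_⟩
  filter_upwards [eventually_cobounded_le_norm R] with z hz hS
  rw [norm_div, norm_one, mul_one_div]
  exact hf z hz hS

theorem openHalfPlane_subset (e : ℤˣ) : openHalfPlane e ⊆ halfPlane e :=
  Set.ofPred_subset_ofPred.2 fun _ => le_of_lt

/-- Moving vertically away from the real axis increases the distance to every real point. So both
conditions, |z| ≥ R and distance δ from the Dirichlet eigenvalues, survive when a boundary point is
approached from inside. -/
theorem norm_vertical {e : ℤˣ} {z : ℂ} (hz : z ∈ halfPlane e) {y : ℝ} (hy : 0 ≤ y) {μ : ℂ}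
    (hμ : μ.im = 0) :
    ‖z - μ‖ ≤ ‖z + (((e : ℤ) : ℝ) * y : ℝ) * Complex.I - μ‖ := by
  have h1 : 0 ≤ ((e : ℤ) : ℝ) * z.im := hz
  rw [← sq_le_sq₀ (norm_nonneg _) (norm_nonneg _), Complex.sq_norm, Complex.sq_norm,
    Complex.normSq_apply, Complex.normSq_apply]
  simp only [Complex.sub_re, Complex.sub_im, Complex.add_re, Complex.add_im, Complex.re_ofReal_mul,
    Complex.im_ofReal_mul, Complex.I_re, Complex.I_im, mul_zero, mul_one, add_zero, hμ, sub_zero]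
  nlinarith [units_sq_real e, mul_nonneg h1 hy, mul_nonneg hy hy,
    mul_nonneg (mul_self_nonneg ((e : ℤ) : ℝ)) (mul_nonneg hy hy)]

/-- A bound on the open half-plane away from the Dirichlet eigenvalues passes to the boundary. -/
theorem IsPeriodicPotential.norm_le_of_openHalfPlane (h : IsPeriodicPotential q L t) {e : ℤˣ}
    {f : ℂ → ℂ} (hf : ContinuousOn f (halfPlane e \ dirichletSpectrum q L t)) {K R δ : ℝ}
    (hδ : 0 < δ) (hR : 1 ≤ R)
    (hb : ∀ z : ℂ, R ≤ ‖z‖ → z ∈ openHalfPlane e →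
      (∀ μ ∈ dirichletSpectrum q L t, δ ≤ dist z μ) → ‖f z‖ ≤ K / ‖z‖) {z : ℂ} (hzR : R ≤ ‖z‖)
    (hz : z ∈ halfPlane e) (hdist : ∀ μ ∈ dirichletSpectrum q L t, δ ≤ dist z μ) :
    ‖f z‖ ≤ K / ‖z‖ := by
  have hzd : z ∉ dirichletSpectrum q L t := fun hmem => by
    have := hdist z hmem
    rw [dist_self] at this
    linarith
  have hz0 : z ≠ 0 := norm_pos_iff.1 (by linarith)
  have hsub : openHalfPlane e ⊆ halfPlane e \ dirichletSpectrum q L t := fun w hw =>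
    ⟨openHalfPlane_subset e hw, fun hmem => im_ne_zero_of_mem hw (h.im_eq_zero_of_dirichlet hmem)⟩
  have ht := tendsto_vertical hz
  have h1 : Filter.Tendsto (fun y : ℝ => ‖f (z + (((e : ℤ) : ℝ) * y : ℝ) * Complex.I)‖)
      (𝓝[>] 0) (𝓝 ‖f z‖) :=
    (((hf z ⟨hz, hzd⟩).mono_left (nhdsWithin_mono z hsub)).comp ht).norm
  have h2 : Filter.Tendsto (fun y : ℝ => K / ‖z + (((e : ℤ) : ℝ) * y : ℝ) * Complex.I‖)
      (𝓝[>] 0) (𝓝 (K / ‖z‖)) :=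
    tendsto_const_nhds.div (ht.mono_right nhdsWithin_le_nhds).norm (norm_ne_zero_iff.2 hz0)
  refine le_of_tendsto_of_tendsto h1 h2 ?_
  filter_upwards [self_mem_nhdsWithin] with y hy
  have hy0 : (0 : ℝ) < y := hy
  refine hb _ ?_ (vertical_mem hz hy0) fun μ hμ => ?_
  · refine hzR.trans ?_
    simpa using norm_vertical hz hy0.le (μ := 0) rfl
  · refine (hdist μ hμ).trans ?_
    rw [dist_eq_norm, dist_eq_norm]
    exact norm_vertical hz hy0.le (h.im_eq_zero_of_dirichlet hμ)

/-- The continuous extension of `α` to the closed half-plane and its asymptotics. -/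
theorem IsPeriodicNLSSolution.exists_extension_asymptotics (hq : IsPeriodicNLSSolution q L T)
    (hL : 0 < L) (hT : IsOpen T) (ht : t ∈ T) (s e : ℤˣ) :
    ∃ β : ℂ → ℂ,
      Set.EqOn β (alpha s q L t) (halfPlane e \ laxSpectrum q t) ∧
      ContinuousOn β (halfPlane e \ dirichletSpectrum q L t) ∧
      (∀ θ : ℝ, 0 < θ →
        (fun z => β z - ((s : ℤ) : ℂ) * ((e : ℤ) : ℂ) * (2 * Complex.I * z ^ 2))
          =O[Bornology.cobounded ℂ ⊓ Filter.principal {z | θ * ‖z‖ ≤ ((e : ℤ) : ℝ) * z.im}]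
            (fun z => 1 / z)) ∧
      (ContDiff ℝ 3 (fun x => q x t) → ∀ δ : ℝ, 0 < δ →
        (fun z => β z - ((s : ℤ) : ℂ) * ((e : ℤ) : ℂ) * (2 * Complex.I * z ^ 2))
          =O[Bornology.cobounded ℂ ⊓ Filter.principal {z | z ∈ halfPlane e ∧
              ∀ μ ∈ dirichletSpectrum q L t, δ ≤ dist z μ}]
            (fun z => 1 / z)) := by
  have h := hq.isPeriodicPotential hL ht
  obtain ⟨β, hβ, hc⟩ := hq.exists_extension hL hT ht s e
  have hse : ((s : ℤ) : ℂ) * ((e : ℤ) : ℂ) = (((s * e : ℤˣ) : ℤ) : ℂ) := by push_cast; ring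
  have hβo : ∀ z ∈ openHalfPlane e, β z = alpha s q L t z := fun z hz =>
    hβ ⟨openHalfPlane_subset e hz, h.not_mem_lax_of_openHalfPlane hz⟩
  rw [hse]
  refine ⟨β, hβ, hc, fun θ hθ => ?_, fun h3 δ hδ => ?_⟩
  · obtain ⟨K, R, hR, hK⟩ := hq.exists_norm_alpha_sub_le_of_sector hL ht s e hθ
    refine isBigO_one_div_of_bound (K := K) (R := R) fun z hz hsec => ?_
    have hzp : 0 < ‖z‖ := by linarith
    rw [hβo z (lt_of_lt_of_le (mul_pos hθ hzp) hsec)]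
    exact hK z hz hsec
  · obtain ⟨K, R, hR, hK⟩ := hq.exists_norm_alpha_sub_le_of_dist hL hT ht h3 s e hδ
    refine isBigO_one_div_of_bound (K := K) (R := R) fun z hz hmem => ?_
    have hpoly : Continuous fun z : ℂ =>
        (((s * e : ℤˣ) : ℤ) : ℂ) * (2 * Complex.I * z ^ 2) := by fun_prop
    refine h.norm_le_of_openHalfPlane (e := e) (hc.sub hpoly.continuousOn) hδ hR
      (fun w hw hwo hwd => ?_) hz hmem.1 hmem.2
    rw [Pi.sub_apply, hβo w hwo]
    exact hK w hw hwo hwd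

/-- A Dirichlet eigenvalue with nonzero sign is the moving eigenvalue of some gap. -/
theorem IsPeriodicNLSSolution.exists_gap_of_sign_ne_zero (hq : IsPeriodicNLSSolution q L T)
    (hL : 0 < L) (hT : IsOpen T) (ht : t ∈ T) {μ : ℂ} (hμ : μ ∈ dirichletSpectrum q L t)
    (hσ : dirichletSign q L t μ ≠ 0) :
    ∃ a b : ℝ, IsSpectralGap q t a b ∧ μ = (gapDirichlet q L a b t : ℂ) := by
  have h := hq.isPeriodicPotential hL ht
  have hre : ((μ.re : ℝ) : ℂ) = μ :=
    Complex.ext rfl (h.im_eq_zero_of_dirichlet hμ).symm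
  rw [← hre] at hμ hσ
  obtain ⟨a, b, hg, hab⟩ := hq.exists_gap hL hT ht (hq.lax_unbounded_above hL ht)
    (hq.lax_unbounded_below hL ht) (h.not_mem_lax_of_sign_ne_zero hμ hσ)
  refine ⟨a, b, hg, ?_⟩
  rw [← hre]
  exact congrArg _ (hq.gapDirichlet_eq hL hT ht hg hab hμ).symm

end PeriodicNLS

end

theorem mainTheorem8 (q : ℝ → ℝ → ℂ) (L : ℝ) (hL : 0 < L) (T : Set ℝ) (hT : IsOpen T)
    (hq : PeriodicNLS.IsPeriodicNLSSolution q L T) (t : ℝ) (ht : t ∈ T) :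
    -- the Bloch-Floquet solutions are well defined and satisfy the evolution equation
    (∀ s : ℤˣ, ∀ z : ℂ, z ∉ PeriodicNLS.laxSpectrum q t →
      ¬ (z ∈ PeriodicNLS.dirichletSpectrum q L t ∧ PeriodicNLS.dirichletSign q L t z = (s : ℤ)) →
        PeriodicNLS.IsSmallMultiplier q L t z (PeriodicNLS.multiplier q L t z) ∧
        PeriodicNLS.IsNormalizedBloch s q L t z (PeriodicNLS.bloch s q L t z) ∧
        (∀ v, PeriodicNLS.IsNormalizedBloch s q L t z v → v = PeriodicNLS.bloch s q L t z) ∧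
        ∀ x : ℝ, HasDerivAt (fun τ => PeriodicNLS.bloch s q L τ z x)
          (PeriodicNLS.modLaxA q t (PeriodicNLS.bloch s q L t z) x
            - PeriodicNLS.alpha s q L t z • PeriodicNLS.bloch s q L t z x) t) ∧
    -- asymptotics on the closed half-planes; `β` is `α` together with its boundary values
    (∀ s e : ℤˣ, ∃ β : ℂ → ℂ,
      Set.EqOn β (PeriodicNLS.alpha s q L t)
        (PeriodicNLS.halfPlane e \ PeriodicNLS.laxSpectrum q t) ∧
      ContinuousOn β (PeriodicNLS.halfPlane e \ PeriodicNLS.dirichletSpectrum q L t) ∧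
      (∀ θ : ℝ, 0 < θ →
        (fun z => β z - ((s : ℤ) : ℂ) * ((e : ℤ) : ℂ) * (2 * Complex.I * z ^ 2))
          =O[Bornology.cobounded ℂ ⊓ Filter.principal {z | θ * ‖z‖ ≤ ((e : ℤ) : ℝ) * z.im}]
            (fun z => 1 / z)) ∧
      (ContDiff ℝ 3 (fun x => q x t) → ∀ δ : ℝ, 0 < δ →
        (fun z => β z - ((s : ℤ) : ℂ) * ((e : ℤ) : ℂ) * (2 * Complex.I * z ^ 2))
          =O[Bornology.cobounded ℂ ⊓ Filter.principal {z | z ∈ PeriodicNLS.halfPlane e ∧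
              ∀ μ ∈ PeriodicNLS.dirichletSpectrum q L t, δ ≤ dist z μ}]
            (fun z => 1 / z))) ∧
    -- the moving Dirichlet eigenvalues are well defined, and those with nonzero sign lie in gaps
    (∀ a b : ℝ, PeriodicNLS.IsSpectralGap q t a b →
      ∃! μ : ℝ, μ ∈ Set.Icc a b ∧ (μ : ℂ) ∈ PeriodicNLS.dirichletSpectrum q L t) ∧
    (∀ μ ∈ PeriodicNLS.dirichletSpectrum q L t, PeriodicNLS.dirichletSign q L t μ ≠ 0 →
      ∃ a b : ℝ, PeriodicNLS.IsSpectralGap q t a b ∧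
        μ = (PeriodicNLS.gapDirichlet q L a b t : ℂ)) ∧
    -- poles of `α` and their residues
    (∀ s : ℤˣ, ∀ a b : ℝ, PeriodicNLS.IsSpectralGap q t a b →
      PeriodicNLS.dirichletSign q L t (PeriodicNLS.gapDirichlet q L a b t) = (s : ℤ) →
      ∃ μ' : ℝ, HasDerivAt (fun τ => PeriodicNLS.gapDirichlet q L a b τ) μ' t ∧
        (∃ g : ℂ → ℂ, AnalyticAt ℂ g (PeriodicNLS.gapDirichlet q L a b t) ∧
          ∀ᶠ z in 𝓝[≠] (PeriodicNLS.gapDirichlet q L a b t : ℂ),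
            PeriodicNLS.alpha s q L t z =
              -(μ' : ℂ) / (z - (PeriodicNLS.gapDirichlet q L a b t : ℂ)) + g z) ∧
        (μ' ≠ 0 → meromorphicOrderAt (PeriodicNLS.alpha s q L t)
          (PeriodicNLS.gapDirichlet q L a b t : ℂ) = -1)) := by
  have h := hq.isPeriodicPotential hL ht
  refine ⟨fun s z hz hd => ⟨h.isSmallMultiplier hz, h.isNormalizedBloch hz hd,
    fun v hv => h.bloch_unique hz hd hv, fun x => hq.hasDerivAt_bloch hL hT ht hz hd x⟩,
    fun s e => hq.exists_extension_asymptotics hL hT ht s e,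
    fun a b hg => hq.gap_exists_unique hL hT ht hg,
    fun μ hμ hσ => hq.exists_gap_of_sign_ne_zero hL hT ht hμ hσ,
    fun s a b hg hσ => hq.alpha_pole hL hT ht hg hσ⟩
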